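/- **Setting.** Let $N,k\ge 1$ be integers and let $\gamma=(\gamma_{ij})_{1\le i,j\le N}$ be a symmetric real matrix with entries $\gamma_{ij}\ge 0$, not all zero; put $\gamma_{\max}=\max_{i,j}\gamma_{ij}>0$. Let $X_N=\big(\gamma_{ij}\,x_{ij}/\sqrt N\big)_{i,j}$ be a GUE matrix with variance profile $(\gamma_{ij}^2)$: $x_{ji}=\overline{x_{ij}}$, the variables $x_{ij}$ with $j\le i$ are independent, each $x_{ii}$ is a standard real Gaussian, and each $x_{ij}$ with $i\neq j$ is a standard complex Gaussian (its real and imaginary parts are independent, centered, of variance $1/2$). Let $Y_N$ be a deterministic real diagonal $N\times N$ matrix and $H_N=X_N+Y_N$. Let $\Theta_k$ be a $k\times k$ real diagonal matrix with nonzero diagonal entries, and let $U$ be an $N\times k$ complex matrix with orthonormal columns, $U^*U=I_k$. Write $\|\cdot\|$ for the operator norm, $\Delta(A)$ for the diagonal part of a matrix $A$, $\mathrm D_N^{+}$ (resp. $\mathrm D_N^{-}$) for the set of complex diagonal $N\times N$ matrices all of whose diagonal entries have positive (resp. negative) imaginary part, and $\mathcal R_N(\Lambda)=\mathrm{diag}_i\big(\sum_{j=1}^N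 \tfrac{\gamma_{ij}^2}{N}\Lambda(j,j)\big)$. **Statement.** There is exactly one function $G^\square_{H_N}:\mathrm D_N^+\to\mathrm D_N^-$, analytic in each of the $N$ diagonal variables, such that $$G^\square_{H_N}(\Lambda)=\Delta\Big[\big(\Lambda-\mathcal R_N(G^\square_{H_N}(\Lambda))-Y_N\big)^{-1}\Big]\qquad\text{for all }\Lambda\in\mathrm D_N^+ .$$ For $\operatorname{Im}\lambda>0$ put $$\beta_k(\lambda)=I_k-U^*(\lambda I_N-H_N)^{-1}U\Theta_k,\qquad \beta_k^\square(\lambda)=I_k-U^*G^\square_{H_N}(\lambda I_N)U\Theta_k .$$ Then for all $\delta\in(0,1)$, all $d>0$ and all $\lambda\in\mathbb C$ with $\operatorname{Im}\lambda>0$ and $\operatorname{Im}\lambda\ge\gamma_{\max}N^{-1/4}(1-\delta)^{-1/6}$, $$\mathbb P\Big(\|\beta_k(\lambda)-\beta_k^\square(\lambda)\|\ \ge\ \|\Theta_k\|\,\varepsilon'_N(d)\Big)\ \le\ 4k^2N^{-d},$$ where $$\varepsilon'_N(d)=\sqrt2\,k\,\gamma_{\max}\,\frac{\sqrt{d\log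 N}}{(\operatorname{Im}\lambda)^2}\,N^{-1/2}+\Big(1+\frac{\gamma_{\max}^2}{\delta(\operatorname{Im}\lambda)^2}\Big)\frac{\gamma_{\max}^4}{N^{3/2}(\operatorname{Im}\lambda)^5}.$$ -/

import Mathlib

open MeasureTheory ProbabilityTheory
-- `‖A‖` for a complex matrix `A` is the operator norm induced by the Euclidean norms.
open scoped Matrix.Norms.L2Operator

noncomputable section

/-- The law of a standard complex Gaussian variable (centered, circular, `E|z|² = 1`): its real and
imaginary parts are independent real Gaussian variables, centered with variance `1/2`. -/
def stdComplexGaussian : Measure ℂ :=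
  ((gaussianReal 0 (1 / 2)).prod (gaussianReal 0 (1 / 2))).map
    (fun p : ℝ × ℝ => (⟨p.1, p.2⟩ : ℂ))

/-- The (unnormalized) entries of a GUE matrix: a Hermitian array of random variables whose
entries on and below the diagonal are independent, with standard real Gaussian diagonal entries
and standard complex Gaussian off-diagonal entries. -/
structure IsGUEArray {Ω : Type*} [MeasurableSpace Ω] (P : Measure Ω) {N : ℕ}
    (x : Fin N → Fin N → Ω → ℂ) : Prop where
  herm : ∀ i j ω, x j i ω = star (x i j ω)
  indep : iIndepFun (fun (p : {p : Fin N × Fin N // p.2 ≤ p.1}) => x p.1.1 p.1.2) P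
  law_diag : ∀ i, HasLaw (x i i) ((gaussianReal 0 1).map (fun t : ℝ => (t : ℂ))) P
  law_offDiag : ∀ i j, i ≠ j → HasLaw (x i j) stdComplexGaussian P

/-- The matrix `(γ(i,j) x(i,j) / √N)`: when `x` is a GUE array, this is the GUE matrix with variance
profile `(γ(i,j)²)`. -/
def gueVarProfile {Ω : Type*} {N : ℕ} (γ : Matrix (Fin N) (Fin N) ℝ)
    (x : Fin N → Fin N → Ω → ℂ) (ω : Ω) : Matrix (Fin N) (Fin N) ℂ :=
  Matrix.of fun i j => (γ i j : ℂ) * (x i j ω / (Real.sqrt N : ℂ))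

/-- `γ_max`, the largest entry of `γ`. -/
def gammaMax {N : ℕ} (γ : Matrix (Fin N) (Fin N) ℝ) : ℝ :=
  ⨆ p : Fin N × Fin N, γ p.1 p.2

/-- Diagonal matrices whose diagonal entries have positive imaginary parts. -/
def diagPlus (N : ℕ) : Set (Matrix (Fin N) (Fin N) ℂ) :=
  {Λ | Λ.IsDiag ∧ ∀ i, 0 < (Λ i i).im}

/-- Diagonal matrices whose diagonal entries have negative imaginary parts. -/
def diagMinus (N : ℕ) : Set (Matrix (Fin N) (Fin N) ℂ) :=
  {Λ | Λ.IsDiag ∧ ∀ i, (Λ i i).im < 0}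

/-- `Δ(A)`: the diagonal matrix with the same diagonal as `A`. -/
def diagPart {N : ℕ} (A : Matrix (Fin N) (Fin N) ℂ) : Matrix (Fin N) (Fin N) ℂ :=
  Matrix.diagonal A.diag

/-- `R_N(Λ) = diag_i (∑_j γ(i,j)² Λ(j,j) / N)`. -/
def covMap {N : ℕ} (γ : Matrix (Fin N) (Fin N) ℝ) (Λ : Matrix (Fin N) (Fin N) ℂ) :
    Matrix (Fin N) (Fin N) ℂ :=
  Matrix.diagonal fun i => ∑ j, ((γ i j : ℂ) ^ 2 / (N : ℂ)) * Λ j j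

/-- `G` restricts to a map from `diagPlus N` to `diagMinus N` which is analytic in each of the `N`
diagonal variables and solves `G(Λ) = Δ[(Λ - R_N(G(Λ)) - Y)⁻¹]`. The values of `G` outside
`diagPlus N` are irrelevant. -/
structure IsDetEquiv {N : ℕ} (γ : Matrix (Fin N) (Fin N) ℝ) (Y : Matrix (Fin N) (Fin N) ℂ)
    (G : Matrix (Fin N) (Fin N) ℂ → Matrix (Fin N) (Fin N) ℂ) : Prop where
  mapsTo : Set.MapsTo G (diagPlus N) (diagMinus N)
  analytic : ∀ Λ ∈ diagPlus N, ∀ i a b : Fin N,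
    AnalyticOnNhd ℂ (fun z : ℂ => G (Matrix.diagonal (Function.update Λ.diag i z)) a b)
      {z : ℂ | 0 < z.im}
  fixedPoint : ∀ Λ ∈ diagPlus N, G Λ = diagPart ((Λ - covMap γ (G Λ) - Y)⁻¹)

/-- `β_k(λ) = I - U* (λ - H)⁻¹ U Θ`. -/
def betaMat {N k : ℕ} (H : Matrix (Fin N) (Fin N) ℂ) (U : Matrix (Fin N) (Fin k) ℂ)
    (Θ : Matrix (Fin k) (Fin k) ℂ) (z : ℂ) : Matrix (Fin k) (Fin k) ℂ :=
  1 - U.conjTranspose * (z • (1 : Matrix (Fin N) (Fin N) ℂ) - H)⁻¹ * U * Θ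

/-- `I - U* G(λ I) U Θ`, which is `β_k^□(λ)` when `G` is the deterministic equivalent. -/
def betaSquare {N k : ℕ} (G : Matrix (Fin N) (Fin N) ℂ → Matrix (Fin N) (Fin N) ℂ)
    (U : Matrix (Fin N) (Fin k) ℂ) (Θ : Matrix (Fin k) (Fin k) ℂ) (z : ℂ) :
    Matrix (Fin k) (Fin k) ℂ :=
  1 - U.conjTranspose * G (z • (1 : Matrix (Fin N) (Fin N) ℂ)) * U * Θ

/-- The error term `ε'_N(d)`, where `g` is `γ_max` and `η` is `Im λ`. -/
def epsPrime (N k : ℕ) (g δ d η : ℝ) : ℝ :=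
  Real.sqrt 2 * k * g * (Real.sqrt (d * Real.log N) / η ^ 2) * (N : ℝ) ^ (-(1 / 2) : ℝ)
    + (1 + g ^ 2 / (δ * η ^ 2)) * (g ^ 4 / ((N : ℝ) ^ (3 / 2 : ℝ) * η ^ 5))

end

/-!
The argument compares three matrices: the resolvent `R = (z - H)⁻¹`, its mean `M = E R`, and the
deterministic equivalent `G = G(z)`.

*The deterministic equivalent.* On diagonal matrices the fixed-point equation is the vector Dyson
equation `g = (w - s g)⁻¹` with `s i j = γ(i,j)² / N` and `w` the diagonal of `Λ - Y`. Taking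
imaginary parts, `-Im g = |g|² (Im w + s (-Im g))`; by the Cauchy–Schwarz inequality this makes one
step `p ↦ (w - s p)⁻¹` a strict contraction for the gauge `|p - q| / √(Im p · Im q)`
(`norm_dysonStep_sub_le_mul_sqrt`). The iterates therefore converge, locally uniformly in `w`, to a
holomorphic solution (`dysonSol`, `detEquiv`). The same identity shows that solutions for spectral
parameters `w`, `w'` differ by at most `|w - w'| / (Im w · Im w')` (`norm_sub_le_of_dysonStep_eq`),
which contains uniqueness.

*Fluctuations.* A complex-valued function `F` of a standard Gaussian vector with
`∑ c, |∂ c F|² ≤ V` satisfies `E cosh (l |F - E F|) ≤ exp (l² V / 2)` (`integral_cosh_mul_le_exp`):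
split the Gaussian vector into `n` independent increments, use Pinelis' inequality for `cosh` of a
Hilbert-space norm on each, and let `n → ∞`. Treating `F` as a vector in the plane, instead of its
real and imaginary parts separately, gives the tail `2 exp (-t² / (2 V))` with the sharp constant,
and also the Poincaré inequality `Var F ≤ V`. For `F = Tr (B R)` the gradient bound holds with
`V = (γ_max² / N) |B|² / (Im z)⁴`, where `|B|` is the Hilbert–Schmidt norm. Each of the `k²` entries
of `U* R U` has this form with `|B| = 1`.

*Bias.* Gaussian integration by parts gives the Schwinger–Dyson equation: the diagonal of `M` solves
the Dyson equation up to the covariance of `∑ j, s i j R(j,j)` and `R(i,i)`, which the Poincaré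
inequality bounds by `γ_max⁴ N^(-3/2) (Im z)⁻⁴` (`norm_schwinger_dyson_error_le`). One more Dyson
step turns this approximate solution into an exact one for a perturbed spectral parameter, whose
imaginary part is at least `δ Im z` by the lower bound on `Im z`, and stability concludes
(`norm_sub_dysonSol_le`). Since flipping the signs of one row and column does not change the law of
the Gaussian matrix, `M` is diagonal, so this controls the norm of `M - G`
(`norm_meanResolv_sub_detEquiv_le`).

A union bound over the `k²` entries of `U* (R - M) U` finishes the proof, even with `2 k² N^(-d)`.
-/

/-! ### The vector Dyson equation -/

section DysonEquation

variable {ι : Type*} [Fintype ι]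

/-- One step `p ↦ (w - s p)⁻¹` of the vector Dyson equation `g = (w - s g)⁻¹`. -/
noncomputable def dysonStep (s : ι → ι → ℝ) (w p : ι → ℂ) (i : ι) : ℂ :=
  (w i - ∑ j, (s i j : ℂ) * p j)⁻¹

theorem im_sub_sum_ofReal_mul (a : ι → ℝ) (z : ℂ) (p : ι → ℂ) :
    (z - ∑ j, (a j : ℂ) * p j).im = z.im + ∑ j, a j * -(p j).im := by
  simp [Complex.im_sum, sub_eq_add_neg]

theorem sum_mul_neg_im_nonneg {a : ι → ℝ} (ha : ∀ j, 0 ≤ a j) {p : ι → ℂ}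
    (hp : ∀ j, (p j).im ≤ 0) : 0 ≤ ∑ j, a j * -(p j).im :=
  Finset.sum_nonneg fun j _ => mul_nonneg (ha j) (neg_nonneg.2 (hp j))

theorem norm_inv_le_of_le_im {z : ℂ} {η : ℝ} (hη : 0 < η) (h : η ≤ z.im) : ‖z⁻¹‖ ≤ 1 / η := by
  rw [norm_inv, one_div]
  exact inv_anti₀ hη (h.trans ((le_abs_self _).trans (Complex.abs_im_le_norm z)))

theorem neg_im_inv (z : ℂ) : -(z⁻¹).im = ‖z⁻¹‖ ^ 2 * z.im := by
  rw [Complex.inv_im, norm_inv, inv_pow, ← Complex.normSq_eq_norm_sq]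
  ring

variable {s : ι → ι → ℝ} {w w' p q g g' : ι → ℂ} {η η' c : ℝ}

theorem neg_im_dysonStep (s : ι → ι → ℝ) (w p : ι → ℂ) (i : ι) :
    -(dysonStep s w p i).im =
      ‖dysonStep s w p i‖ ^ 2 * ((w i).im + ∑ j, s i j * -(p j).im) := by
  rw [dysonStep, neg_im_inv, im_sub_sum_ofReal_mul]

theorem norm_dysonStep_le (hs : ∀ i j, 0 ≤ s i j) (hη : 0 < η) (hw : ∀ i, η ≤ (w i).im)
    (hp : ∀ i, (p i).im ≤ 0) (i : ι) : ‖dysonStep s w p i‖ ≤ 1 / η := by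
  refine norm_inv_le_of_le_im hη ?_
  rw [im_sub_sum_ofReal_mul]
  linarith [hw i, sum_mul_neg_im_nonneg (hs i) hp]

theorem dysonStep_denom_ne_zero (hs : ∀ i j, 0 ≤ s i j) (hw : ∀ i, 0 < (w i).im)
    (hp : ∀ i, (p i).im ≤ 0) (i : ι) : w i - ∑ j, (s i j : ℂ) * p j ≠ 0 := by
  intro h
  have := im_sub_sum_ofReal_mul (s i) (w i) p
  rw [h, Complex.zero_im] at this
  linarith [hw i, sum_mul_neg_im_nonneg (hs i) hp]

theorem dysonStep_im_neg (hs : ∀ i j, 0 ≤ s i j) (hw : ∀ i, 0 < (w i).im)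
    (hp : ∀ i, (p i).im ≤ 0) (i : ι) : (dysonStep s w p i).im < 0 := by
  have h := neg_im_dysonStep s w p i
  have h1 : 0 < ‖dysonStep s w p i‖ :=
    norm_pos_iff.2 (inv_ne_zero (dysonStep_denom_ne_zero hs hw hp i))
  have h2 := sum_mul_neg_im_nonneg (hs i) hp
  have h3 : 0 < ‖dysonStep s w p i‖ ^ 2 * ((w i).im + ∑ j, s i j * -(p j).im) := by
    have := hw i
    positivity
  linarith

theorem norm_dysonStep_sub (hs : ∀ i j, 0 ≤ s i j) (hw : ∀ i, 0 < (w i).im)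
    (hw' : ∀ i, 0 < (w' i).im) (hp : ∀ i, (p i).im ≤ 0) (hq : ∀ i, (q i).im ≤ 0) (i : ι) :
    ‖dysonStep s w p i - dysonStep s w' q i‖ ≤ ‖dysonStep s w p i‖ * ‖dysonStep s w' q i‖ *
      (‖w i - w' i‖ + ∑ j, s i j * ‖p j - q j‖) := by
  have h1 := dysonStep_denom_ne_zero hs hw hp i
  have h2 := dysonStep_denom_ne_zero hs hw' hq i
  have : dysonStep s w p i - dysonStep s w' q i = dysonStep s w p i * dysonStep s w' q i *
      ((w' i - w i) + ∑ j, (s i j : ℂ) * (p j - q j)) := by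
    have h3 : ∑ j, (s i j : ℂ) * (p j - q j) =
        ∑ j, (s i j : ℂ) * p j - ∑ j, (s i j : ℂ) * q j := by
      simp [mul_sub, Finset.sum_sub_distrib]
    rw [h3, dysonStep, dysonStep, inv_sub_inv h1 h2]
    field_simp
    ring
  rw [this, norm_mul, norm_mul]
  gcongr
  refine (norm_add_le _ _).trans ?_
  rw [norm_sub_rev]
  gcongr
  refine (norm_sum_le _ _).trans (Finset.sum_le_sum fun j _ => ?_)
  rw [norm_mul, Complex.norm_real, Real.norm_of_nonneg (hs i j)]

/-- The Cauchy-Schwarz inequality behind both the contraction property of `dysonStep` and the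
stability of its fixed points. -/
theorem sum_mul_sqrt_le {a v v' : ι → ℝ} (ha : ∀ j, 0 ≤ a j) (hv : ∀ j, 0 ≤ v j)
    (hv' : ∀ j, 0 ≤ v' j) :
    ∑ j, a j * √(v j * v' j) ≤ √(∑ j, a j * v j) * √(∑ j, a j * v' j) := by
  refine le_trans (le_of_eq ?_) (Real.sum_sqrt_mul_sqrt_le Finset.univ
    (fun j => mul_nonneg (ha j) (hv j)) (fun j => mul_nonneg (ha j) (hv' j)))
  refine Finset.sum_congr rfl fun j _ => ?_
  rw [← Real.sqrt_mul (mul_nonneg (ha j) (hv j)), show a j * v j * (a j * v' j) =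
    a j ^ 2 * (v j * v' j) by ring, Real.sqrt_mul (sq_nonneg _), Real.sqrt_sq (ha j)]

theorem sqrt_mul_sqrt_add_le {a b x y : ℝ} (ha : 0 ≤ a) (hb : 0 ≤ b) (hx : 0 ≤ x) (hy : 0 ≤ y) :
    √a * √b + √x * √y ≤ √(a + x) * √(b + y) := by
  rw [← Real.sqrt_mul (add_nonneg ha hx)]
  refine Real.le_sqrt_of_sq_le ?_
  have h1 := Real.sq_sqrt ha
  have h2 := Real.sq_sqrt hb
  have h3 := Real.sq_sqrt hx
  have h4 := Real.sq_sqrt hy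
  calc (√a * √b + √x * √y) ^ 2 ≤ (√a ^ 2 + √x ^ 2) * (√b ^ 2 + √y ^ 2) := by
        nlinarith [sq_nonneg (√a * √y - √x * √b)]
    _ = (a + x) * (b + y) := by rw [h1, h2, h3, h4]

/-- Stability of the vector Dyson equation. With `v = -Im g`, `v' = -Im g'`, the vector
`√(v v')` is a supersolution of the linear inequality satisfied by `|g - g'|`; comparing both at
the index where their ratio is largest gives the bound. For `w = w'` this is uniqueness. -/
theorem norm_sub_le_of_dysonStep_eq (hs : ∀ i j, 0 ≤ s i j) (hη : 0 < η) (hη' : 0 < η')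
    (hw : ∀ i, η ≤ (w i).im) (hw' : ∀ i, η' ≤ (w' i).im)
    (hg : ∀ i, g i = dysonStep s w g i) (hg' : ∀ i, g' i = dysonStep s w' g' i)
    (hgim : ∀ i, (g i).im < 0) (hgim' : ∀ i, (g' i).im < 0) (hc : ∀ i, ‖w i - w' i‖ ≤ c) (i : ι) :
    ‖g i - g' i‖ ≤ c / (η * η') := by
  have : Nonempty ι := ⟨i⟩
  have hc0 : 0 ≤ c := (norm_nonneg _).trans (hc i)
  have hw0 : ∀ i, 0 < (w i).im := fun i => hη.trans_le (hw i)
  have hw0' : ∀ i, 0 < (w' i).im := fun i => hη'.trans_le (hw' i)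
  set v : ι → ℝ := fun i => -(g i).im with hv
  set v' : ι → ℝ := fun i => -(g' i).im with hv'
  have hvpos : ∀ i, 0 < v i := fun i => neg_pos.2 (hgim i)
  have hvpos' : ∀ i, 0 < v' i := fun i => neg_pos.2 (hgim' i)
  have hveq : ∀ i, v i = ‖g i‖ ^ 2 * ((w i).im + ∑ j, s i j * v j) := fun i => by
    have := neg_im_dysonStep s w g i
    rwa [← hg i] at this
  have hveq' : ∀ i, v' i = ‖g' i‖ ^ 2 * ((w' i).im + ∑ j, s i j * v' j) := fun i => by
    have := neg_im_dysonStep s w' g' i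
    rwa [← hg' i] at this
  have hsuper : ∀ i, ‖g i‖ * ‖g' i‖ * (√η * √η' + ∑ j, s i j * √(v j * v' j)) ≤
      √(v i * v' i) := fun i => by
    have hA : 0 ≤ ∑ j, s i j * v j :=
      Finset.sum_nonneg fun j _ => mul_nonneg (hs i j) (hvpos j).le
    have hA' : 0 ≤ ∑ j, s i j * v' j :=
      Finset.sum_nonneg fun j _ => mul_nonneg (hs i j) (hvpos' j).le
    have e : √(v i * v' i) = ‖g i‖ * ‖g' i‖ *
        (√((w i).im + ∑ j, s i j * v j) * √((w' i).im + ∑ j, s i j * v' j)) := by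
      rw [Real.sqrt_mul (hvpos i).le]
      nth_rw 1 [hveq i, hveq' i]
      rw [Real.sqrt_mul (sq_nonneg _), Real.sqrt_mul (sq_nonneg _), Real.sqrt_sq (norm_nonneg _),
        Real.sqrt_sq (norm_nonneg _)]
      ring
    rw [e]
    gcongr
    calc _ ≤ √η * √η' + √(∑ j, s i j * v j) * √(∑ j, s i j * v' j) := by
            gcongr
            exact sum_mul_sqrt_le (hs i) (fun j => (hvpos j).le) (fun j => (hvpos' j).le)
      _ ≤ √(η + ∑ j, s i j * v j) * √(η' + ∑ j, s i j * v' j) :=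
            sqrt_mul_sqrt_add_le hη.le hη'.le hA hA'
      _ ≤ _ := by gcongr <;> simp [hw, hw']
  have hgn : ∀ i, ‖g i‖ ≤ 1 / η := fun i => by
    rw [hg i]; exact norm_dysonStep_le hs hη hw (fun j => (hgim j).le) i
  have hgn' : ∀ i, ‖g' i‖ ≤ 1 / η' := fun i => by
    rw [hg' i]; exact norm_dysonStep_le hs hη' hw' (fun j => (hgim' j).le) i
  have hppos : ∀ i, 0 < √(v i * v' i) := fun i => Real.sqrt_pos.2 (mul_pos (hvpos i) (hvpos' i))
  obtain ⟨k, hk⟩ := Finite.exists_max fun i => ‖g i - g' i‖ / √(v i * v' i)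
  set M := ‖g k - g' k‖ / √(v k * v' k) with hM
  have hM0 : 0 ≤ M := by positivity
  have hu : ∀ i, ‖g i - g' i‖ ≤ M * √(v i * v' i) := fun i => (div_le_iff₀ (hppos i)).1 (hk i)
  have hηη : 0 < √η * √η' := by positivity
  have hMle : M ≤ c / (√η * √η') := by
    rw [le_div_iff₀ hηη]
    have h1 := norm_dysonStep_sub hs hw0 hw0' (fun j => (hgim j).le) (fun j => (hgim' j).le) k
    rw [← hg k, ← hg' k] at h1
    have hD : 0 < ‖g k‖ * ‖g' k‖ :=
      mul_pos (norm_pos_iff.2 fun h => by simpa [h] using hgim k)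
        (norm_pos_iff.2 fun h => by simpa [h] using hgim' k)
    have h2 : ∑ j, s k j * ‖g j - g' j‖ ≤ M * ∑ j, s k j * √(v j * v' j) := by
      rw [Finset.mul_sum]
      refine Finset.sum_le_sum fun j _ => ?_
      have := mul_le_mul_of_nonneg_left (hu j) (hs k j)
      linarith
    have h3 : M * (‖g k‖ * ‖g' k‖ * (√η * √η' + ∑ j, s k j * √(v j * v' j))) ≤
        ‖g k‖ * ‖g' k‖ * (c + M * ∑ j, s k j * √(v j * v' j)) :=
      calc _ ≤ M * √(v k * v' k) := mul_le_mul_of_nonneg_left (hsuper k) hM0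
        _ = ‖g k - g' k‖ := div_mul_cancel₀ _ (hppos k).ne'
        _ ≤ _ := h1
        _ ≤ _ := by gcongr; exact hc k
    have h4 : ‖g k‖ * ‖g' k‖ * (M * (√η * √η')) ≤ ‖g k‖ * ‖g' k‖ * c := by linarith
    exact le_of_mul_le_mul_left h4 hD
  have hple : √(v i * v' i) ≤ 1 / (√η * √η') := by
    have e : 1 / (√η * √η') = √(1 / η * (1 / η')) := by
      rw [Real.sqrt_mul (by positivity), Real.sqrt_div zero_le_one, Real.sqrt_div zero_le_one]
      simp [mul_comm]
    rw [e]
    refine Real.sqrt_le_sqrt (mul_le_mul ?_ ?_ (hvpos' i).le (by positivity))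
    · exact (neg_le_abs _).trans ((Complex.abs_im_le_norm _).trans (hgn i))
    · exact (neg_le_abs _).trans ((Complex.abs_im_le_norm _).trans (hgn' i))
  calc ‖g i - g' i‖ ≤ M * √(v i * v' i) := hu i
    _ ≤ c / (√η * √η') * (1 / (√η * √η')) := by gcongr
    _ = c / (η * η') := by
      rw [div_mul_div_comm, mul_one, mul_mul_mul_comm, Real.mul_self_sqrt hη.le,
        Real.mul_self_sqrt hη'.le]

end DysonEquation

section DysonEquationExistence

variable {ι : Type*} [Fintype ι] {s : ι → ι → ℝ} {w p q : ι → ℂ} {η a B M : ℝ}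

/-- In the symmetric gauge `|p - q| / √(Im p * Im q)`, whose square is a function of the hyperbolic
distance, a Dyson step is a strict contraction. -/
theorem norm_dysonStep_sub_le_mul_sqrt (hs : ∀ i j, 0 ≤ s i j) (hη : 0 < η)
    (hw : ∀ i, η ≤ (w i).im) (hp : ∀ i, (p i).im ≤ 0) (hq : ∀ i, (q i).im ≤ 0)
    (hpa : ∀ i, ∑ j, s i j * -(p j).im ≤ a) (hqa : ∀ i, ∑ j, s i j * -(q j).im ≤ a) (hM : 0 ≤ M)
    (h : ∀ j, ‖p j - q j‖ ≤ M * √(-(p j).im * -(q j).im)) (i : ι) :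
    ‖dysonStep s w p i - dysonStep s w q i‖ ≤
      a / (η + a) * M * √(-(dysonStep s w p i).im * -(dysonStep s w q i).im) := by
  have hw0 : ∀ i, 0 < (w i).im := fun i => hη.trans_le (hw i)
  have hA := sum_mul_neg_im_nonneg (hs i) hp
  have hB := sum_mul_neg_im_nonneg (hs i) hq
  have ha : 0 ≤ a := hA.trans (hpa i)
  have key : ∀ {x : ℝ}, 0 ≤ x → x ≤ a → √x ≤ √(a / (η + a)) * √((w i).im + x) := by
    intro x hx hxa
    rw [← Real.sqrt_mul (by positivity)]
    refine Real.sqrt_le_sqrt ?_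
    rw [div_mul_eq_mul_div, le_div_iff₀ (by positivity)]
    nlinarith [mul_le_mul_of_nonneg_right (hw i) ha, mul_le_mul_of_nonneg_left hxa hη.le]
  have e : √(-(dysonStep s w p i).im * -(dysonStep s w q i).im) =
      ‖dysonStep s w p i‖ * ‖dysonStep s w q i‖ *
        (√((w i).im + ∑ j, s i j * -(p j).im) * √((w i).im + ∑ j, s i j * -(q j).im)) := by
    rw [neg_im_dysonStep, neg_im_dysonStep, Real.sqrt_mul (mul_nonneg (sq_nonneg _)
      (add_nonneg (hw0 i).le hA)), Real.sqrt_mul (sq_nonneg _), Real.sqrt_mul (sq_nonneg _),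
      Real.sqrt_sq (norm_nonneg _), Real.sqrt_sq (norm_nonneg _)]
    ring
  have hsum : ∑ j, s i j * ‖p j - q j‖ ≤
      M * (√(∑ j, s i j * -(p j).im) * √(∑ j, s i j * -(q j).im)) := by
    refine le_trans ?_ (mul_le_mul_of_nonneg_left (sum_mul_sqrt_le (hs i)
      (fun j => neg_nonneg.2 (hp j)) (fun j => neg_nonneg.2 (hq j))) hM)
    rw [Finset.mul_sum]
    refine Finset.sum_le_sum fun j _ => ?_
    have := mul_le_mul_of_nonneg_left (h j) (hs i j)
    linarith
  calc ‖dysonStep s w p i - dysonStep s w q i‖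
      ≤ ‖dysonStep s w p i‖ * ‖dysonStep s w q i‖ *
        (‖w i - w i‖ + ∑ j, s i j * ‖p j - q j‖) := norm_dysonStep_sub hs hw0 hw0 hp hq i
    _ ≤ ‖dysonStep s w p i‖ * ‖dysonStep s w q i‖ *
        (M * ((√(a / (η + a)) * √((w i).im + ∑ j, s i j * -(p j).im)) *
          (√(a / (η + a)) * √((w i).im + ∑ j, s i j * -(q j).im)))) := by
        rw [sub_self, norm_zero, zero_add]
        refine mul_le_mul_of_nonneg_left (hsum.trans (mul_le_mul_of_nonneg_left ?_ hM))
          (by positivity)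
        exact mul_le_mul (key hA (hpa i)) (key hB (hqa i)) (Real.sqrt_nonneg _) (by positivity)
    _ = √(a / (η + a)) * √(a / (η + a)) * M *
          √(-(dysonStep s w p i).im * -(dysonStep s w q i).im) := by rw [e]; ring
    _ = _ := by rw [Real.mul_self_sqrt (by positivity)]

/-- The iterates of the Dyson step, started at the constant vector `-i`. -/
noncomputable def dysonIter (s : ι → ι → ℝ) (w : ι → ℂ) (m : ℕ) : ι → ℂ :=
  (dysonStep s w)^[m] fun _ => -Complex.I

@[simp] theorem dysonIter_zero (s : ι → ι → ℝ) (w : ι → ℂ) :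
    dysonIter s w 0 = fun _ => -Complex.I := rfl

theorem dysonIter_succ (s : ι → ι → ℝ) (w : ι → ℂ) (m : ℕ) :
    dysonIter s w (m + 1) = dysonStep s w (dysonIter s w m) :=
  Function.iterate_succ_apply' _ _ _

theorem dysonIter_im_neg (hs : ∀ i j, 0 ≤ s i j) (hw : ∀ i, 0 < (w i).im) (m : ℕ) (i : ι) :
    (dysonIter s w m i).im < 0 := by
  induction m generalizing i with
  | zero => simp
  | succ m ih =>
    rw [dysonIter_succ]
    exact dysonStep_im_neg hs hw (fun j => (ih j).le) i

theorem norm_dysonIter_le (hs : ∀ i j, 0 ≤ s i j) (hη : 0 < η) (hw : ∀ i, η ≤ (w i).im) (m : ℕ)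
    (i : ι) : ‖dysonIter s w m i‖ ≤ 1 + 1 / η := by
  have : 0 < 1 / η := by positivity
  cases m with
  | zero => simp [hη.le]
  | succ m =>
    rw [dysonIter_succ]
    have := norm_dysonStep_le hs hη hw
      (fun j => (dysonIter_im_neg hs (fun i => hη.trans_le (hw i)) m j).le) i
    linarith

/-- Consecutive iterates approach each other at a geometric rate, uniformly over all `w` with
`η ≤ Im w` and `|w| ≤ B`. -/
theorem exists_norm_dysonIter_sub_le (hs : ∀ i j, 0 ≤ s i j) (hη : 0 < η) (B : ℝ) :
    ∃ u : ℕ → ℝ, Summable u ∧ ∀ w : ι → ℂ, (∀ i, η ≤ (w i).im) → (∀ i, ‖w i‖ ≤ B) →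
      ∀ m i, ‖dysonIter s w (m + 1) i - dysonIter s w m i‖ ≤ u m := by
  set b := 1 + 1 / η with hb
  have hb0 : 0 < b := by positivity
  set S := ∑ i, ∑ j, s i j with hS
  have hS0 : 0 ≤ S := Finset.sum_nonneg fun i _ => Finset.sum_nonneg fun j _ => hs i j
  have hSi : ∀ i, ∑ j, s i j ≤ S := fun i =>
    Finset.single_le_sum (f := fun i => ∑ j, s i j)
      (fun i _ => Finset.sum_nonneg fun j _ => hs i j) (Finset.mem_univ i)
  set a := S * b with ha
  have ha0 : 0 ≤ a := by positivity
  set ρ := a / (η + a) with hρ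
  have hρ0 : 0 ≤ ρ := by positivity
  have hρ1 : ρ < 1 := by rw [hρ, div_lt_one (by positivity)]; linarith
  set M := (1 / η + 1) * ((B + S) / √η) with hM
  refine ⟨fun m => ρ ^ m * (M * b),
    (summable_geometric_of_lt_one hρ0 hρ1).mul_right _, fun w hw hB m i => ?_⟩
  have hw0 : ∀ i, 0 < (w i).im := fun i => hη.trans_le (hw i)
  have hηB : η ≤ B := (hw i).trans ((le_abs_self _).trans ((Complex.abs_im_le_norm _).trans (hB i)))
  have hM0 : 0 ≤ M := by have := hη.trans_le hηB; positivity
  have him : ∀ m j, (dysonIter s w m j).im ≤ 0 := fun m j => (dysonIter_im_neg hs hw0 m j).le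
  have himb : ∀ m j, -(dysonIter s w m j).im ≤ b := fun m j =>
    (neg_le_abs _).trans ((Complex.abs_im_le_norm _).trans (norm_dysonIter_le hs hη hw m j))
  have hsuma : ∀ m i, ∑ j, s i j * -(dysonIter s w m j).im ≤ a := fun m i => by
    calc _ ≤ ∑ j, s i j * b :=
          Finset.sum_le_sum fun j _ => mul_le_mul_of_nonneg_left (himb m j) (hs i j)
      _ = (∑ j, s i j) * b := by rw [Finset.sum_mul]
      _ ≤ a := by rw [ha]; gcongr; exact hSi i
  have key : ∀ m i, ‖dysonIter s w (m + 1) i - dysonIter s w m i‖ ≤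
      ρ ^ m * M * √(-(dysonIter s w (m + 1) i).im * -(dysonIter s w m i).im) := by
    intro m
    induction m with
    | zero =>
      intro i
      have h0 : ‖dysonIter s w 1 i - dysonIter s w 0 i‖ ≤ 1 / η + 1 := by
        refine (norm_sub_le _ _).trans ?_
        rw [dysonIter_succ]
        refine add_le_add (norm_dysonStep_le hs hη hw (him 0) i) ?_
        simp
      have hden : ‖w i - ∑ j, (s i j : ℂ) * dysonIter s w 0 j‖ ≤ B + S := by
        refine (norm_sub_le _ _).trans (add_le_add (hB i) ?_)
        refine (norm_sum_le _ _).trans (le_trans (Finset.sum_le_sum fun j _ => ?_) (hSi i))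
        rw [norm_mul, Complex.norm_real, Real.norm_of_nonneg (hs i j)]
        simp
      have hBS : 0 < B + S := by linarith [hη.trans_le hηB]
      have h1 : √η / (B + S) ≤ √(-(dysonIter s w 1 i).im * -(dysonIter s w 0 i).im) := by
        have e : -(dysonIter s w 0 i).im = 1 := by simp
        rw [e, mul_one, dysonIter_succ, neg_im_dysonStep, Real.sqrt_mul (sq_nonneg _),
          Real.sqrt_sq (norm_nonneg _), div_eq_inv_mul]
        have h2 := norm_pos_iff.2 (dysonStep_denom_ne_zero hs hw0 (him 0) i)
        refine mul_le_mul ?_ ?_ (Real.sqrt_nonneg _) (norm_nonneg _)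
        · rw [dysonStep, norm_inv]
          exact inv_anti₀ h2 hden
        · exact Real.sqrt_le_sqrt (by linarith [hw i, sum_mul_neg_im_nonneg (hs i) (him 0)])
      have hsq : 0 < √η := Real.sqrt_pos.2 hη
      calc _ ≤ 1 / η + 1 := h0
        _ = M * (√η / (B + S)) := by rw [hM]; field_simp
        _ ≤ _ := by
          rw [pow_zero, one_mul]
          exact mul_le_mul_of_nonneg_left h1 hM0
    | succ m ih =>
      intro i
      have := norm_dysonStep_sub_le_mul_sqrt hs hη hw (him (m + 1)) (him m) (hsuma (m + 1))
        (hsuma m) (by positivity) ih i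
      rw [← dysonIter_succ, ← dysonIter_succ] at this
      rw [pow_succ' ρ m, mul_assoc ρ]
      exact this
  refine (key m i).trans ?_
  rw [mul_assoc]
  refine mul_le_mul_of_nonneg_left (mul_le_mul_of_nonneg_left ?_ hM0) (pow_nonneg hρ0 m)
  rw [Real.sqrt_le_left hb0.le, sq]
  exact mul_le_mul (himb _ _) (himb _ _) (neg_nonneg.2 (him _ _)) hb0.le

/-- The solution of the vector Dyson equation with negative imaginary parts, as the limit of the
iterates of the Dyson step, written as a telescoping series. -/
noncomputable def dysonSol (s : ι → ι → ℝ) (w : ι → ℂ) (i : ι) : ℂ :=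
  -Complex.I + ∑' m, (dysonIter s w (m + 1) i - dysonIter s w m i)

theorem exists_bounds_of_im_pos (hw : ∀ i, 0 < (w i).im) :
    ∃ η B : ℝ, 0 < η ∧ (∀ i, η < (w i).im) ∧ ∀ i, ‖w i‖ < B := by
  rcases isEmpty_or_nonempty ι with h | h
  · exact ⟨1, 1, one_pos, fun i => h.elim i, fun i => h.elim i⟩
  · obtain ⟨k, hk⟩ := Finite.exists_min fun i => (w i).im
    obtain ⟨l, hl⟩ := Finite.exists_max fun i => ‖w i‖
    exact ⟨(w k).im / 2, ‖w l‖ + 1, half_pos (hw k),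
      fun i => (half_lt_self (hw k)).trans_le (hk i), fun i => (hl i).trans_lt (lt_add_one _)⟩

open Filter Topology in
theorem tendsto_dysonIter (hs : ∀ i j, 0 ≤ s i j) (hw : ∀ i, 0 < (w i).im) (i : ι) :
    Tendsto (fun m => dysonIter s w m i) atTop (𝓝 (dysonSol s w i)) := by
  obtain ⟨η, B, hη, hwη, hB⟩ := exists_bounds_of_im_pos hw
  obtain ⟨u, hu, hbd⟩ := exists_norm_dysonIter_sub_le hs hη B
  have hsum : Summable fun m => dysonIter s w (m + 1) i - dysonIter s w m i :=
    hu.of_norm_bounded fun m => hbd w (fun i => (hwη i).le) (fun i => (hB i).le) m i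
  have := (hsum.hasSum.tendsto_sum_nat).const_add (-Complex.I)
  refine this.congr fun m => ?_
  rw [Finset.sum_range_sub (fun m => dysonIter s w m i)]
  simp

open Filter Topology in
theorem dysonSol_eq_dysonStep (hs : ∀ i j, 0 ≤ s i j) (hw : ∀ i, 0 < (w i).im) (i : ι) :
    dysonSol s w i = dysonStep s w (dysonSol s w) i := by
  have him : ∀ j, (dysonSol s w j).im ≤ 0 := fun j =>
    le_of_tendsto ((Complex.continuous_im.tendsto _).comp (tendsto_dysonIter hs hw j))
      (Eventually.of_forall fun m => (dysonIter_im_neg hs hw m j).le)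
  refine tendsto_nhds_unique ((tendsto_add_atTop_iff_nat 1).2 (tendsto_dysonIter hs hw i)) ?_
  simp only [dysonIter_succ]
  refine Tendsto.inv₀ ?_ (dysonStep_denom_ne_zero hs hw him i)
  exact tendsto_const_nhds.sub (tendsto_finsetSum _ fun j _ =>
    (tendsto_dysonIter hs hw j).const_mul _)

open Filter Topology in
theorem dysonSol_im_neg (hs : ∀ i j, 0 ≤ s i j) (hw : ∀ i, 0 < (w i).im) (i : ι) :
    (dysonSol s w i).im < 0 := by
  have him : ∀ j, (dysonSol s w j).im ≤ 0 := fun j =>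
    le_of_tendsto ((Complex.continuous_im.tendsto _).comp (tendsto_dysonIter hs hw j))
      (Eventually.of_forall fun m => (dysonIter_im_neg hs hw m j).le)
  rw [dysonSol_eq_dysonStep hs hw i]
  exact dysonStep_im_neg hs hw him i

/-- The solution depends holomorphically on the spectral parameters. -/
theorem differentiableAt_dysonSol (hs : ∀ i j, 0 ≤ s i j) {W : ℂ → ι → ℂ}
    (hW : ∀ i, Differentiable ℂ fun z => W z i) {z₀ : ℂ} (hz₀ : ∀ i, 0 < (W z₀ i).im) (i : ι) :
    DifferentiableAt ℂ (fun z => dysonSol s (W z) i) z₀ := by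
  obtain ⟨η, B, hη, hwη, hB⟩ := exists_bounds_of_im_pos hz₀
  obtain ⟨u, hu, hbd⟩ := exists_norm_dysonIter_sub_le hs hη B
  set V : Set ℂ := {z | ∀ i, η < (W z i).im ∧ ‖W z i‖ < B} with hV
  have hVo : IsOpen V := by
    have : V = ⋂ i, {z | η < (W z i).im ∧ ‖W z i‖ < B} := by ext; simp [hV]
    rw [this]
    refine isOpen_iInter_of_finite fun i => ?_
    have hc := (hW i).continuous
    exact (isOpen_lt continuous_const (Complex.continuous_im.comp hc)).inter
      (isOpen_lt hc.norm continuous_const)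
  have hd : ∀ m i, DifferentiableOn ℂ (fun z => dysonIter s (W z) m i) V := by
    intro m
    induction m with
    | zero => exact fun i => differentiableOn_const _
    | succ m ih =>
      intro i
      simp only [dysonIter_succ, dysonStep]
      have hpos : ∀ z ∈ V, ∀ i, 0 < (W z i).im := fun z hz i => hη.trans (hz i).1
      refine DifferentiableOn.inv ?_ fun z hz => dysonStep_denom_ne_zero hs (hpos z hz)
        (fun j => (dysonIter_im_neg hs (hpos z hz) m j).le) i
      exact (hW i).differentiableOn.sub
        (DifferentiableOn.fun_sum fun j _ => (ih j).const_mul _)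
  have := Complex.differentiableOn_tsum_of_summable_norm (F := fun m z =>
    dysonIter s (W z) (m + 1) i - dysonIter s (W z) m i) hu
    (fun m => (hd (m + 1) i).sub (hd m i)) hVo
    (fun m z hz => hbd (W z) (fun i => (hz i).1.le) (fun i => (hz i).2.le) m i)
  exact ((this.differentiableAt (hVo.mem_nhds fun i => ⟨hwη i, hB i⟩)).const_add _)

end DysonEquationExistence

/-! ### The deterministic equivalent -/

section DetEquiv

variable {N : ℕ} {γ : Matrix (Fin N) (Fin N) ℝ} {Y : Matrix (Fin N) (Fin N) ℂ}

/-- The variances `γ(i,j)² / N` of the entries of the random matrix. -/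
noncomputable def varProfile (γ : Matrix (Fin N) (Fin N) ℝ) (i j : Fin N) : ℝ := γ i j ^ 2 / N

theorem varProfile_nonneg (γ : Matrix (Fin N) (Fin N) ℝ) (i j : Fin N) : 0 ≤ varProfile γ i j := by
  unfold varProfile; positivity

theorem covMap_eq (γ : Matrix (Fin N) (Fin N) ℝ) (Λ : Matrix (Fin N) (Fin N) ℂ) :
    covMap γ Λ = Matrix.diagonal fun i => ∑ j, (varProfile γ i j : ℂ) * Λ j j := by
  simp [covMap, varProfile]

theorem diagPart_inv_sub_covMap_sub (hY : Y.IsDiag) {Λ : Matrix (Fin N) (Fin N) ℂ} (hΛ : Λ.IsDiag)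
    (D : Matrix (Fin N) (Fin N) ℂ)
    (h : ∀ i, (Λ i i - Y i i) - ∑ j, (varProfile γ i j : ℂ) * D j j ≠ 0) :
    diagPart ((Λ - covMap γ D - Y)⁻¹) = Matrix.diagonal
      (dysonStep (varProfile γ) (fun i => Λ i i - Y i i) fun j => D j j) := by
  have h1 : Λ - covMap γ D - Y = Matrix.diagonal
      fun i => (Λ i i - Y i i) - ∑ j, (varProfile γ i j : ℂ) * D j j := by
    rw [covMap_eq]
    nth_rw 1 [← hΛ.diagonal_diag, ← hY.diagonal_diag]
    rw [Matrix.diagonal_sub, Matrix.diagonal_sub]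
    congr 1
    ext i
    simp only [Matrix.diag_apply]
    ring
  have h2 : (Λ - covMap γ D - Y)⁻¹ = Matrix.diagonal
      (dysonStep (varProfile γ) (fun i => Λ i i - Y i i) fun j => D j j) := by
    rw [h1]
    refine Matrix.inv_eq_right_inv ?_
    rw [Matrix.diagonal_mul_diagonal, ← Matrix.diagonal_one]
    congr 1
    ext i
    exact mul_inv_cancel₀ (h i)
  rw [h2, diagPart, Matrix.diag_diagonal]

theorem im_sub_diag_of_isHermitian (hY : Y.IsHermitian) (Λ : Matrix (Fin N) (Fin N) ℂ) (i : Fin N) :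
    (Λ i i - Y i i).im = (Λ i i).im := by
  have h : (Y i i).im = 0 := Complex.conj_eq_iff_im.1 (hY.apply i i)
  rw [Complex.sub_im, h, sub_zero]

/-- The map `G` of the theorem: at `Λ`, the diagonal solution of the vector Dyson equation with
spectral parameters `Λ - Y`. -/
noncomputable def detEquiv (γ : Matrix (Fin N) (Fin N) ℝ) (Y Λ : Matrix (Fin N) (Fin N) ℂ) :
    Matrix (Fin N) (Fin N) ℂ :=
  Matrix.diagonal (dysonSol (varProfile γ) fun i => Λ i i - Y i i)

theorem isDetEquiv_detEquiv (γ : Matrix (Fin N) (Fin N) ℝ) (hYh : Y.IsHermitian)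
    (hYd : Y.IsDiag) : IsDetEquiv γ Y (detEquiv γ Y) := by
  have hpos : ∀ {Λ}, Λ ∈ diagPlus N → ∀ i, 0 < (Λ i i - Y i i).im := fun hΛ i => by
    rw [im_sub_diag_of_isHermitian hYh]; exact hΛ.2 i
  refine ⟨fun Λ hΛ => ⟨Matrix.isDiag_diagonal _, fun i => ?_⟩, fun Λ hΛ i a b => ?_,
    fun Λ hΛ => ?_⟩
  · rw [detEquiv, Matrix.diagonal_apply_eq]
    exact dysonSol_im_neg (varProfile_nonneg γ) (hpos hΛ) i
  · refine DifferentiableOn.analyticOnNhd (fun z hz => ?_) (isOpen_lt continuous_const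
      Complex.continuous_im)
    refine DifferentiableAt.differentiableWithinAt ?_
    simp only [detEquiv, Matrix.diagonal_apply_eq]
    rcases eq_or_ne a b with rfl | hab
    · simp only [Matrix.diagonal_apply_eq]
      refine differentiableAt_dysonSol (varProfile_nonneg γ)
        (W := fun z j => Function.update Λ.diag i z j - Y j j) (fun j => ?_) (fun j => ?_) a
      · rcases eq_or_ne j i with rfl | hj
        · simp
        · simp [hj]
      · have hz' : Matrix.diagonal (Function.update Λ.diag i z) ∈ diagPlus N := by
          refine ⟨Matrix.isDiag_diagonal _, fun l => ?_⟩
          rw [Matrix.diagonal_apply_eq]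
          rcases eq_or_ne l i with rfl | hl
          · simpa using hz
          · simpa [hl] using hΛ.2 l
        simpa using hpos hz' j
    · simp [hab]
  · have hs := varProfile_nonneg γ
    have hfix := fun i => dysonSol_eq_dysonStep hs (hpos hΛ) i
    have him := fun i => (dysonSol_im_neg hs (hpos hΛ) i).le
    rw [diagPart_inv_sub_covMap_sub hYd hΛ.1]
    · simp only [detEquiv, Matrix.diagonal_apply_eq]
      congr 1
      ext i
      exact hfix i
    · intro i
      simp only [detEquiv, Matrix.diagonal_apply_eq]
      exact dysonStep_denom_ne_zero hs (hpos hΛ) him i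

theorem IsDetEquiv.diag_eq_dysonStep (hYh : Y.IsHermitian) (hYd : Y.IsDiag)
    {G : Matrix (Fin N) (Fin N) ℂ → Matrix (Fin N) (Fin N) ℂ} (hG : IsDetEquiv γ Y G)
    {Λ : Matrix (Fin N) (Fin N) ℂ} (hΛ : Λ ∈ diagPlus N) (i : Fin N) :
    G Λ i i = dysonStep (varProfile γ) (fun i => Λ i i - Y i i) (fun j => G Λ j j) i := by
  have h := hG.fixedPoint Λ hΛ
  rw [diagPart_inv_sub_covMap_sub hYd hΛ.1] at h
  · exact (congrFun (congrFun h i) i).trans (Matrix.diagonal_apply_eq _ _)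
  · refine dysonStep_denom_ne_zero (w := fun i => Λ i i - Y i i) (varProfile_nonneg γ)
      (fun i => ?_) (fun i => ((hG.mapsTo hΛ).2 i).le)
    rw [im_sub_diag_of_isHermitian hYh]
    exact hΛ.2 i

theorem IsDetEquiv.eqOn (hYh : Y.IsHermitian) (hYd : Y.IsDiag)
    {G G' : Matrix (Fin N) (Fin N) ℂ → Matrix (Fin N) (Fin N) ℂ} (hG : IsDetEquiv γ Y G)
    (hG' : IsDetEquiv γ Y G') : Set.EqOn G' G (diagPlus N) := by
  intro Λ hΛ
  obtain ⟨η, -, hη, hw, -⟩ := exists_bounds_of_im_pos (w := fun i => Λ i i - Y i i) fun i => by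
    rw [im_sub_diag_of_isHermitian hYh]; exact hΛ.2 i
  have h : ∀ i, G' Λ i i = G Λ i i := fun i => by
    have := norm_sub_le_of_dysonStep_eq (c := 0) (varProfile_nonneg γ) hη hη (fun i => (hw i).le)
      (fun i => (hw i).le) (hG'.diag_eq_dysonStep hYh hYd hΛ) (hG.diag_eq_dysonStep hYh hYd hΛ)
      (hG'.mapsTo hΛ).2 (hG.mapsTo hΛ).2 (fun i => by simp) i
    rw [zero_div] at this
    exact sub_eq_zero.1 (norm_le_zero_iff.1 this)
  rw [← (hG'.mapsTo hΛ).1.diagonal_diag, ← (hG.mapsTo hΛ).1.diagonal_diag]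
  exact congrArg Matrix.diagonal (funext h)

end DetEquiv

/-! ### Convexity inequalities for the hyperbolic cosine of a norm -/

section CoshNorm

/-- Convexity of `x ↦ cosh √x` on `[0, ∞)`, read off its power series. -/
theorem cosh_le_of_sq_eq {θ r x y : ℝ} (h0 : 0 ≤ θ) (h1 : θ ≤ 1)
    (h : r ^ 2 = θ * x ^ 2 + (1 - θ) * y ^ 2) :
    Real.cosh r ≤ θ * Real.cosh x + (1 - θ) * Real.cosh y := by
  refine hasSum_le (fun n => ?_) (Real.hasSum_cosh r)
    (((Real.hasSum_cosh x).mul_left θ).add ((Real.hasSum_cosh y).mul_left (1 - θ)))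
  have := (convexOn_pow (𝕜 := ℝ) n).2 (Set.mem_Ici.2 (sq_nonneg x)) (Set.mem_Ici.2 (sq_nonneg y))
    h0 (sub_nonneg.2 h1) (by ring)
  simp only [smul_eq_mul] at this
  rw [pow_mul, pow_mul, pow_mul, h, ← mul_div_assoc, ← mul_div_assoc, ← add_div]
  gcongr

/-- Pinelis' inequality: up to a term linear in `d`, adding `d` to `a` multiplies `cosh ‖a‖` by at
most `exp ‖d‖ - ‖d‖`. -/
theorem cosh_norm_add_le {E : Type*} [NormedAddCommGroup E] [InnerProductSpace ℝ E] (a d : E) :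
    Real.cosh ‖a + d‖ ≤ Real.cosh ‖a‖ * (Real.exp ‖d‖ - ‖d‖) +
      Real.sinh ‖a‖ / ‖a‖ * inner ℝ a d := by
  have hsd : ‖d‖ ≤ Real.sinh ‖d‖ := Real.self_le_sinh_iff.2 (norm_nonneg d)
  have hexp : Real.exp ‖d‖ = Real.cosh ‖d‖ + Real.sinh ‖d‖ := (Real.cosh_add_sinh _).symm
  rcases eq_or_ne a 0 with rfl | ha
  · simp only [zero_add, norm_zero, Real.cosh_zero, inner_zero_left, mul_zero, add_zero, one_mul]
    linarith
  rcases eq_or_ne d 0 with rfl | hd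
  · simp
  have ha' : 0 < ‖a‖ := norm_pos_iff.2 ha
  have hd' : 0 < ‖d‖ := norm_pos_iff.2 hd
  set t := inner ℝ a d / (‖a‖ * ‖d‖) with ht
  have hin : inner ℝ a d = t * (‖a‖ * ‖d‖) := by rw [ht]; field_simp
  have habs : |t| ≤ 1 := abs_real_inner_div_norm_mul_norm_le_one a d
  obtain ⟨ht1, ht2⟩ := abs_le.1 habs
  have hsq : ‖a + d‖ ^ 2 = (1 + t) / 2 * (‖a‖ + ‖d‖) ^ 2 +
      (1 - (1 + t) / 2) * (‖a‖ - ‖d‖) ^ 2 := by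
    rw [norm_add_sq_real, hin]; ring
  have h1 := cosh_le_of_sq_eq (by linarith) (by linarith) hsq
  rw [Real.cosh_add, Real.cosh_sub] at h1
  have hsa : 0 ≤ Real.sinh ‖a‖ := Real.sinh_nonneg_iff.2 ha'.le
  have hsc : Real.sinh ‖a‖ ≤ Real.cosh ‖a‖ := (Real.sinh_lt_cosh _).le
  have h2 : t * Real.sinh ‖a‖ * (Real.sinh ‖d‖ - ‖d‖) ≤ Real.cosh ‖a‖ * (Real.sinh ‖d‖ - ‖d‖) :=
    mul_le_mul_of_nonneg_right ((mul_le_of_le_one_left hsa ht2).trans hsc) (by linarith)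
  have h3 : Real.sinh ‖a‖ / ‖a‖ * inner ℝ a d = t * Real.sinh ‖a‖ * ‖d‖ := by
    rw [hin]; field_simp
  rw [h3, hexp]
  nlinarith [h1, h2]

/-- On a bounded interval `exp y - y` is `1 + y² / 2`, up to a relative error `τ` in the quadratic
term and a quartic remainder. -/
theorem exists_exp_sub_le {B τ : ℝ} (hτ : 0 < τ) : ∃ c : ℝ, 0 ≤ c ∧ ∀ y : ℝ, 0 ≤ y → y ≤ B →
    Real.exp y - y ≤ 1 + (1 + τ) / 2 * y ^ 2 + c * y ^ 4 := by
  refine ⟨(Real.exp B) ^ 2 / (2 * τ), by positivity, fun y hy hyB => ?_⟩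
  have h1 : Real.exp y - (1 + y + y ^ 2 / 2) ≤ y ^ 3 * Real.exp B := by
    have h := Complex.norm_exp_sub_sum_le_norm_mul_exp (y : ℂ) 3
    rw [Complex.norm_real, Real.norm_of_nonneg hy] at h
    have e : Complex.exp y - ∑ m ∈ Finset.range 3, (y : ℂ) ^ m / (m.factorial : ℂ) =
        ((Real.exp y - (1 + y + y ^ 2 / 2) : ℝ) : ℂ) := by
      simp [Finset.sum_range_succ, Nat.factorial]
    rw [e, Complex.norm_real] at h
    have h2 : y ^ 3 * Real.exp y ≤ y ^ 3 * Real.exp B := by gcongr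
    exact (le_abs_self _).trans (h.trans h2)
  have h2 : y ^ 3 * Real.exp B ≤ τ / 2 * y ^ 2 + (Real.exp B) ^ 2 / (2 * τ) * y ^ 4 := by
    have : 0 ≤ (τ * y - Real.exp B * y ^ 2) ^ 2 / (2 * τ) := by positivity
    have e : (τ * y - Real.exp B * y ^ 2) ^ 2 / (2 * τ) =
        τ / 2 * y ^ 2 + (Real.exp B) ^ 2 / (2 * τ) * y ^ 4 - y ^ 3 * Real.exp B := by
      field_simp; ring
    linarith
  linarith

end CoshNorm

/-! ### Standard Gaussian vectors -/

section StdGaussian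

/-- The law of a vector of independent standard real Gaussian variables. -/
noncomputable def stdGaussPi (κ : Type*) [Fintype κ] : Measure (κ → ℝ) :=
  Measure.pi fun _ => gaussianReal 0 1

variable {κ : Type*} [Fintype κ]

instance : IsProbabilityMeasure (stdGaussPi κ) := by unfold stdGaussPi; infer_instance

theorem map_prod_gaussianReal (a b : ℝ) :
    ((gaussianReal 0 1).prod (gaussianReal 0 1)).map (fun p : ℝ × ℝ => a * p.1 + b * p.2) =
      (gaussianReal 0 1).map fun t => √(a ^ 2 + b ^ 2) * t := by
  have h : (fun p : ℝ × ℝ => a * p.1 + b * p.2) =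
      (fun p : ℝ × ℝ => p.1 + p.2) ∘ Prod.map (fun t => a * t) fun t => b * t := rfl
  rw [h, ← Measure.map_map (by fun_prop) (by fun_prop),
    ← Measure.map_prod_map _ _ (by fun_prop) (by fun_prop), gaussianReal_map_const_mul,
    gaussianReal_map_const_mul, gaussianReal_map_const_mul]
  refine (gaussianReal_conv_gaussianReal).trans ?_
  congr 1
  · ring
  · ext
    simp only [NNReal.coe_add, NNReal.coe_mk, mul_one]
    exact (Real.sq_sqrt (by positivity)).symm

/-- The sum of two independent scaled standard Gaussian vectors is a scaled standard Gaussian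
vector. -/
theorem map_prod_stdGaussPi (a b : ℝ) :
    ((stdGaussPi κ).prod (stdGaussPi κ)).map (fun p => a • p.1 + b • p.2) =
      (stdGaussPi κ).map fun z => √(a ^ 2 + b ^ 2) • z := by
  have h1 := measurePreserving_arrowProdEquivProdArrow ℝ ℝ κ (fun _ => gaussianReal 0 1)
    fun _ => gaussianReal 0 1
  have hA : Measurable fun p : (κ → ℝ) × (κ → ℝ) => a • p.1 + b • p.2 := by fun_prop
  unfold stdGaussPi
  rw [← h1.map_eq, Measure.map_map hA h1.measurable]
  have h2 := Measure.pi_map_pi (μ := fun _ : κ => (gaussianReal 0 1).prod (gaussianReal 0 1))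
    (f := fun _ (p : ℝ × ℝ) => a * p.1 + b * p.2) fun _ => by fun_prop
  have h3 := Measure.pi_map_pi (μ := fun _ : κ => gaussianReal 0 1)
    (f := fun _ (t : ℝ) => √(a ^ 2 + b ^ 2) * t) fun _ => by fun_prop
  simp only [map_prod_gaussianReal] at h2
  exact h2.trans h3.symm

theorem integral_integral_stdGaussPi {E : Type*} [NormedAddCommGroup E] [NormedSpace ℝ E]
    {G : (κ → ℝ) → E} (hG : StronglyMeasurable G) {K : ℝ} (hK : ∀ x, ‖G x‖ ≤ K) (a b : ℝ) :
    ∫ z, G (√(a ^ 2 + b ^ 2) • z) ∂stdGaussPi κ =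
      ∫ z, ∫ z', G (a • z + b • z') ∂stdGaussPi κ ∂stdGaussPi κ := by
  have h := map_prod_stdGaussPi (κ := κ) a b
  have h1 : ∫ z, G z ∂(stdGaussPi κ).map (fun z => √(a ^ 2 + b ^ 2) • z) =
      ∫ z, G (√(a ^ 2 + b ^ 2) • z) ∂stdGaussPi κ :=
    integral_map (by fun_prop) hG.aestronglyMeasurable
  rw [← h1, ← h, integral_map (by fun_prop) hG.aestronglyMeasurable]
  refine integral_prod (fun p : (κ → ℝ) × (κ → ℝ) => G (a • p.1 + b • p.2)) ?_
  refine Integrable.of_bound ?_ K (Filter.Eventually.of_forall fun p => hK _)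
  exact (hG.comp_measurable (by fun_prop)).aestronglyMeasurable

theorem memLp_eval_stdGaussPi (c : κ) (p : NNReal) :
    MemLp (fun z : κ → ℝ => z c) p (stdGaussPi κ) :=
  (memLp_id_gaussianReal p).comp_measurePreserving
    (measurePreserving_eval (fun _ : κ => gaussianReal 0 1) c)

theorem integral_eval_stdGaussPi (c : κ) : ∫ z, z c ∂stdGaussPi κ = 0 := by
  exact (integral_comp_eval (μ := fun _ : κ => gaussianReal 0 1) (i := c) (f := fun t : ℝ => t)
    (by fun_prop)).trans integral_id_gaussianReal

theorem integrable_sum_mul_sq_stdGaussPi (r : κ → ℝ) :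
    Integrable (fun z => (∑ c, r c * z c) ^ 2) (stdGaussPi κ) :=
  (memLp_finsetSum _ fun c _ => (memLp_eval_stdGaussPi c 2).const_mul (r c)).integrable_sq

theorem integral_sum_mul_sq_stdGaussPi (r : κ → ℝ) :
    ∫ z, (∑ c, r c * z c) ^ 2 ∂stdGaussPi κ = ∑ c, r c ^ 2 := by
  have h := variance_sum_pi (μ := fun _ : κ => gaussianReal 0 1) (X := fun c t => r c * t)
    fun c => (memLp_id_gaussianReal 2).const_mul (r c)
  have hc : ∀ c, Var[fun t => r c * t; gaussianReal 0 1] = r c ^ 2 := fun c => by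
    rw [variance_const_mul, variance_fun_id_gaussianReal, NNReal.coe_one, mul_one]
  rw [← Finset.sum_congr rfl fun c _ => hc c, ← h, variance_eq_integral (by fun_prop)]
  have h0 : ∫ z : κ → ℝ, (∑ c, fun ω : κ → ℝ => r c * ω c) z ∂stdGaussPi κ = 0 := by
    simp only [Finset.sum_apply]
    rw [integral_finsetSum _ fun c _ => ((memLp_eval_stdGaussPi c 1).integrable le_rfl).const_mul _]
    simp [integral_const_mul, integral_eval_stdGaussPi]
  change _ = ∫ z, ((∑ c, fun ω : κ → ℝ => r c * ω c) z -
    ∫ z : κ → ℝ, (∑ c, fun ω : κ → ℝ => r c * ω c) z ∂stdGaussPi κ) ^ 2 ∂stdGaussPi κ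
  rw [h0]
  simp

theorem norm_sum_mul_sq (D : κ → ℂ) (z : κ → ℝ) : ‖∑ c, (z c : ℂ) * D c‖ ^ 2 =
    (∑ c, (D c).re * z c) ^ 2 + (∑ c, (D c).im * z c) ^ 2 := by
  rw [← Complex.normSq_eq_norm_sq, Complex.normSq_apply]
  simp [Complex.re_sum, Complex.im_sum, sq, mul_comm]

theorem integrable_norm_sum_mul_sq (D : κ → ℂ) :
    Integrable (fun z : κ → ℝ => ‖∑ c, (z c : ℂ) * D c‖ ^ 2) (stdGaussPi κ) := by
  simp only [norm_sum_mul_sq]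
  exact (integrable_sum_mul_sq_stdGaussPi _).add (integrable_sum_mul_sq_stdGaussPi _)

theorem integral_norm_sum_mul_sq (D : κ → ℂ) :
    ∫ z, ‖∑ c, (z c : ℂ) * D c‖ ^ 2 ∂stdGaussPi κ = ∑ c, ‖D c‖ ^ 2 := by
  simp only [norm_sum_mul_sq]
  rw [integral_add (integrable_sum_mul_sq_stdGaussPi _) (integrable_sum_mul_sq_stdGaussPi _),
    integral_sum_mul_sq_stdGaussPi, integral_sum_mul_sq_stdGaussPi, ← Finset.sum_add_distrib]
  refine Finset.sum_congr rfl fun c _ => ?_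
  rw [← Complex.normSq_eq_norm_sq, Complex.normSq_apply]
  ring

theorem integrable_sum_sq_sq_stdGaussPi :
    Integrable (fun z : κ → ℝ => (∑ c, z c ^ 2) ^ 2) (stdGaussPi κ) := by
  refine (memLp_finsetSum (p := 2) _ fun c _ => ?_).integrable_sq
  rw [memLp_two_iff_integrable_sq ((measurable_pi_apply c).pow_const 2).aestronglyMeasurable]
  have h := (memLp_eval_stdGaussPi c 4).integrable_norm_pow (by norm_num)
  refine h.congr (Filter.Eventually.of_forall fun z => ?_)
  norm_num [← pow_mul]
  exact Even.pow_abs (by decide) _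

end StdGaussian

/-! ### Gaussian concentration for complex-valued functions -/

section Variance

variable {α E : Type*} [MeasurableSpace α] {μ : Measure α} [IsProbabilityMeasure μ]
  [NormedAddCommGroup E] [InnerProductSpace ℝ E] [CompleteSpace E] {f : α → E}

theorem integral_norm_sub_sq (hf : MemLp f 2 μ) (a : E) :
    ∫ x, ‖f x - a‖ ^ 2 ∂μ = ∫ x, ‖f x - ∫ y, f y ∂μ‖ ^ 2 ∂μ + ‖∫ y, f y ∂μ - a‖ ^ 2 := by
  set m := ∫ y, f y ∂μ with hm
  have h1 : ∀ x, ‖f x - a‖ ^ 2 = ‖f x - m‖ ^ 2 + 2 * inner ℝ (m - a) (f x - m) + ‖m - a‖ ^ 2 := by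
    intro x
    rw [show f x - a = (f x - m) + (m - a) by abel, norm_add_sq_real, real_inner_comm]
  have hi : Integrable f μ := hf.integrable (by norm_num)
  have hisub : Integrable (fun x => f x - m) μ := hi.sub (integrable_const m)
  have hi2 : Integrable (fun x => ‖f x - m‖ ^ 2) μ :=
    (hf.sub (memLp_const m)).integrable_norm_pow (by norm_num)
  have hin : Integrable (fun x => inner ℝ (m - a) (f x - m)) μ :=
    hisub.const_inner _
  have h0 : ∫ x, inner ℝ (m - a) (f x - m) ∂μ = 0 := by
    rw [integral_inner hisub, integral_sub hi (integrable_const m)]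
    simp [hm]
  have hi3 : Integrable (fun x => ‖f x - m‖ ^ 2 + 2 * inner ℝ (m - a) (f x - m)) μ :=
    hi2.add (hin.const_mul 2)
  simp_rw [h1]
  rw [integral_add hi3 (integrable_const _), integral_add hi2 (hin.const_mul 2),
    integral_const_mul, h0]
  simp

theorem norm_integral_sq_le (hf : MemLp f 2 μ) : ‖∫ x, f x ∂μ‖ ^ 2 ≤ ∫ x, ‖f x‖ ^ 2 ∂μ := by
  have h := integral_norm_sub_sq hf 0
  simp only [sub_zero] at h
  rw [h]
  exact le_add_of_nonneg_left (integral_nonneg fun x => by positivity)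

theorem integral_norm_sub_integral_sq_le (hf : MemLp f 2 μ) (a : E) :
    ∫ x, ‖f x - ∫ y, f y ∂μ‖ ^ 2 ∂μ ≤ ∫ x, ‖f x - a‖ ^ 2 ∂μ := by
  rw [integral_norm_sub_sq hf a]
  exact le_add_of_nonneg_right (by positivity)

end Variance

section Concentration

variable {κ : Type*} [Fintype κ] {K L C V r τ : ℝ} {F : (κ → ℝ) → ℂ} {D : κ → (κ → ℝ) → ℂ}

/-- A bounded Lipschitz function with a first-order expansion of uniformly quadratic error. `V`
bounds the squared Euclidean norm of the gradient `D`. This class of functions, with the same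
constants, is stable under averaging over translations. -/
structure HasBoundedGradient (K L C V : ℝ) (F : (κ → ℝ) → ℂ) (D : κ → (κ → ℝ) → ℂ) : Prop where
  measurable : Measurable F
  measurable_grad : ∀ c, Measurable (D c)
  norm_le : ∀ x, ‖F x‖ ≤ K
  lipschitz : ∀ x h, ‖F (x + h) - F x‖ ≤ L * √(∑ c, h c ^ 2)
  expansion : ∀ x h, ‖F (x + h) - F x - ∑ c, (h c : ℂ) * D c x‖ ≤ C * ∑ c, h c ^ 2
  grad_sq_le : ∀ x, ∑ c, ‖D c x‖ ^ 2 ≤ V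

namespace HasBoundedGradient

theorem norm_grad_le (hF : HasBoundedGradient K L C V F D) (c : κ) (x : κ → ℝ) :
    ‖D c x‖ ≤ √V :=
  Real.le_sqrt_of_sq_le ((Finset.single_le_sum (f := fun c => ‖D c x‖ ^ 2)
    (fun _ _ => by positivity) (Finset.mem_univ c)).trans (hF.grad_sq_le x))

theorem nonneg (hF : HasBoundedGradient K L C V F D) : 0 ≤ K ∧ 0 ≤ V :=
  ⟨(norm_nonneg _).trans (hF.norm_le 0),
    (Finset.sum_nonneg fun _ _ => by positivity).trans (hF.grad_sq_le 0)⟩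

theorem memLp (hF : HasBoundedGradient K L C V F D) {α : Type*} [MeasurableSpace α]
    {μ : Measure α} [IsFiniteMeasure μ] {p : α → κ → ℝ} (hp : Measurable p) (q : ENNReal) :
    MemLp (fun a => F (p a)) q μ :=
  MemLp.of_bound (hF.measurable.comp hp).aestronglyMeasurable K
    (Filter.Eventually.of_forall fun _ => hF.norm_le _)

theorem memLp_grad (hF : HasBoundedGradient K L C V F D) {α : Type*} [MeasurableSpace α]
    {μ : Measure α} [IsFiniteMeasure μ] {p : α → κ → ℝ} (hp : Measurable p) (c : κ) (q : ENNReal) :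
    MemLp (fun a => D c (p a)) q μ :=
  MemLp.of_bound ((hF.measurable_grad c).comp hp).aestronglyMeasurable (√V)
    (Filter.Eventually.of_forall fun _ => hF.norm_grad_le _ _)

theorem average (hF : HasBoundedGradient K L C V F D) (r : ℝ) :
    HasBoundedGradient K L C V (fun x => ∫ z, F (x + r • z) ∂stdGaussPi κ)
      fun c x => ∫ z, D c (x + r • z) ∂stdGaussPi κ := by
  have hm : ∀ x : κ → ℝ, Measurable fun z : κ → ℝ => x + r • z := fun x => by fun_prop
  have hi : ∀ x, Integrable (fun z => F (x + r • z)) (stdGaussPi κ) := fun x =>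
    (hF.memLp (hm x) 1).integrable le_rfl
  have hid : ∀ c x, Integrable (fun z => D c (x + r • z)) (stdGaussPi κ) := fun c x =>
    (hF.memLp_grad (hm x) c 1).integrable le_rfl
  have hm2 : Measurable fun p : (κ → ℝ) × (κ → ℝ) => p.1 + r • p.2 := by fun_prop
  refine ⟨?_, fun c => ?_, fun x => ?_, fun x h => ?_, fun x h => ?_, fun x => ?_⟩
  · exact ((hF.measurable.comp hm2).stronglyMeasurable.integral_prod_right').measurable
  · exact (((hF.measurable_grad c).comp hm2).stronglyMeasurable.integral_prod_right').measurable
  · refine (norm_integral_le_of_norm_le_const (Filter.Eventually.of_forall fun _ =>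
      hF.norm_le _)).trans ?_
    simp
  · rw [← integral_sub (hi _) (hi _)]
    refine (norm_integral_le_of_norm_le_const (C := L * √(∑ c, h c ^ 2))
      (Filter.Eventually.of_forall fun z => ?_)).trans (by simp)
    rw [add_right_comm]
    exact hF.lipschitz _ _
  · have e : ∑ c, (h c : ℂ) * ∫ z, D c (x + r • z) ∂stdGaussPi κ =
        ∫ z, ∑ c, (h c : ℂ) * D c (x + r • z) ∂stdGaussPi κ := by
      rw [integral_finsetSum _ fun c _ => (hid c x).const_mul _]
      simp [integral_const_mul]
    have hi' : Integrable (fun z => F (x + h + r • z) - F (x + r • z)) (stdGaussPi κ) :=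
      (hi _).sub (hi _)
    rw [e, ← integral_sub (hi _) (hi _), ← integral_sub hi'
      (integrable_finsetSum _ fun c _ => (hid c x).const_mul _)]
    refine (norm_integral_le_of_norm_le_const (C := C * ∑ c, h c ^ 2)
      (Filter.Eventually.of_forall fun z => ?_)).trans (by simp)
    rw [add_right_comm]
    exact hF.expansion _ _
  · have hisq : ∀ c, Integrable (fun z => ‖D c (x + r • z)‖ ^ 2) (stdGaussPi κ) := fun c =>
      (hF.memLp_grad (hm x) c 2).integrable_norm_pow (by norm_num)
    calc ∑ c, ‖∫ z, D c (x + r • z) ∂stdGaussPi κ‖ ^ 2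
        ≤ ∑ c, ∫ z, ‖D c (x + r • z)‖ ^ 2 ∂stdGaussPi κ :=
          Finset.sum_le_sum fun c _ => norm_integral_sq_le (hF.memLp_grad (hm x) c 2)
      _ = ∫ z, ∑ c, ‖D c (x + r • z)‖ ^ 2 ∂stdGaussPi κ :=
          (integral_finsetSum _ fun c _ => hisq c).symm
      _ ≤ ∫ _, V ∂stdGaussPi κ := integral_mono (integrable_finsetSum _ fun c _ => hisq c)
          (integrable_const _) fun z => hF.grad_sq_le _
      _ = V := by simp

theorem sum_smul_sq (r : ℝ) (z : κ → ℝ) : ∑ c, (r • z) c ^ 2 = r ^ 2 * ∑ c, z c ^ 2 := by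
  simp [mul_pow, Finset.mul_sum]

theorem integral_norm_sub_sq_le (hF : HasBoundedGradient K L C V F D) (hτ : 0 < τ) (r : ℝ)
    (x : κ → ℝ) :
    ∫ z, ‖F (x + r • z) - F x‖ ^ 2 ∂stdGaussPi κ ≤ (1 + τ) * V * r ^ 2 +
      (1 + 1 / τ) * C ^ 2 * (∫ z : κ → ℝ, (∑ c, z c ^ 2) ^ 2 ∂stdGaussPi κ) * r ^ 4 := by
  have hpt : ∀ z : κ → ℝ, ‖F (x + r • z) - F x‖ ^ 2 ≤
      (1 + τ) * r ^ 2 * ‖∑ c, (z c : ℂ) * D c x‖ ^ 2 +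
        (1 + 1 / τ) * C ^ 2 * r ^ 4 * (∑ c, z c ^ 2) ^ 2 := by
    intro z
    have h1 := hF.expansion x (r • z)
    have e : ∑ c, (((r • z) c : ℝ) : ℂ) * D c x = (r : ℂ) * ∑ c, (z c : ℂ) * D c x := by
      rw [Finset.mul_sum]
      refine Finset.sum_congr rfl fun c _ => ?_
      simp [mul_assoc]
    rw [sum_smul_sq, e] at h1
    set A := ∑ c, (z c : ℂ) * D c x
    set Q := ∑ c, z c ^ 2
    have h2 : ‖F (x + r • z) - F x‖ ≤ |r| * ‖A‖ + C * (r ^ 2 * Q) := by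
      have := norm_add_le (F (x + r • z) - F x - r * A) (r * A)
      rw [sub_add_cancel, norm_mul, Complex.norm_real, Real.norm_eq_abs] at this
      linarith
    calc ‖F (x + r • z) - F x‖ ^ 2 ≤ (|r| * ‖A‖ + C * (r ^ 2 * Q)) ^ 2 := by gcongr
      _ ≤ (1 + τ) * (|r| * ‖A‖) ^ 2 + (1 + 1 / τ) * (C * (r ^ 2 * Q)) ^ 2 := by
        have : 0 ≤ (τ * (|r| * ‖A‖) - C * (r ^ 2 * Q)) ^ 2 / τ := by positivity
        have e2 : (τ * (|r| * ‖A‖) - C * (r ^ 2 * Q)) ^ 2 / τ = τ * (|r| * ‖A‖) ^ 2 +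
            1 / τ * (C * (r ^ 2 * Q)) ^ 2 - 2 * (|r| * ‖A‖) * (C * (r ^ 2 * Q)) := by
          field_simp; ring
        linarith
      _ = _ := by rw [mul_pow |r|, sq_abs]; ring
  have hm : Measurable fun z : κ → ℝ => x + r • z := by fun_prop
  have hi1 : Integrable (fun z => ‖F (x + r • z) - F x‖ ^ 2) (stdGaussPi κ) :=
    ((hF.memLp hm 2).sub (memLp_const _)).integrable_norm_pow (by norm_num)
  have hi2 := (integrable_norm_sum_mul_sq fun c => D c x).const_mul ((1 + τ) * r ^ 2)
  have hi3 := (integrable_sum_sq_sq_stdGaussPi (κ := κ)).const_mul ((1 + 1 / τ) * C ^ 2 * r ^ 4)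
  refine (integral_mono hi1 (hi2.add hi3) hpt).trans ?_
  rw [integral_add' hi2 hi3, integral_const_mul, integral_const_mul, integral_norm_sum_mul_sq]
  have := mul_le_mul_of_nonneg_left (hF.grad_sq_le x) (by positivity : 0 ≤ (1 + τ) * r ^ 2)
  linarith

theorem integral_norm_sub_integral_pow_four_le (hF : HasBoundedGradient K L C V F D) (r : ℝ)
    (x : κ → ℝ) :
    ∫ z, ‖F (x + r • z) - ∫ z', F (x + r • z') ∂stdGaussPi κ‖ ^ 4 ∂stdGaussPi κ ≤
      16 * L ^ 4 * (∫ z : κ → ℝ, (∑ c, z c ^ 2) ^ 2 ∂stdGaussPi κ) * r ^ 4 := by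
  have hm : Measurable fun z : κ → ℝ => x + r • z := by fun_prop
  set e : (κ → ℝ) → ℂ := fun z => F (x + r • z) - F x with he
  have hme : ∀ q, MemLp e q (stdGaussPi κ) := fun q => (hF.memLp hm q).sub (memLp_const _)
  have hd : ∀ z, F (x + r • z) - ∫ z', F (x + r • z') ∂stdGaussPi κ =
      e z - ∫ z', e z' ∂stdGaussPi κ := by
    intro z
    have : ∫ z', e z' ∂stdGaussPi κ = ∫ z', F (x + r • z') ∂stdGaussPi κ - F x := by
      rw [he, integral_sub ((hF.memLp hm 1).integrable le_rfl) (integrable_const _)]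
      simp
    rw [this, he]
    simp
  have hi4 : Integrable (fun z => ‖e z‖ ^ 4) (stdGaussPi κ) :=
    (hme 4).integrable_norm_pow (by norm_num)
  have hm2 : MemLp (fun z => ‖e z‖ ^ 2) 2 (stdGaussPi κ) := by
    refine MemLp.of_bound (((hF.measurable.comp hm).sub_const _).norm.pow_const 2
      ).aestronglyMeasurable ((2 * K) ^ 2) (Filter.Eventually.of_forall fun z => ?_)
    rw [Real.norm_of_nonneg (by positivity)]
    have : ‖e z‖ ≤ 2 * K :=
      (norm_sub_le _ _).trans (by linarith [hF.norm_le (x + r • z), hF.norm_le x])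
    gcongr
  have hmean : ‖∫ z', e z' ∂stdGaussPi κ‖ ^ 4 ≤ ∫ z, ‖e z‖ ^ 4 ∂stdGaussPi κ := by
    have h1 := norm_integral_sq_le (hme 2)
    have h2 := norm_integral_sq_le hm2
    simp only [Real.norm_eq_abs, sq_abs, ← pow_mul] at h2
    calc ‖∫ z', e z' ∂stdGaussPi κ‖ ^ 4 = (‖∫ z', e z' ∂stdGaussPi κ‖ ^ 2) ^ 2 := by ring
      _ ≤ (∫ z, ‖e z‖ ^ 2 ∂stdGaussPi κ) ^ 2 := by gcongr
      _ ≤ _ := h2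
  have hQ : ∫ z, ‖e z‖ ^ 4 ∂stdGaussPi κ ≤
      L ^ 4 * r ^ 4 * ∫ z : κ → ℝ, (∑ c, z c ^ 2) ^ 2 ∂stdGaussPi κ := by
    rw [← integral_const_mul]
    refine integral_mono hi4 (integrable_sum_sq_sq_stdGaussPi.const_mul _) fun z => ?_
    have h1 := hF.lipschitz x (r • z)
    rw [sum_smul_sq] at h1
    have h2 : √(r ^ 2 * ∑ c, z c ^ 2) ^ 2 = r ^ 2 * ∑ c, z c ^ 2 :=
      Real.sq_sqrt (mul_nonneg (sq_nonneg _) (Finset.sum_nonneg fun c _ => sq_nonneg _))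
    calc ‖e z‖ ^ 4 ≤ (L * √(r ^ 2 * ∑ c, z c ^ 2)) ^ 4 := by gcongr
      _ = L ^ 4 * (√(r ^ 2 * ∑ c, z c ^ 2) ^ 2) ^ 2 := by ring
      _ = _ := by rw [h2]; ring
  calc _ ≤ ∫ z, (8 * ‖e z‖ ^ 4 + 8 * ‖∫ z', e z' ∂stdGaussPi κ‖ ^ 4) ∂stdGaussPi κ := by
        refine integral_mono ?_ ((hi4.const_mul 8).add (integrable_const _)) fun z => ?_
        · exact ((hF.memLp hm 4).sub (memLp_const _)).integrable_norm_pow (by norm_num)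
        · simp only [hd]
          have h1 := norm_sub_le (e z) (∫ z', e z' ∂stdGaussPi κ)
          set p := ‖e z‖
          set q := ‖∫ z', e z' ∂stdGaussPi κ‖
          calc _ ≤ (p + q) ^ 4 := by gcongr
            _ ≤ 2 ^ (4 - 1) * (p ^ 4 + q ^ 4) := add_pow_le (norm_nonneg _) (norm_nonneg _) 4
            _ = _ := by norm_num; ring
    _ = 8 * ∫ z, ‖e z‖ ^ 4 ∂stdGaussPi κ + 8 * ‖∫ z', e z' ∂stdGaussPi κ‖ ^ 4 := by
        rw [integral_add (hi4.const_mul 8) (integrable_const _), integral_const_mul]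
        simp
    _ ≤ _ := by linarith

/-- One Gaussian increment of standard deviation `r` multiplies `E cosh ‖F - m‖` by at most
`1 + V r² / 2`, up to a small relative error and terms of order `r⁴`. -/
theorem exists_integral_cosh_le (κ : Type*) [Fintype κ] (K L C V : ℝ) (hτ : 0 < τ) :
    ∃ c : ℝ, 0 ≤ c ∧ ∀ (F : (κ → ℝ) → ℂ) (D : κ → (κ → ℝ) → ℂ),
      HasBoundedGradient K L C V F D → ∀ (r : ℝ) (x : κ → ℝ) (m : ℂ),
      ∫ z, Real.cosh ‖F (x + r • z) - m‖ ∂stdGaussPi κ ≤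
        Real.cosh ‖∫ z, F (x + r • z) ∂stdGaussPi κ - m‖ *
          (1 + (1 + τ) ^ 2 / 2 * V * r ^ 2 + c * r ^ 4) := by
  obtain ⟨c₁, hc₁, hexp⟩ := exists_exp_sub_le (B := 2 * K) hτ
  set Q := ∫ z : κ → ℝ, (∑ c, z c ^ 2) ^ 2 ∂stdGaussPi κ with hQ
  have hQ0 : 0 ≤ Q := integral_nonneg fun z => by positivity
  refine ⟨(1 + τ) / 2 * ((1 + 1 / τ) * C ^ 2 * Q) + c₁ * (16 * L ^ 4 * Q), by positivity,
    fun F D hF r x m => ?_⟩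
  have hm : Measurable fun z : κ → ℝ => x + r • z := by fun_prop
  set M := ∫ z, F (x + r • z) ∂stdGaussPi κ with hM
  have hMK : ‖M‖ ≤ K := (hF.average r).norm_le x
  set d : (κ → ℝ) → ℂ := fun z => F (x + r • z) - M with hd
  have hmd : ∀ q, MemLp d q (stdGaussPi κ) := fun q => (hF.memLp hm q).sub (memLp_const _)
  have hdm : Measurable d := (hF.measurable.comp hm).sub_const _
  have hd2K : ∀ z, ‖d z‖ ≤ 2 * K := fun z =>
    (norm_sub_le _ _).trans (by linarith [hF.norm_le (x + r • z)])
  have hd0 : ∫ z, d z ∂stdGaussPi κ = 0 := by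
    rw [hd, integral_sub ((hF.memLp hm 1).integrable le_rfl) (integrable_const _)]
    simp [hM]
  have hi2 : Integrable (fun z => ‖d z‖ ^ 2) (stdGaussPi κ) :=
    (hmd 2).integrable_norm_pow (by norm_num)
  have hi4 : Integrable (fun z => ‖d z‖ ^ 4) (stdGaussPi κ) :=
    (hmd 4).integrable_norm_pow (by norm_num)
  have hiin : Integrable (fun z => inner ℝ (M - m) (d z)) (stdGaussPi κ) :=
    ((hmd 1).integrable le_rfl).const_inner _
  have hexpm : Integrable (fun z => Real.exp ‖d z‖ - ‖d z‖) (stdGaussPi κ) := by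
    refine Integrable.sub ?_ ((hmd 1).integrable le_rfl).norm
    refine Integrable.of_bound (Real.measurable_exp.comp hdm.norm).aestronglyMeasurable
      (Real.exp (2 * K)) (Filter.Eventually.of_forall fun z => ?_)
    rw [Real.norm_of_nonneg (Real.exp_pos _).le]
    exact Real.exp_le_exp.2 (hd2K z)
  have hcosh : Integrable (fun z => Real.cosh ‖F (x + r • z) - m‖) (stdGaussPi κ) := by
    refine Integrable.of_bound (Real.continuous_cosh.measurable.comp
      ((hF.measurable.comp hm).sub_const m).norm).aestronglyMeasurable
      (Real.cosh (K + ‖m‖)) (Filter.Eventually.of_forall fun z => ?_)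
    have h1 : ‖F (x + r • z) - m‖ ≤ K + ‖m‖ :=
      (norm_sub_le _ _).trans (by linarith [hF.norm_le (x + r • z)])
    rw [Real.norm_of_nonneg (Real.cosh_pos _).le, Real.cosh_le_cosh, abs_of_nonneg (norm_nonneg _)]
    exact h1.trans (le_abs_self _)
  have hd2 : ∫ z, ‖d z‖ ^ 2 ∂stdGaussPi κ ≤ (1 + τ) * V * r ^ 2 + (1 + 1 / τ) * C ^ 2 * Q * r ^ 4 :=
    (integral_norm_sub_integral_sq_le (hF.memLp hm 2) (F x)).trans
      (hF.integral_norm_sub_sq_le hτ r x)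
  have hd4 : ∫ z, ‖d z‖ ^ 4 ∂stdGaussPi κ ≤ 16 * L ^ 4 * Q * r ^ 4 :=
    hF.integral_norm_sub_integral_pow_four_le r x
  have hE : ∫ z, (Real.exp ‖d z‖ - ‖d z‖) ∂stdGaussPi κ ≤ 1 + (1 + τ) ^ 2 / 2 * V * r ^ 2 +
      ((1 + τ) / 2 * ((1 + 1 / τ) * C ^ 2 * Q) + c₁ * (16 * L ^ 4 * Q)) * r ^ 4 := by
    have h1 := integral_mono hexpm (((integrable_const 1).add (hi2.const_mul ((1 + τ) / 2))).add
      (hi4.const_mul c₁)) fun z => hexp ‖d z‖ (norm_nonneg _) (hd2K z)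
    refine h1.trans ?_
    rw [integral_add' ((integrable_const 1).add (hi2.const_mul ((1 + τ) / 2))) (hi4.const_mul c₁),
      integral_add' (integrable_const 1) (hi2.const_mul ((1 + τ) / 2)), integral_const_mul,
      integral_const_mul]
    simp only [integral_const, probReal_univ, smul_eq_mul, mul_one]
    have h2 := mul_le_mul_of_nonneg_left hd2 (by positivity : 0 ≤ (1 + τ) / 2)
    have h3 := mul_le_mul_of_nonneg_left hd4 hc₁
    linarith
  have hpt : ∀ z, Real.cosh ‖F (x + r • z) - m‖ ≤
      Real.cosh ‖M - m‖ * (Real.exp ‖d z‖ - ‖d z‖) +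
        Real.sinh ‖M - m‖ / ‖M - m‖ * inner ℝ (M - m) (d z) := fun z => by
    have := cosh_norm_add_le (M - m) (d z)
    rwa [show M - m + d z = F (x + r • z) - m by simp [hd]] at this
  refine (integral_mono hcosh ((hexpm.const_mul _).add (hiin.const_mul _)) hpt).trans ?_
  rw [integral_add' (hexpm.const_mul _) (hiin.const_mul _), integral_const_mul, integral_const_mul,
    integral_inner ((hmd 1).integrable le_rfl), hd0, inner_zero_right, mul_zero, add_zero]
  exact mul_le_mul_of_nonneg_left hE (Real.cosh_pos _).le

end HasBoundedGradient

end Concentration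

section ConcentrationBound

variable {κ : Type*} [Fintype κ] {K L C V r τ : ℝ} {F : (κ → ℝ) → ℂ} {D : κ → (κ → ℝ) → ℂ}

namespace HasBoundedGradient

theorem const_mul (hF : HasBoundedGradient K L C V F D) {l : ℝ} (hl : 0 ≤ l) :
    HasBoundedGradient (l * K) (l * L) (l * C) (l ^ 2 * V) (fun x => (l : ℂ) * F x)
      fun c x => (l : ℂ) * D c x := by
  have hn : ‖(l : ℂ)‖ = l := by rw [Complex.norm_real, Real.norm_of_nonneg hl]
  refine ⟨hF.measurable.const_mul _, fun c => (hF.measurable_grad c).const_mul _, fun x => ?_,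
    fun x h => ?_, fun x h => ?_, fun x => ?_⟩
  · rw [norm_mul, hn]
    exact mul_le_mul_of_nonneg_left (hF.norm_le x) hl
  · rw [← mul_sub, norm_mul, hn, mul_assoc]
    exact mul_le_mul_of_nonneg_left (hF.lipschitz x h) hl
  · have e : ∑ c, (h c : ℂ) * ((l : ℂ) * D c x) = (l : ℂ) * ∑ c, (h c : ℂ) * D c x := by
      rw [Finset.mul_sum]
      exact Finset.sum_congr rfl fun c _ => by ring
    rw [e, ← mul_sub, ← mul_sub, norm_mul, hn, mul_assoc]
    exact mul_le_mul_of_nonneg_left (hF.expansion x h) hl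
  · simp only [norm_mul, hn, mul_pow, ← Finset.mul_sum]
    exact mul_le_mul_of_nonneg_left (hF.grad_sq_le x) (sq_nonneg l)

theorem measurable_cosh_norm_sub (hF : HasBoundedGradient K L C V F D) (m : ℂ) :
    Measurable fun x => Real.cosh ‖F x - m‖ :=
  Real.continuous_cosh.measurable.comp (hF.measurable.sub_const m).norm

theorem cosh_norm_sub_le (hF : HasBoundedGradient K L C V F D) (m : ℂ) (x : κ → ℝ) :
    ‖Real.cosh ‖F x - m‖‖ ≤ Real.cosh (K + ‖m‖) := by
  rw [Real.norm_of_nonneg (Real.cosh_pos _).le, Real.cosh_le_cosh, abs_of_nonneg (norm_nonneg _)]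
  exact (norm_sub_le _ _).trans ((add_le_add_left (hF.norm_le x) _).trans (le_abs_self _))

theorem integrable_cosh (hF : HasBoundedGradient K L C V F D) (m : ℂ) {p : (κ → ℝ) → κ → ℝ}
    (hp : Measurable p) : Integrable (fun z => Real.cosh ‖F (p z) - m‖) (stdGaussPi κ) :=
  Integrable.of_bound ((hF.measurable_cosh_norm_sub m).comp hp).aestronglyMeasurable _
    (Filter.Eventually.of_forall fun _ => hF.cosh_norm_sub_le m _)

theorem integral_cosh_le_pow {b : ℝ} (hb : 0 ≤ b)
    (hstep : ∀ (F : (κ → ℝ) → ℂ) (D : κ → (κ → ℝ) → ℂ), HasBoundedGradient K L C V F D →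
      ∀ (x : κ → ℝ) (m : ℂ), ∫ z, Real.cosh ‖F (x + r • z) - m‖ ∂stdGaussPi κ ≤
        Real.cosh ‖∫ z, F (x + r • z) ∂stdGaussPi κ - m‖ * b) (k : ℕ)
    (hF : HasBoundedGradient K L C V F D) :
    ∫ z, Real.cosh ‖F (√(k * r ^ 2) • z) - ∫ z', F (√(k * r ^ 2) • z') ∂stdGaussPi κ‖
      ∂stdGaussPi κ ≤ b ^ k := by
  induction k generalizing F D with
  | zero => simp
  | succ k ih =>
    have e : √(((k + 1 : ℕ) : ℝ) * r ^ 2) = √(√(k * r ^ 2) ^ 2 + r ^ 2) := by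
      rw [Real.sq_sqrt (by positivity)]
      congr 1
      push_cast
      ring
    rw [e]
    set a := √(k * r ^ 2) with ha
    have hav := hF.average r
    have h1 := integral_integral_stdGaussPi hF.measurable.stronglyMeasurable hF.norm_le a r
    rw [h1]
    set m := ∫ z, ∫ z', F (a • z + r • z') ∂stdGaussPi κ ∂stdGaussPi κ with hm
    rw [integral_integral_stdGaussPi (hF.measurable_cosh_norm_sub m).stronglyMeasurable
      (hF.cosh_norm_sub_le m) a r]
    have hpa : Measurable fun z : κ → ℝ => a • z := by fun_prop
    calc ∫ z, ∫ z', Real.cosh ‖F (a • z + r • z') - m‖ ∂stdGaussPi κ ∂stdGaussPi κ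
        ≤ ∫ z, Real.cosh ‖∫ z', F (a • z + r • z') ∂stdGaussPi κ - m‖ * b ∂stdGaussPi κ := by
          refine integral_mono ?_ ((hav.integrable_cosh m hpa).mul_const b)
            fun z => hstep F D hF (a • z) m
          refine Integrable.of_bound ?_ (Real.cosh (K + ‖m‖))
            (Filter.Eventually.of_forall fun z => ?_)
          · refine (StronglyMeasurable.integral_prod_right' (f := fun p : (κ → ℝ) × (κ → ℝ) =>
              Real.cosh ‖F (a • p.1 + r • p.2) - m‖) ?_).aestronglyMeasurable
            exact ((hF.measurable_cosh_norm_sub m).comp (by fun_prop)).stronglyMeasurable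
          · exact (norm_integral_le_of_norm_le_const (Filter.Eventually.of_forall fun _ =>
              hF.cosh_norm_sub_le m _)).trans (by simp)
      _ = (∫ z, Real.cosh ‖∫ z', F (a • z + r • z') ∂stdGaussPi κ - m‖ ∂stdGaussPi κ) * b :=
          integral_mul_const _ _
      _ ≤ b ^ k * b := mul_le_mul_of_nonneg_right (ih hav) hb
      _ = b ^ (k + 1) := (pow_succ _ _).symm

open Filter Topology in
/-- Splitting a Gaussian vector into `n` increments and letting `n → ∞`, only the quadratic term of
the one-step estimate survives. -/
theorem integral_cosh_le_exp (hF : HasBoundedGradient K L C V F D) :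
    ∫ z, Real.cosh ‖F z - ∫ z', F z' ∂stdGaussPi κ‖ ∂stdGaussPi κ ≤ Real.exp (V / 2) := by
  have hV := hF.nonneg.2
  have key : ∀ τ : ℝ, 0 < τ → ∫ z, Real.cosh ‖F z - ∫ z', F z' ∂stdGaussPi κ‖ ∂stdGaussPi κ ≤
      Real.exp ((1 + τ) ^ 2 / 2 * V) := by
    intro τ hτ
    obtain ⟨c, hc, hstep⟩ := exists_integral_cosh_le κ K L C V hτ
    have hlim : Tendsto (fun n : ℕ => Real.exp ((1 + τ) ^ 2 / 2 * V + c / (n : ℝ))) atTop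
        (𝓝 (Real.exp ((1 + τ) ^ 2 / 2 * V + 0))) :=
      (Real.continuous_exp.tendsto _).comp
        ((tendsto_const_div_atTop_nhds_zero_nat c).const_add _)
    rw [add_zero] at hlim
    refine ge_of_tendsto hlim ((eventually_ge_atTop 1).mono fun n hn => ?_)
    have hn0 : (0 : ℝ) < n := by exact_mod_cast hn
    have hr2 : √(1 / (n : ℝ)) ^ 2 = 1 / n := Real.sq_sqrt (by positivity)
    have h1 := integral_cosh_le_pow (r := √(1 / (n : ℝ)))
      (b := 1 + (1 + τ) ^ 2 / 2 * V * √(1 / (n : ℝ)) ^ 2 + c * √(1 / (n : ℝ)) ^ 4)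
      (by positivity) (fun F D hF x m => hstep F D hF _ x m) n hF
    have e1 : √((n : ℝ) * √(1 / (n : ℝ)) ^ 2) = 1 := by
      rw [hr2, mul_one_div_cancel hn0.ne', Real.sqrt_one]
    simp only [e1, one_smul] at h1
    refine h1.trans ?_
    have e2 : √(1 / (n : ℝ)) ^ 4 = (1 / n) ^ 2 := by
      rw [show √(1 / (n : ℝ)) ^ 4 = (√(1 / (n : ℝ)) ^ 2) ^ 2 by ring, hr2]
    have e3 : (1 + τ) ^ 2 / 2 * V + c / (n : ℝ) =
        n * ((1 + τ) ^ 2 / 2 * V * (1 / n) + c * (1 / n) ^ 2) := by field_simp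
    rw [hr2, e2, e3, Real.exp_nat_mul]
    refine pow_le_pow_left₀ (by positivity) ?_ n
    have := Real.add_one_le_exp ((1 + τ) ^ 2 / 2 * V * (1 / n) + c * (1 / n) ^ 2)
    linarith
  have hlim : Tendsto (fun τ : ℝ => Real.exp ((1 + τ) ^ 2 / 2 * V)) (𝓝[>] 0)
      (𝓝 (Real.exp ((1 + 0) ^ 2 / 2 * V))) := by
    have : Continuous fun τ : ℝ => Real.exp ((1 + τ) ^ 2 / 2 * V) := by fun_prop
    exact this.continuousAt.tendsto.mono_left nhdsWithin_le_nhds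
  rw [show V / 2 = (1 + 0) ^ 2 / 2 * V by ring]
  exact ge_of_tendsto hlim (eventually_mem_nhdsWithin.mono key)

theorem integral_cosh_mul_le_exp (hF : HasBoundedGradient K L C V F D) {l : ℝ} (hl : 0 ≤ l) :
    ∫ z, Real.cosh (l * ‖F z - ∫ z', F z' ∂stdGaussPi κ‖) ∂stdGaussPi κ ≤
      Real.exp (l ^ 2 * V / 2) := by
  have h := (hF.const_mul hl).integral_cosh_le_exp
  have hn : ‖(l : ℂ)‖ = l := by rw [Complex.norm_real, Real.norm_of_nonneg hl]
  simpa only [integral_const_mul, ← mul_sub, norm_mul, hn] using h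

theorem integrable_cosh_mul (hF : HasBoundedGradient K L C V F D) {l : ℝ} (hl : 0 ≤ l) (m : ℂ) :
    Integrable (fun z => Real.cosh (l * ‖F z - m‖)) (stdGaussPi κ) := by
  have h := (hF.const_mul hl).integrable_cosh (l * m) measurable_id
  have hn : ‖(l : ℂ)‖ = l := by rw [Complex.norm_real, Real.norm_of_nonneg hl]
  simpa only [← mul_sub, norm_mul, hn, id] using h

theorem _root_.one_add_sq_div_two_le_cosh {y : ℝ} (hy : 0 ≤ y) : 1 + y ^ 2 / 2 ≤ Real.cosh y := by
  have h1 : Real.cosh y = 1 + 2 * Real.sinh (y / 2) ^ 2 := by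
    rw [show y = 2 * (y / 2) by ring, Real.cosh_two_mul, Real.cosh_sq]
    ring_nf
  have h2 : y / 2 ≤ Real.sinh (y / 2) := Real.self_le_sinh_iff.2 (by linarith)
  nlinarith

/-- The Gaussian Poincaré inequality, with a uniform bound on the gradient. -/
theorem integral_norm_sub_integral_sq_le (hF : HasBoundedGradient K L C V F D) :
    ∫ z, ‖F z - ∫ z', F z' ∂stdGaussPi κ‖ ^ 2 ∂stdGaussPi κ ≤ V := by
  have hV := hF.nonneg.2
  set m := ∫ z', F z' ∂stdGaussPi κ with hm
  set I := ∫ z, ‖F z - m‖ ^ 2 ∂stdGaussPi κ with hI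
  have hint : Integrable (fun z => ‖F z - m‖ ^ 2) (stdGaussPi κ) :=
    ((hF.memLp measurable_id 2).sub (memLp_const m)).integrable_norm_pow (by norm_num)
  -- `1 + y² / 2 ≤ cosh y` turns the exponential moment at `l` into a bound on the variance.
  have key : ∀ u : ℝ, 0 < u → 1 + u * I ≤ Real.exp (u * V) := by
    intro u hu
    have hl : √(2 * u) ^ 2 = 2 * u := Real.sq_sqrt (by positivity)
    have h1 := hF.integral_cosh_mul_le_exp (Real.sqrt_nonneg (2 * u))
    rw [hl, show 2 * u * V / 2 = u * V by ring] at h1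
    refine le_trans ?_ h1
    have h2 : ∫ z, (1 + u * ‖F z - m‖ ^ 2) ∂stdGaussPi κ = 1 + u * I := by
      rw [integral_add (integrable_const 1) (hint.const_mul u), integral_const_mul]
      simp [hI]
    rw [← h2]
    refine integral_mono ((integrable_const 1).add (hint.const_mul u))
      (hF.integrable_cosh_mul (Real.sqrt_nonneg _) m) fun z => ?_
    have h3 := one_add_sq_div_two_le_cosh (y := √(2 * u) * ‖F z - m‖) (by positivity)
    rw [mul_pow, hl] at h3
    change 1 + u * ‖F z - m‖ ^ 2 ≤ Real.cosh (√(2 * u) * ‖F z - m‖)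
    linarith
  by_contra! hlt
  have hI0 : 0 < I := hV.trans_lt hlt
  set u := (I - V) / (2 * I * V + 1) with hu
  have hden : 0 < 2 * I * V + 1 := by positivity
  have hu0 : 0 < u := div_pos (sub_pos.2 hlt) hden
  have hueq : u * (2 * I * V + 1) = I - V := div_mul_cancel₀ _ hden.ne'
  have huV : u * V < 1 := by
    rw [hu, div_mul_eq_mul_div, div_lt_one hden]
    nlinarith
  have h1 := (key u hu0).trans (Real.exp_bound_div_one_sub_of_interval (by positivity) huV)
  rw [le_div_iff₀ (by linarith)] at h1
  have h2 : u * (I - V - u * I * V) ≤ 0 := by nlinarith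
  have h3 : I - V - u * I * V ≤ 0 := by
    by_contra! h
    nlinarith [mul_pos hu0 h]
  nlinarith

/-- Two-dimensional Gaussian concentration. The variance proxy is the sum of the contributions of
the real and imaginary parts, which is what makes the exponent sharp. -/
theorem measureReal_le_norm_sub_integral_le (hF : HasBoundedGradient K L C V F D) (hV : 0 < V)
    {t : ℝ} (ht : 0 ≤ t) :
    (stdGaussPi κ).real {z | t ≤ ‖F z - ∫ z', F z' ∂stdGaussPi κ‖} ≤
      2 * Real.exp (-(t ^ 2 / (2 * V))) := by
  set m := ∫ z', F z' ∂stdGaussPi κ with hm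
  -- `l = t / V` minimizes `exp (l² V / 2 - l t)`.
  have hl : 0 ≤ t / V := by positivity
  have h1 := hF.integral_cosh_mul_le_exp hl
  have h2 := mul_meas_ge_le_integral_of_nonneg (μ := stdGaussPi κ)
    (f := fun z => Real.cosh (t / V * ‖F z - m‖))
    (Filter.Eventually.of_forall fun z => (Real.cosh_pos _).le)
    (hF.integrable_cosh_mul hl m) (Real.cosh (t / V * t))
  have h3 : (stdGaussPi κ).real {z | t ≤ ‖F z - m‖} ≤
      (stdGaussPi κ).real {z | Real.cosh (t / V * t) ≤ Real.cosh (t / V * ‖F z - m‖)} := by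
    refine measureReal_mono fun z hz => ?_
    change Real.cosh (t / V * t) ≤ Real.cosh (t / V * ‖F z - m‖)
    rw [Real.cosh_le_cosh, abs_of_nonneg (by positivity),
      abs_of_nonneg (by positivity)]
    exact mul_le_mul_of_nonneg_left hz hl
  have h4 : Real.exp (t / V * t) / 2 ≤ Real.cosh (t / V * t) := by
    rw [Real.cosh_eq]
    linarith [Real.exp_pos (-(t / V * t))]
  have h5 : Real.exp (t / V * t) / 2 * (stdGaussPi κ).real {z | t ≤ ‖F z - m‖} ≤
      Real.exp ((t / V) ^ 2 * V / 2) :=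
    (mul_le_mul h4 h3 measureReal_nonneg (Real.cosh_pos _).le).trans (h2.trans h1)
  have h6 : Real.exp ((t / V) ^ 2 * V / 2) =
      Real.exp (t / V * t) * Real.exp (-(t ^ 2 / (2 * V))) := by
    rw [← Real.exp_add]
    congr 1
    field_simp
    ring
  rw [h6] at h5
  have h7 := Real.exp_pos (t / V * t)
  nlinarith

end HasBoundedGradient

end ConcentrationBound

/-! ### Gaussian integration by parts -/

section Stein

theorem hasDerivAt_gaussianPDFReal_zero_one (t : ℝ) :
    HasDerivAt (gaussianPDFReal 0 1) (-t * gaussianPDFReal 0 1 t) t := by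
  rw [gaussianPDFReal_def]
  have h1 : HasDerivAt (fun x : ℝ => -(x - 0) ^ 2 / (2 * ((1 : NNReal) : ℝ))) (-t) t := by
    have := (((hasDerivAt_id t).sub_const 0).pow 2).neg.div_const (2 * ((1 : NNReal) : ℝ))
    refine this.congr_deriv ?_
    simp [mul_div_cancel_left₀, neg_div]
  refine (h1.exp.const_mul (√(2 * Real.pi * ((1 : NNReal) : ℝ)))⁻¹).congr_deriv ?_
  ring

theorem integrable_gaussianPDFReal_smul {f : ℝ → ℂ} (hf : Integrable f (gaussianReal 0 1)) :
    Integrable fun t => gaussianPDFReal 0 1 t • f t := by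
  rw [gaussianReal_of_var_ne_zero _ one_ne_zero] at hf
  have h := (integrable_withDensity_iff_integrable_smul' (measurable_gaussianPDF 0 1)
    (Filter.Eventually.of_forall fun _ => gaussianPDF_lt_top)).1 hf
  simpa only [toReal_gaussianPDF] using h

theorem integral_mul_gaussianReal_eq_integral_deriv {h h' : ℝ → ℂ} {K K' : ℝ}
    (hd : ∀ t, HasDerivAt h (h' t) t) (hK : ∀ t, ‖h t‖ ≤ K) (hm' : Measurable h')
    (hK' : ∀ t, ‖h' t‖ ≤ K') :
    ∫ t, (t : ℂ) * h t ∂gaussianReal 0 1 = ∫ t, h' t ∂gaussianReal 0 1 := by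
  have hc : Continuous h := continuous_iff_continuousAt.2 fun t => (hd t).continuousAt
  have hi : Integrable h (gaussianReal 0 1) :=
    Integrable.of_bound hc.aestronglyMeasurable K (Filter.Eventually.of_forall hK)
  have hi' : Integrable h' (gaussianReal 0 1) :=
    Integrable.of_bound hm'.aestronglyMeasurable K' (Filter.Eventually.of_forall hK')
  have hti : Integrable (fun t : ℝ => (t : ℂ)) (gaussianReal 0 1) :=
    ((memLp_id_gaussianReal 1).integrable le_rfl).ofReal
  have hth : Integrable (fun t : ℝ => (t : ℂ) * h t) (gaussianReal 0 1) :=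
    hti.mul_bdd hc.aestronglyMeasurable (Filter.Eventually.of_forall hK)
  have h0 := integral_eq_zero_of_hasDerivAt_of_integrable
    (f := fun t => gaussianPDFReal 0 1 t • h t)
    (f' := fun t => gaussianPDFReal 0 1 t • h' t - gaussianPDFReal 0 1 t • ((t : ℂ) * h t))
    (fun t => by
      refine ((hasDerivAt_gaussianPDFReal_zero_one t).smul (hd t)).congr_deriv ?_
      simp only [Complex.real_smul]
      push_cast
      ring)
    ((integrable_gaussianPDFReal_smul hi').sub (integrable_gaussianPDFReal_smul hth))
    (integrable_gaussianPDFReal_smul hi)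
  rw [integral_sub (integrable_gaussianPDFReal_smul hi') (integrable_gaussianPDFReal_smul hth),
    ← integral_gaussianReal_eq_integral_smul one_ne_zero,
    ← integral_gaussianReal_eq_integral_smul one_ne_zero] at h0
  exact (sub_eq_zero.1 h0).symm

variable {κ : Type*} [Fintype κ]

theorem HasBoundedGradient.integrable_eval_mul {K L C V : ℝ} {F : (κ → ℝ) → ℂ}
    {D : κ → (κ → ℝ) → ℂ} (hF : HasBoundedGradient K L C V F D) (c : κ) :
    Integrable (fun z => (z c : ℂ) * F z) (stdGaussPi κ) :=
  (((memLp_eval_stdGaussPi c 1).integrable le_rfl).ofReal (𝕜 := ℂ)).mul_bdd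
    hF.measurable.aestronglyMeasurable (Filter.Eventually.of_forall hF.norm_le)

variable [DecidableEq κ]

/-- Resampling one coordinate of a standard Gaussian vector leaves its law unchanged. -/
theorem measurePreserving_update_stdGaussPi (c : κ) :
    MeasurePreserving (fun p : (κ → ℝ) × ℝ => Function.update p.1 c p.2)
      ((stdGaussPi κ).prod (gaussianReal 0 1)) (stdGaussPi κ) := by
  have hm : Measurable fun p : (κ → ℝ) × ℝ => Function.update p.1 c p.2 := by
    refine measurable_pi_iff.2 fun i => ?_
    rcases eq_or_ne i c with rfl | hi
    · simpa using measurable_snd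
    · simpa [hi, Function.comp_def] using (measurable_pi_apply i).comp measurable_fst
  refine ⟨hm, (Measure.pi_eq fun s hs => ?_).symm⟩
  rw [Measure.map_apply hm (MeasurableSet.univ_pi hs)]
  have e : (fun p : (κ → ℝ) × ℝ => Function.update p.1 c p.2) ⁻¹' Set.univ.pi s =
      (Set.univ.pi (Function.update s c Set.univ)) ×ˢ s c := by
    ext p
    simp only [Set.mem_preimage, Set.mem_pi, Set.mem_univ, true_imp_iff, Set.mem_prod]
    constructor
    · refine fun h => ⟨fun i => ?_, by simpa using h c⟩
      rcases eq_or_ne i c with rfl | hi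
      · simp
      · simpa [hi] using h i
    · rintro ⟨h1, h2⟩ i
      rcases eq_or_ne i c with rfl | hi
      · simpa using h2
      · simpa [hi] using h1 i
  rw [e, Measure.prod_prod, stdGaussPi, Measure.pi_pi, ← Finset.prod_erase_mul _ _
    (Finset.mem_univ c), ← Finset.prod_erase_mul _ (fun i => gaussianReal 0 1 (s i))
    (Finset.mem_univ c)]
  congr 1
  simp only [Function.update_self, measure_univ, mul_one]
  exact Finset.prod_congr rfl fun i hi => by rw [Function.update_of_ne (Finset.ne_of_mem_erase hi)]

namespace HasBoundedGradient

variable {K L C V : ℝ} {F : (κ → ℝ) → ℂ} {D : κ → (κ → ℝ) → ℂ}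

theorem hasDerivAt_update (hF : HasBoundedGradient K L C V F D) (c : κ) (z : κ → ℝ) (t : ℝ) :
    HasDerivAt (fun t => F (Function.update z c t)) (D c (Function.update z c t)) t := by
  rw [hasDerivAt_iff_isLittleO_nhds_zero]
  refine Asymptotics.IsBigO.trans_isLittleO (g := fun s : ℝ => s ^ 2) ?_ ?_
  · refine Asymptotics.IsBigO.of_bound C (Filter.Eventually.of_forall fun s => ?_)
    have h := hF.expansion (Function.update z c t) (Pi.single c s)
    have e1 : Function.update z c t + Pi.single c s = Function.update z c (t + s) := by
      ext i
      rcases eq_or_ne i c with rfl | hi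
      · simp
      · simp [hi]
    have e2 : ∑ i, ((Pi.single c s : κ → ℝ) i : ℂ) * D i (Function.update z c t) =
        s • D c (Function.update z c t) := by
      rw [Finset.sum_eq_single c (fun i _ hi => by simp [hi]) (by simp)]
      simp
    have e3 : ∑ i, (Pi.single c s : κ → ℝ) i ^ 2 = s ^ 2 := by
      rw [Finset.sum_eq_single c (fun i _ hi => by simp [hi]) (by simp)]
      simp
    rw [e1, e2, e3] at h
    rwa [Real.norm_of_nonneg (sq_nonneg s)]
  · simpa using Asymptotics.isLittleO_pow_id (𝕜 := ℝ) one_lt_two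

/-- Gaussian integration by parts (Stein's identity). -/
theorem integral_eval_mul (hF : HasBoundedGradient K L C V F D) (c : κ) :
    ∫ z, (z c : ℂ) * F z ∂stdGaussPi κ = ∫ z, D c z ∂stdGaussPi κ := by
  have hmp := measurePreserving_update_stdGaussPi c
  have hD : Integrable (D c) (stdGaussPi κ) := (hF.memLp_grad measurable_id c 1).integrable le_rfl
  have hmu : ∀ z : κ → ℝ, Measurable fun t => Function.update z c t := fun z =>
    measurable_update z
  rw [← hmp.map_eq, integral_map hmp.measurable.aemeasurable,
    integral_map hmp.measurable.aemeasurable, integral_prod, integral_prod]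
  · refine integral_congr_ae (Filter.Eventually.of_forall fun z => ?_)
    simp only [Function.update_self]
    exact integral_mul_gaussianReal_eq_integral_deriv (hF.hasDerivAt_update c z)
      (fun t => hF.norm_le _) ((hF.measurable_grad c).comp (hmu z)) (fun t => hF.norm_grad_le c _)
  · exact hmp.integrable_comp_of_integrable hD
  · exact hmp.integrable_comp_of_integrable (hF.integrable_eval_mul c)
  · rw [hmp.map_eq]; exact hD.aestronglyMeasurable
  · rw [hmp.map_eq]; exact (hF.integrable_eval_mul c).aestronglyMeasurable

end HasBoundedGradient

end Stein

/-! ### Hilbert–Schmidt norms and resolvents of Hermitian matrices -/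

section HilbertSchmidt

variable {m n l : Type*} [Fintype m] [Fintype n] [Fintype l]

/-- The squared Hilbert–Schmidt norm of a matrix. -/
noncomputable def hsSq (A : Matrix m n ℂ) : ℝ := ∑ i, ∑ j, ‖A i j‖ ^ 2

theorem hsSq_nonneg (A : Matrix m n ℂ) : 0 ≤ hsSq A :=
  Finset.sum_nonneg fun _ _ => Finset.sum_nonneg fun _ _ => by positivity

theorem hsSq_conjTranspose (A : Matrix m n ℂ) : hsSq A.conjTranspose = hsSq A := by
  simp only [hsSq, Matrix.conjTranspose_apply, norm_star]
  exact Finset.sum_comm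

variable [DecidableEq n]

theorem sum_norm_mulVec_sq_le (A : Matrix m n ℂ) (x : n → ℂ) :
    ∑ i, ‖A.mulVec x i‖ ^ 2 ≤ ‖A‖ ^ 2 * ∑ j, ‖x j‖ ^ 2 := by
  have h := A.l2_opNorm_mulVec (WithLp.toLp 2 x)
  have h2 := pow_le_pow_left₀ (norm_nonneg _) h 2
  rw [mul_pow, EuclideanSpace.norm_sq_eq, EuclideanSpace.norm_sq_eq] at h2
  exact h2

theorem hsSq_mul_le (A : Matrix m n ℂ) (B : Matrix n l ℂ) : hsSq (A * B) ≤ ‖A‖ ^ 2 * hsSq B := by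
  unfold hsSq
  rw [Finset.sum_comm, Finset.sum_comm (f := fun i j => ‖B i j‖ ^ 2), Finset.mul_sum]
  exact Finset.sum_le_sum fun j _ => sum_norm_mulVec_sq_le A fun i => B i j

theorem hsSq_mul_le_right [DecidableEq l] (A : Matrix m n ℂ) (B : Matrix n l ℂ) :
    hsSq (A * B) ≤ ‖B‖ ^ 2 * hsSq A := by
  rw [← hsSq_conjTranspose, Matrix.conjTranspose_mul, ← hsSq_conjTranspose A,
    ← Matrix.l2_opNorm_conjTranspose B]
  exact hsSq_mul_le _ _

theorem norm_apply_le_l2_opNorm (A : Matrix m n ℂ) (i : m) (j : n) : ‖A i j‖ ≤ ‖A‖ := by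
  have h := sum_norm_mulVec_sq_le A (Pi.single j 1)
  have h1 : ∑ k, ‖(Pi.single j 1 : n → ℂ) k‖ ^ 2 = 1 := by
    rw [Finset.sum_eq_single j (fun k _ hk => by simp [hk]) (by simp)]
    simp
  simp only [Matrix.mulVec_single_one, h1, mul_one] at h
  have h2 := (Finset.single_le_sum (f := fun i => ‖A.col j i‖ ^ 2)
    (fun _ _ => by positivity) (Finset.mem_univ i)).trans h
  exact le_of_sq_le_sq h2 (norm_nonneg A)

theorem l2_opNorm_le_sqrt_hsSq (A : Matrix m n ℂ) : ‖A‖ ≤ √(hsSq A) := by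
  rw [Matrix.l2_opNorm_def]
  refine ContinuousLinearMap.opNorm_le_bound _ (Real.sqrt_nonneg _) fun x => ?_
  refine le_of_sq_le_sq ?_ (by positivity)
  rw [mul_pow, Real.sq_sqrt (hsSq_nonneg A), EuclideanSpace.norm_sq_eq, EuclideanSpace.norm_sq_eq,
    hsSq, Finset.sum_mul]
  refine Finset.sum_le_sum fun i _ => ?_
  change ‖∑ j, A i j * x j‖ ^ 2 ≤ _
  refine (pow_le_pow_left₀ (norm_nonneg _) (norm_sum_le _ _) 2).trans ?_
  simp only [norm_mul]
  exact Finset.sum_mul_sq_le_sq_mul_sq _ _ _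

theorem norm_trace_mul_le (B : Matrix n m ℂ) (M : Matrix m n ℂ) :
    ‖(B * M).trace‖ ≤ (∑ i, ∑ j, ‖B i j‖) * ‖M‖ := by
  rw [Matrix.trace, Finset.sum_mul]
  refine (norm_sum_le _ _).trans (Finset.sum_le_sum fun i _ => ?_)
  rw [Matrix.diag_apply, Matrix.mul_apply, Finset.sum_mul]
  refine (norm_sum_le _ _).trans (Finset.sum_le_sum fun j _ => ?_)
  rw [norm_mul]
  exact mul_le_mul_of_nonneg_left (norm_apply_le_l2_opNorm M j i) (norm_nonneg _)

end HilbertSchmidt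

section Resolvent

variable {n : Type*} [Fintype n] [DecidableEq n] {z : ℂ} {H H' : Matrix n n ℂ}

/-- The resolvent `(z - H)⁻¹`. -/
noncomputable def resolv (z : ℂ) (H : Matrix n n ℂ) : Matrix n n ℂ :=
  (z • (1 : Matrix n n ℂ) - H)⁻¹

theorem isUnit_det_smul_one_sub (hz : 0 < z.im) (hH : H.IsHermitian) :
    IsUnit (z • (1 : Matrix n n ℂ) - H).det := by
  rw [← Matrix.isUnit_iff_isUnit_det]
  by_contra h
  have h1 : z ∈ spectrum ℂ H := by
    rw [spectrum.mem_iff, Algebra.algebraMap_eq_smul_one]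
    exact h
  have h2 := IsSelfAdjoint.im_eq_zero_of_mem_spectrum (a := H) hH.isSelfAdjoint h1
  exact hz.ne' h2

theorem resolv_mul (hz : 0 < z.im) (hH : H.IsHermitian) :
    resolv z H * (z • (1 : Matrix n n ℂ) - H) = 1 :=
  Matrix.nonsing_inv_mul _ (isUnit_det_smul_one_sub hz hH)

theorem mul_resolv (hz : 0 < z.im) (hH : H.IsHermitian) :
    (z • (1 : Matrix n n ℂ) - H) * resolv z H = 1 :=
  Matrix.mul_nonsing_inv _ (isUnit_det_smul_one_sub hz hH)

theorem resolv_sub_resolv (hz : 0 < z.im) (hH : H.IsHermitian) (hH' : H'.IsHermitian) :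
    resolv z H' - resolv z H = resolv z H' * (H' - H) * resolv z H := by
  calc resolv z H' - resolv z H = resolv z H' * ((z • (1 : Matrix n n ℂ) - H) * resolv z H) -
        (resolv z H' * (z • (1 : Matrix n n ℂ) - H')) * resolv z H := by
        rw [mul_resolv hz hH, resolv_mul hz hH', mul_one, one_mul]
    _ = _ := by noncomm_ring

theorem resolv_conjTranspose_sub (hz : 0 < z.im) (hH : H.IsHermitian) :
    (resolv z H).conjTranspose - resolv z H =
      (z - star z) • ((resolv z H).conjTranspose * resolv z H) := by
  have h1 : (resolv z H).conjTranspose * (star z • (1 : Matrix n n ℂ) - H) = 1 := by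
    have := congrArg Matrix.conjTranspose (mul_resolv hz hH)
    rwa [Matrix.conjTranspose_mul, Matrix.conjTranspose_sub, Matrix.conjTranspose_smul,
      Matrix.conjTranspose_one, hH.eq] at this
  calc (resolv z H).conjTranspose - resolv z H =
      (resolv z H).conjTranspose * ((z • (1 : Matrix n n ℂ) - H) * resolv z H) -
        ((resolv z H).conjTranspose * (star z • (1 : Matrix n n ℂ) - H)) * resolv z H := by
        rw [mul_resolv hz hH, h1, mul_one, one_mul]
    _ = (resolv z H).conjTranspose * ((z - star z) • (1 : Matrix n n ℂ)) * resolv z H := by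
        rw [sub_smul]; noncomm_ring
    _ = _ := by rw [mul_smul_comm, smul_mul_assoc, mul_one]

theorem norm_resolv_le (hz : 0 < z.im) (hH : H.IsHermitian) : ‖resolv z H‖ ≤ 1 / z.im := by
  have h1 : ‖z - star z‖ = 2 * z.im := by
    rw [show z - star z = ((2 * z.im : ℝ) : ℂ) * Complex.I from Complex.sub_conj z, norm_mul,
      Complex.norm_I, mul_one, Complex.norm_real, Real.norm_of_nonneg (by linarith)]
  have h2 := congrArg norm (resolv_conjTranspose_sub hz hH)
  rw [norm_smul, h1, Matrix.l2_opNorm_conjTranspose_mul_self] at h2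
  have h3 := norm_sub_le (resolv z H).conjTranspose (resolv z H)
  rw [Matrix.l2_opNorm_conjTranspose, h2] at h3
  rw [le_div_iff₀ hz]
  rcases (norm_nonneg (resolv z H)).eq_or_lt with h | h
  · rw [← h]; simp
  · nlinarith

theorem resolv_apply_self_im_nonpos (hz : 0 < z.im) (hH : H.IsHermitian) (i : n) :
    (resolv z H i i).im ≤ 0 := by
  have h := congrArg Complex.im (congrFun (congrFun (resolv_conjTranspose_sub hz hH) i) i)
  have h1 : ((resolv z H).conjTranspose * resolv z H) i i =
      ((∑ j, ‖resolv z H j i‖ ^ 2 : ℝ) : ℂ) := by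
    rw [Matrix.mul_apply, Complex.ofReal_sum]
    refine Finset.sum_congr rfl fun j _ => ?_
    rw [Matrix.conjTranspose_apply, Complex.ofReal_pow]
    exact Complex.conj_mul' _
  have h0 : 0 ≤ ∑ j, ‖resolv z H j i‖ ^ 2 := Finset.sum_nonneg fun _ _ => by positivity
  have hstar : ∀ w : ℂ, (star w).im = -w.im := Complex.conj_im
  rw [Matrix.sub_apply, Matrix.smul_apply, h1, smul_eq_mul, Complex.im_mul_ofReal,
    Matrix.conjTranspose_apply, Complex.sub_im, Complex.sub_im, hstar, hstar] at h
  nlinarith [mul_nonneg hz.le h0]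

open Filter Topology in
theorem continuous_resolv {α : Type*} [TopologicalSpace α] {H : α → Matrix n n ℂ}
    (hc : Continuous H) (hH : ∀ a, (H a).IsHermitian) (hz : 0 < z.im) :
    Continuous fun a => resolv z (H a) := by
  refine continuous_iff_continuousAt.2 fun a => ?_
  rw [ContinuousAt, tendsto_iff_norm_sub_tendsto_zero]
  have h0 : Tendsto (fun a' => 1 / z.im * ‖H a' - H a‖ * (1 / z.im)) (𝓝 a) (𝓝 0) := by
    have h1 := ((tendsto_iff_norm_sub_tendsto_zero.1 (hc.tendsto a)).const_mul
      (1 / z.im)).mul_const (1 / z.im)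
    rwa [mul_zero, zero_mul] at h1
  refine squeeze_zero (fun _ => norm_nonneg _) (fun a' => ?_) h0
  rw [resolv_sub_resolv hz (hH a) (hH a')]
  refine (norm_mul_le _ _).trans ?_
  refine mul_le_mul ((norm_mul_le _ _).trans ?_) (norm_resolv_le hz (hH a)) (norm_nonneg _)
    (by positivity)
  exact mul_le_mul_of_nonneg_right (norm_resolv_le hz (hH a')) (norm_nonneg _)

end Resolvent

/-! ### Resolvents of Gaussian Hermitian matrices -/

section GaussianMatrix

variable {κ n : Type*} [Fintype κ]

/-- The Gaussian matrix `∑ c, g c • E c` with deterministic coefficient matrices `E c`. -/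
noncomputable def gaussMat (E : κ → Matrix n n ℂ) (g : κ → ℝ) : Matrix n n ℂ :=
  ∑ c, (g c : ℂ) • E c

theorem gaussMat_add (E : κ → Matrix n n ℂ) (g h : κ → ℝ) :
    gaussMat E (g + h) = gaussMat E g + gaussMat E h := by
  simp [gaussMat, add_smul, Finset.sum_add_distrib]

variable [DecidableEq n]

/-- Hermitian coefficient matrices for which the entries of `gaussMat E g` have the covariances of
a Hermitian matrix with independent entries and variance profile `s`. -/
structure IsHermitianFrame (s : n → n → ℝ) (E : κ → Matrix n n ℂ) : Prop where
  isHermitian : ∀ c, (E c).IsHermitian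
  sum_mul : ∀ a b d e, ∑ c, E c a b * E c d e = if a = e ∧ b = d then (s a b : ℂ) else 0

variable {s : n → n → ℝ} {E : κ → Matrix n n ℂ} {A : Matrix n n ℂ} {z : ℂ} {S : ℝ}

theorem IsHermitianFrame.isHermitian_gaussMat (hE : IsHermitianFrame s E) (g : κ → ℝ) :
    (gaussMat E g).IsHermitian := by
  unfold gaussMat Matrix.IsHermitian
  rw [Matrix.conjTranspose_sum]
  refine Finset.sum_congr rfl fun c _ => ?_
  rw [Matrix.conjTranspose_smul, (hE.isHermitian c).eq]
  congr 1
  exact Complex.conj_ofReal _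

theorem IsHermitianFrame.isHermitian_gaussMat_add (hE : IsHermitianFrame s E)
    (hA : A.IsHermitian) (g : κ → ℝ) : (gaussMat E g + A).IsHermitian :=
  (hE.isHermitian_gaussMat g).add hA

variable [Fintype n]

theorem norm_gaussMat_le (E : κ → Matrix n n ℂ) (g : κ → ℝ) :
    ‖gaussMat E g‖ ≤ √(∑ c, ‖E c‖ ^ 2) * √(∑ c, g c ^ 2) := by
  refine (norm_sum_le _ _).trans ?_
  rw [← Real.sqrt_mul (Finset.sum_nonneg fun _ _ => by positivity)]
  refine Real.le_sqrt_of_sq_le ?_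
  have h : ∀ c, ‖(g c : ℂ) • E c‖ = ‖E c‖ * |g c| := fun c => by
    rw [norm_smul, Complex.norm_real, Real.norm_eq_abs, mul_comm]
  simp only [h]
  simpa only [sq_abs] using Finset.sum_mul_sq_le_sq_mul_sq Finset.univ (fun c => ‖E c‖)
    fun c => |g c|

namespace IsHermitianFrame

theorem sum_norm_trace_sq (hE : IsHermitianFrame s E) (M : Matrix n n ℂ) :
    ∑ c, ‖(E c * M).trace‖ ^ 2 = ∑ a, ∑ b, s a b * ‖M b a‖ ^ 2 := by
  have h1 : ∀ c, (E c * M).trace = ∑ p : n × n, E c p.1 p.2 * M p.2 p.1 := fun c => by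
    simp [Matrix.trace, Matrix.mul_apply, Fintype.sum_prod_type]
  have h2 : ∀ c, star (E c * M).trace = ∑ q : n × n, E c q.1 q.2 * star (M q.1 q.2) := fun c => by
    have : ∀ a b, star (E c a b) = E c b a := fun a b => (hE.isHermitian c).apply b a
    simp only [Matrix.trace, Matrix.diag_apply, Matrix.mul_apply, Fintype.sum_prod_type, star_sum,
      star_mul', this]
    exact Finset.sum_comm
  have h3 : ∀ w : ℂ, ((‖w‖ ^ 2 : ℝ) : ℂ) = w * star w := fun w => by
    rw [Complex.ofReal_pow]
    exact (Complex.mul_conj' w).symm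
  rw [← Complex.ofReal_inj]
  push_cast
  calc ∑ c, (‖(E c * M).trace‖ : ℂ) ^ 2
      = ∑ c, ∑ p : n × n, ∑ q : n × n,
          (E c p.1 p.2 * E c q.1 q.2) * (M p.2 p.1 * star (M q.1 q.2)) := by
        refine Finset.sum_congr rfl fun c _ => ?_
        have := h3 (E c * M).trace
        rw [Complex.ofReal_pow] at this
        rw [this, h2, h1, Finset.sum_mul_sum]
        exact Finset.sum_congr rfl fun p _ => Finset.sum_congr rfl fun q _ => by ring
    _ = ∑ p : n × n, ∑ q : n × n,
          (∑ c, E c p.1 p.2 * E c q.1 q.2) * (M p.2 p.1 * star (M q.1 q.2)) := by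
        rw [Finset.sum_comm]
        refine Finset.sum_congr rfl fun p _ => ?_
        rw [Finset.sum_comm]
        exact Finset.sum_congr rfl fun q _ => by rw [Finset.sum_mul]
    _ = ∑ p : n × n, (s p.1 p.2 : ℂ) * (‖M p.2 p.1‖ : ℂ) ^ 2 := by
        refine Finset.sum_congr rfl fun p _ => ?_
        rw [Finset.sum_eq_single p.swap]
        · rw [hE.sum_mul]
          have := h3 (M p.2 p.1)
          rw [Complex.ofReal_pow] at this
          simp [this]
        · intro q _ hq
          rw [hE.sum_mul, if_neg, zero_mul]
          rintro ⟨h, h'⟩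
          exact hq (Prod.ext h'.symm h.symm)
        · simp
    _ = _ := Fintype.sum_prod_type _

theorem sum_mul_mul_apply (hE : IsHermitianFrame s E) (M : Matrix n n ℂ) (i j : n) :
    ∑ c, (E c * M * E c) i j = if i = j then ∑ a, (s i a : ℂ) * M a a else 0 := by
  calc ∑ c, (E c * M * E c) i j = ∑ c, ∑ b, ∑ a, (E c i a * E c b j) * M a b := by
        refine Finset.sum_congr rfl fun c _ => ?_
        simp only [Matrix.mul_apply, Finset.sum_mul]
        exact Finset.sum_congr rfl fun b _ => Finset.sum_congr rfl fun a _ => by ring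
    _ = ∑ b, ∑ a, (∑ c, E c i a * E c b j) * M a b := by
        rw [Finset.sum_comm]
        refine Finset.sum_congr rfl fun b _ => ?_
        rw [Finset.sum_comm]
        exact Finset.sum_congr rfl fun a _ => by rw [Finset.sum_mul]
    _ = _ := by
        simp only [hE.sum_mul]
        by_cases hij : i = j <;> simp [hij]

theorem norm_resolv_add_sub_le (hE : IsHermitianFrame s E) (hA : A.IsHermitian) (hz : 0 < z.im)
    (g h : κ → ℝ) : ‖resolv z (gaussMat E (g + h) + A) - resolv z (gaussMat E g + A)‖ ≤
      1 / z.im * (√(∑ c, ‖E c‖ ^ 2) * √(∑ c, h c ^ 2)) * (1 / z.im) := by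
  have hH := hE.isHermitian_gaussMat_add hA
  rw [resolv_sub_resolv hz (hH g) (hH (g + h)), gaussMat_add, add_right_comm, add_sub_cancel_left]
  refine (norm_mul_le _ _).trans ?_
  refine mul_le_mul ((norm_mul_le _ _).trans ?_) (norm_resolv_le hz (hH g)) (norm_nonneg _)
    (by positivity)
  rw [add_right_comm, ← gaussMat_add]
  exact mul_le_mul (norm_resolv_le hz (hH (g + h))) (norm_gaussMat_le E h) (norm_nonneg _)
    (by positivity)

theorem continuous_resolv (hE : IsHermitianFrame s E) (hA : A.IsHermitian) (hz : 0 < z.im) :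
    Continuous fun g => resolv z (gaussMat E g + A) := by
  refine _root_.continuous_resolv (Continuous.add ?_ continuous_const)
    (hE.isHermitian_gaussMat_add hA) hz
  unfold gaussMat
  fun_prop

/-- Linear functionals `Tr (B (z - X - A)⁻¹)` of the resolvent satisfy the assumptions of Gaussian
concentration; the gradient is the Hilbert–Schmidt pairing of `E c` with `R B R`, whose squared
length is the sum over the independent entries of `X`. -/
theorem exists_hasBoundedGradient (hE : IsHermitianFrame s E) (hS : ∀ i j, s i j ≤ S)
    (hA : A.IsHermitian) (hz : 0 < z.im) (hS0 : 0 ≤ S) (B : Matrix n n ℂ) :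
    ∃ K L C, HasBoundedGradient K L C (S * hsSq B / z.im ^ 4)
      (fun g => (B * resolv z (gaussMat E g + A)).trace)
      fun c g => (B * (resolv z (gaussMat E g + A) * E c * resolv z (gaussMat E g + A))).trace := by
  set b := ∑ i, ∑ j, ‖B i j‖ with hb
  have hb0 : 0 ≤ b := Finset.sum_nonneg fun _ _ => Finset.sum_nonneg fun _ _ => norm_nonneg _
  set e := √(∑ c, ‖E c‖ ^ 2) with he
  set R : (κ → ℝ) → Matrix n n ℂ := fun g => resolv z (gaussMat E g + A) with hR
  have hH := hE.isHermitian_gaussMat_add hA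
  have hRn : ∀ g, ‖R g‖ ≤ 1 / z.im := fun g => norm_resolv_le hz (hH g)
  have hRc : Continuous R := hE.continuous_resolv hA hz
  have hRd : ∀ g h, ‖R (g + h) - R g‖ ≤ 1 / z.im * (e * √(∑ c, h c ^ 2)) * (1 / z.im) :=
    hE.norm_resolv_add_sub_le hA hz
  refine ⟨b * (1 / z.im), b * (1 / z.im * e * (1 / z.im)),
    b * (1 / z.im * e * (1 / z.im) * e * (1 / z.im)), ?_, fun c => ?_, fun g => ?_,
    fun g h => ?_, fun g h => ?_, fun g => ?_⟩
  · exact (Continuous.matrix_trace (continuous_const.matrix_mul hRc)).measurable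
  · exact (Continuous.matrix_trace (continuous_const.matrix_mul
      ((hRc.matrix_mul continuous_const).matrix_mul hRc))).measurable
  · exact (norm_trace_mul_le B (R g)).trans (mul_le_mul_of_nonneg_left (hRn g) hb0)
  · rw [← Matrix.trace_sub, ← mul_sub]
    refine (norm_trace_mul_le B _).trans ?_
    rw [mul_assoc b]
    refine mul_le_mul_of_nonneg_left ((hRd g h).trans_eq (by ring)) hb0
  · have e1 : ∑ c, (h c : ℂ) * (B * (R g * E c * R g)).trace =
        (B * (R g * gaussMat E h * R g)).trace := by
      rw [gaussMat, Finset.mul_sum, Finset.sum_mul, Finset.mul_sum, Matrix.trace_sum]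
      refine Finset.sum_congr rfl fun c _ => ?_
      rw [mul_smul_comm, smul_mul_assoc, mul_smul_comm, Matrix.trace_smul, smul_eq_mul]
    have e2 : R (g + h) - R g - R g * gaussMat E h * R g =
        (R (g + h) - R g) * gaussMat E h * R g := by
      have h1 : R (g + h) - R g = R (g + h) * gaussMat E h * R g := by
        have := resolv_sub_resolv hz (hH g) (hH (g + h))
        rw [gaussMat_add] at this
        rw [show gaussMat E g + gaussMat E h + A - (gaussMat E g + A) = gaussMat E h by abel,
          ← gaussMat_add] at this
        exact this
      rw [sub_mul, sub_mul, ← h1]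
    change ‖(B * R (g + h)).trace - (B * R g).trace - ∑ c, (h c : ℂ) *
      (B * (R g * E c * R g)).trace‖ ≤ _
    rw [e1, ← Matrix.trace_sub, ← Matrix.trace_sub, ← mul_sub, ← mul_sub, e2]
    refine (norm_trace_mul_le B _).trans ?_
    rw [mul_assoc b]
    refine mul_le_mul_of_nonneg_left ?_ hb0
    have hq : √(∑ c, h c ^ 2) * √(∑ c, h c ^ 2) = ∑ c, h c ^ 2 :=
      Real.mul_self_sqrt (Finset.sum_nonneg fun _ _ => sq_nonneg _)
    calc _ ≤ ‖R (g + h) - R g‖ * ‖gaussMat E h‖ * ‖R g‖ :=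
          (norm_mul_le _ _).trans (mul_le_mul_of_nonneg_right (norm_mul_le _ _) (norm_nonneg _))
      _ ≤ 1 / z.im * (e * √(∑ c, h c ^ 2)) * (1 / z.im) * (e * √(∑ c, h c ^ 2)) * (1 / z.im) := by
          gcongr
          · exact hRd g h
          · exact norm_gaussMat_le E h
          · exact hRn g
      _ = 1 / z.im * e * (1 / z.im) * e * (1 / z.im) * (√(∑ c, h c ^ 2) * √(∑ c, h c ^ 2)) := by
          ring
      _ = _ := by rw [hq]
  · have e1 : ∀ c, (B * (R g * E c * R g)).trace = (E c * (R g * B * R g)).trace := fun c => by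
      rw [← mul_assoc, Matrix.trace_mul_comm, ← mul_assoc, ← mul_assoc, ← mul_assoc,
        Matrix.trace_mul_comm]
      simp only [mul_assoc]
    change ∑ c, ‖(B * (R g * E c * R g)).trace‖ ^ 2 ≤ _
    simp only [e1, hE.sum_norm_trace_sq]
    calc ∑ a, ∑ b, s a b * ‖(R g * B * R g) b a‖ ^ 2
        ≤ ∑ a, ∑ b, S * ‖(R g * B * R g) b a‖ ^ 2 := by
          gcongr with a _ b _; exact hS a b
      _ = S * hsSq (R g * B * R g) := by
          simp only [← Finset.mul_sum, hsSq]
          rw [Finset.sum_comm]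
      _ ≤ S * (‖R g‖ ^ 2 * (‖R g‖ ^ 2 * hsSq B)) := by
          gcongr
          exact (hsSq_mul_le_right _ _).trans
            (mul_le_mul_of_nonneg_left (hsSq_mul_le _ _) (by positivity))
      _ ≤ S * ((1 / z.im) ^ 2 * ((1 / z.im) ^ 2 * hsSq B)) := by
          have := hsSq_nonneg B
          gcongr <;> exact hRn g
      _ = S * hsSq B / z.im ^ 4 := by field_simp

end IsHermitianFrame

end GaussianMatrix

/-! ### The mean resolvent almost solves the Dyson equation -/

section DysonStability

variable {ι : Type*} [Fintype ι] {s : ι → ι → ℝ} {w p : ι → ℂ} {η δ ε T : ℝ}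

/-- An approximate solution `p` of the Dyson equation is close to the exact one. The vector
`h = dysonStep s w p` solves the Dyson equation exactly, with spectral parameters
`w - s (p - h)`. -/
theorem norm_sub_dysonSol_le (hs : ∀ i j, 0 ≤ s i j) (hT : ∀ i, ∑ j, s i j ≤ T) (hη : 0 < η)
    (hδ : 0 < δ) (hw : ∀ i, η ≤ (w i).im) (hp : ∀ i, (p i).im ≤ 0)
    (hε : ∀ i, ‖w i * p i - 1 - ∑ j, (s i j : ℂ) * (p j * p i)‖ ≤ ε)
    (hsmall : T * (ε / η) ≤ (1 - δ) * η) (i : ι) :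
    ‖p i - dysonSol s w i‖ ≤ (1 + T / (δ * η ^ 2)) * (ε / η) := by
  have hw0 : ∀ i, 0 < (w i).im := fun i => hη.trans_le (hw i)
  have hε0 : 0 ≤ ε := (norm_nonneg _).trans (hε i)
  set h := dysonStep s w p with hh
  have him : ∀ i, (h i).im < 0 := dysonStep_im_neg hs hw0 hp
  have hph : ∀ i, ‖p i - h i‖ ≤ ε / η := fun i => by
    have hden := dysonStep_denom_ne_zero hs hw0 hp i
    have e : p i - h i = h i * (w i * p i - 1 - ∑ j, (s i j : ℂ) * (p j * p i)) := by
      have e1 : ∑ j, (s i j : ℂ) * (p j * p i) = (∑ j, (s i j : ℂ) * p j) * p i := by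
        rw [Finset.sum_mul]
        exact Finset.sum_congr rfl fun j _ => by ring
      rw [e1, hh, dysonStep]
      field_simp
      ring
    rw [e, norm_mul, div_eq_inv_mul, ← one_div]
    exact mul_le_mul (norm_dysonStep_le hs hη hw hp i) (hε i) (norm_nonneg _) (by positivity)
  set w' : ι → ℂ := fun i => w i - ∑ j, (s i j : ℂ) * (p j - h j) with hw'
  have hdiff : ∀ i, ‖w i - w' i‖ ≤ T * (ε / η) := fun i => by
    rw [hw']
    simp only [sub_sub_cancel]
    calc ‖∑ j, (s i j : ℂ) * (p j - h j)‖ ≤ ∑ j, s i j * (ε / η) := by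
          refine (norm_sum_le _ _).trans (Finset.sum_le_sum fun j _ => ?_)
          rw [norm_mul, Complex.norm_real, Real.norm_of_nonneg (hs i j)]
          exact mul_le_mul_of_nonneg_left (hph j) (hs i j)
      _ = (∑ j, s i j) * (ε / η) := by rw [Finset.sum_mul]
      _ ≤ _ := mul_le_mul_of_nonneg_right (hT i) (by positivity)
  have hwim : ∀ i, δ * η ≤ (w' i).im := fun i => by
    have h1 := (Complex.abs_im_le_norm (w i - w' i)).trans ((hdiff i).trans hsmall)
    rw [Complex.sub_im] at h1
    linarith [le_abs_self ((w i).im - (w' i).im), hw i]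
  have hfix : ∀ i, h i = dysonStep s w' h i := fun i => by
    rw [hh, dysonStep, dysonStep, hw']
    congr 1
    simp only [mul_sub, Finset.sum_sub_distrib]
    rw [← hh]
    ring
  have hsol := norm_sub_le_of_dysonStep_eq hs (by positivity : 0 < δ * η) hη hwim hw hfix
    (dysonSol_eq_dysonStep hs hw0) him (dysonSol_im_neg hs hw0)
    (fun i => (norm_sub_rev _ _).trans_le (hdiff i)) i
  calc ‖p i - dysonSol s w i‖ ≤ ‖p i - h i‖ + ‖h i - dysonSol s w i‖ :=
        norm_sub_le_norm_sub_add_norm_sub _ _ _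
    _ ≤ ε / η + T * (ε / η) / (δ * η * η) := add_le_add (hph i) hsol
    _ = _ := by field_simp

end DysonStability

section MeanResolvent

theorem norm_integral_mul_sub_le {α : Type*} [MeasurableSpace α] {μ : Measure α}
    [IsProbabilityMeasure μ] {f g : α → ℂ} (hf : MemLp f 2 μ) (hg : MemLp g 2 μ) {a b : ℝ}
    (ha : 0 < a) (hb : 0 < b) (hfa : ∫ x, ‖f x - ∫ y, f y ∂μ‖ ^ 2 ∂μ ≤ a ^ 2)
    (hgb : ∫ x, ‖g x - ∫ y, g y ∂μ‖ ^ 2 ∂μ ≤ b ^ 2) :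
    ‖∫ x, f x * g x ∂μ - (∫ x, f x ∂μ) * ∫ x, g x ∂μ‖ ≤ a * b := by
  set p := ∫ x, f x ∂μ with hp
  set q := ∫ x, g x ∂μ with hq
  have hif : Integrable f μ := hf.integrable (by norm_num)
  have hig : Integrable g μ := hg.integrable (by norm_num)
  have hifg : Integrable (fun x => f x * g x) μ := hf.integrable_mul hg
  have e : ∫ x, f x * g x ∂μ - p * q = ∫ x, (f x - p) * (g x - q) ∂μ := by
    have h1 : ∀ x, (f x - p) * (g x - q) = (f x * g x - f x * q) - (p * g x - p * q) :=
      fun x => by ring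
    simp only [h1]
    have i1 : Integrable (fun x => f x * g x - f x * q) μ := hifg.sub (hif.mul_const q)
    have i2 : Integrable (fun x => p * g x - p * q) μ :=
      (hig.const_mul p).sub (integrable_const _)
    rw [integral_sub i1 i2, integral_sub hifg (hif.mul_const q),
      integral_sub (hig.const_mul p) (integrable_const _), integral_mul_const, integral_const_mul,
      ← hp, ← hq]
    simp
  have hf2 : Integrable (fun x => ‖f x - p‖ ^ 2) μ :=
    (hf.sub (memLp_const p)).integrable_norm_pow (by norm_num)
  have hg2 : Integrable (fun x => ‖g x - q‖ ^ 2) μ :=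
    (hg.sub (memLp_const q)).integrable_norm_pow (by norm_num)
  have hifg' : Integrable (fun x => (f x - p) * (g x - q)) μ :=
    (hf.sub (memLp_const p)).integrable_mul (hg.sub (memLp_const q))
  rw [e]
  calc ‖∫ x, (f x - p) * (g x - q) ∂μ‖ ≤ ∫ x, ‖(f x - p) * (g x - q)‖ ∂μ :=
        norm_integral_le_integral_norm _
    _ ≤ ∫ x, (b / (2 * a) * ‖f x - p‖ ^ 2 + a / (2 * b) * ‖g x - q‖ ^ 2) ∂μ := by
        refine integral_mono hifg'.norm ((hf2.const_mul _).add (hg2.const_mul _)) fun x => ?_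
        change ‖(f x - p) * (g x - q)‖ ≤
          b / (2 * a) * ‖f x - p‖ ^ 2 + a / (2 * b) * ‖g x - q‖ ^ 2
        rw [norm_mul]
        have : 0 ≤ (b * ‖f x - p‖ - a * ‖g x - q‖) ^ 2 / (2 * a * b) := by positivity
        have e2 : (b * ‖f x - p‖ - a * ‖g x - q‖) ^ 2 / (2 * a * b) =
            b / (2 * a) * ‖f x - p‖ ^ 2 + a / (2 * b) * ‖g x - q‖ ^ 2 -
              ‖f x - p‖ * ‖g x - q‖ := by field_simp; ring
        linarith
    _ = b / (2 * a) * ∫ x, ‖f x - p‖ ^ 2 ∂μ + a / (2 * b) * ∫ x, ‖g x - q‖ ^ 2 ∂μ := by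
        rw [integral_add (hf2.const_mul _) (hg2.const_mul _), integral_const_mul,
          integral_const_mul]
    _ ≤ b / (2 * a) * a ^ 2 + a / (2 * b) * b ^ 2 := by gcongr
    _ = a * b := by field_simp; ring

variable {κ n : Type*} [Fintype κ] [Fintype n] [DecidableEq n]
  {s : n → n → ℝ} {E : κ → Matrix n n ℂ} {A : Matrix n n ℂ} {z : ℂ} {S : ℝ}

/-- The entrywise expectation of the resolvent of the Gaussian matrix `gaussMat E g + A`. -/
noncomputable def meanResolv (E : κ → Matrix n n ℂ) (A : Matrix n n ℂ) (z : ℂ) : Matrix n n ℂ :=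
  Matrix.of fun i j => ∫ g, resolv z (gaussMat E g + A) i j ∂stdGaussPi κ

theorem meanResolv_apply (E : κ → Matrix n n ℂ) (A : Matrix n n ℂ) (z : ℂ) (i j : n) :
    meanResolv E A z i j = ∫ g, resolv z (gaussMat E g + A) i j ∂stdGaussPi κ := rfl

namespace IsHermitianFrame

theorem memLp_resolv (hE : IsHermitianFrame s E) (hA : A.IsHermitian) (hz : 0 < z.im) (i j : n)
    (q : ENNReal) : MemLp (fun g => resolv z (gaussMat E g + A) i j) q (stdGaussPi κ) :=
  MemLp.of_bound ((hE.continuous_resolv hA hz).matrix_elem i j).aestronglyMeasurable (1 / z.im)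
    (Filter.Eventually.of_forall fun g => (norm_apply_le_l2_opNorm _ i j).trans
      (norm_resolv_le hz (hE.isHermitian_gaussMat_add hA g)))

theorem integral_trace_mul_resolv (hE : IsHermitianFrame s E) (hA : A.IsHermitian) (hz : 0 < z.im)
    (B : Matrix n n ℂ) : ∫ g, (B * resolv z (gaussMat E g + A)).trace ∂stdGaussPi κ =
      (B * meanResolv E A z).trace := by
  have hi : ∀ i j, Integrable (fun g => resolv z (gaussMat E g + A) i j) (stdGaussPi κ) :=
    fun i j => (hE.memLp_resolv hA hz i j 1).integrable le_rfl
  have htr : ∀ M : Matrix n n ℂ, (B * M).trace = ∑ i, ∑ j, B i j * M j i := fun M => by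
    simp [Matrix.trace, Matrix.mul_apply]
  simp only [htr, meanResolv_apply]
  refine (integral_finsetSum _ fun i _ => integrable_finsetSum _ fun j _ =>
    (hi j i).const_mul (B i j)).trans (Finset.sum_congr rfl fun i _ => ?_)
  refine (integral_finsetSum _ fun j _ => (hi j i).const_mul (B i j)).trans ?_
  exact Finset.sum_congr rfl fun j _ => integral_const_mul _ _

theorem meanResolv_im_nonpos (hE : IsHermitianFrame s E) (hA : A.IsHermitian) (hz : 0 < z.im)
    (i : n) : (meanResolv E A z i i).im ≤ 0 := by
  have h := integral_im ((hE.memLp_resolv hA hz i i 1).integrable le_rfl)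
  rw [meanResolv_apply]
  refine (h.symm.le).trans (integral_nonpos fun g => ?_)
  exact resolv_apply_self_im_nonpos hz (hE.isHermitian_gaussMat_add hA g) i

/-- The Schwinger–Dyson equation, obtained by integrating `(z - X - A) (z - X - A)⁻¹ = 1` by
parts. -/
theorem schwinger_dyson (hE : IsHermitianFrame s E) (hS : ∀ i j, s i j ≤ S) (hS0 : 0 ≤ S)
    (hA : A.IsHermitian) (hAd : A.IsDiag) (hz : 0 < z.im) (i : n) :
    (z - A i i) * meanResolv E A z i i = 1 + ∫ g, (∑ a, (s i a : ℂ) *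
      resolv z (gaussMat E g + A) a a) * resolv z (gaussMat E g + A) i i ∂stdGaussPi κ := by
  classical
  set R : (κ → ℝ) → Matrix n n ℂ := fun g => resolv z (gaussMat E g + A) with hR
  have hRi : Integrable (fun g => R g i i) (stdGaussPi κ) :=
    (hE.memLp_resolv hA hz i i 1).integrable le_rfl
  have hentry : ∀ (c : κ) (M : Matrix n n ℂ),
      ((Matrix.single i i 1 * E c) * M).trace = (E c * M) i i := fun c M => by
    rw [mul_assoc, Matrix.trace_single_mul, one_smul]
  have hbg := fun c => hE.exists_hasBoundedGradient hS hA hz hS0 (Matrix.single i i 1 * E c)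
  have hXi : ∀ c, Integrable (fun g : κ → ℝ => (g c : ℂ) * (E c * R g) i i) (stdGaussPi κ) :=
    fun c => by
      obtain ⟨K, L, C, h⟩ := hbg c
      have := h.integrable_eval_mul c
      simpa only [hentry] using this
  have hstein : ∀ c, ∫ g : κ → ℝ, (g c : ℂ) * (E c * R g) i i ∂stdGaussPi κ =
      ∫ g, (E c * (R g * E c * R g)) i i ∂stdGaussPi κ := fun c => by
    obtain ⟨K, L, C, h⟩ := hbg c
    have := h.integral_eval_mul c
    simpa only [hentry] using this
  have hDi : ∀ c, Integrable (fun g => (E c * (R g * E c * R g)) i i) (stdGaussPi κ) := fun c => by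
    obtain ⟨K, L, C, h⟩ := hbg c
    have := (h.memLp_grad (μ := stdGaussPi κ) measurable_id c 1).integrable le_rfl
    simpa only [hentry, id] using this
  have hid : ∀ g, (z - A i i) * R g i i = 1 + ∑ c, (g c : ℂ) * (E c * R g) i i := fun g => by
    have h1 := congrFun (congrFun (mul_resolv hz (hE.isHermitian_gaussMat_add hA g)) i) i
    have h2 : (A * R g) i i = A i i * R g i i := by
      conv_lhs => rw [← hAd.diagonal_diag]
      rw [Matrix.diagonal_mul, Matrix.diag_apply]
    have h3 : (gaussMat E g * R g) i i = ∑ c, (g c : ℂ) * (E c * R g) i i := by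
      rw [gaussMat, Finset.sum_mul, Matrix.sum_apply]
      exact Finset.sum_congr rfl fun c _ => by rw [smul_mul_assoc, Matrix.smul_apply, smul_eq_mul]
    rw [sub_mul, add_mul, smul_mul_assoc, one_mul, Matrix.sub_apply, Matrix.add_apply, h2, h3,
      Matrix.smul_apply, smul_eq_mul, Matrix.one_apply_eq] at h1
    linear_combination h1
  have hcov : ∀ g, ∑ c, (E c * (R g * E c * R g)) i i = (∑ a, (s i a : ℂ) * R g a a) * R g i i :=
    fun g => by
      have h1 : ∀ c, (E c * (R g * E c * R g)) i i = ∑ j, (E c * R g * E c) i j * R g j i :=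
        fun c => by rw [← Matrix.mul_apply]; simp only [mul_assoc]
      simp only [h1]
      rw [Finset.sum_comm]
      simp only [← Finset.sum_mul, hE.sum_mul_mul_apply]
      simp
  calc (z - A i i) * meanResolv E A z i i = ∫ g, (z - A i i) * R g i i ∂stdGaussPi κ := by
        rw [integral_const_mul, meanResolv_apply]
    _ = 1 + ∑ c, ∫ g : κ → ℝ, (g c : ℂ) * (E c * R g) i i ∂stdGaussPi κ := by
        simp only [hid]
        rw [integral_add (integrable_const 1) (integrable_finsetSum _ fun c _ => hXi c),
          integral_finsetSum _ fun c _ => hXi c]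
        simp
    _ = 1 + ∫ g, ∑ c, (E c * (R g * E c * R g)) i i ∂stdGaussPi κ := by
        simp only [hstein]
        rw [integral_finsetSum _ fun c _ => hDi c]
    _ = _ := by simp only [hcov]; rfl

/-- The diagonal of the mean resolvent solves the Dyson equation up to a covariance, which the
Poincaré inequality bounds by `S² √N / η⁴`. -/
theorem norm_schwinger_dyson_error_le (hE : IsHermitianFrame s E) (hs : ∀ i j, 0 ≤ s i j)
    (hS : ∀ i j, s i j ≤ S) (hS0 : 0 < S) (hA : A.IsHermitian) (hAd : A.IsDiag) (hz : 0 < z.im)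
    (i : n) :
    ‖(z - A i i) * meanResolv E A z i i - 1 -
      ∑ j, (s i j : ℂ) * (meanResolv E A z j j * meanResolv E A z i i)‖ ≤
      S ^ 2 * √(Fintype.card n) / z.im ^ 4 := by
  set N : ℝ := (Fintype.card n : ℝ) with hNdef
  have hN : 0 < N := Nat.cast_pos.2 (Fintype.card_pos_iff.2 ⟨i⟩)
  set B₁ : Matrix n n ℂ := Matrix.diagonal fun j => (s i j : ℂ) with hB₁
  set B₂ : Matrix n n ℂ := Matrix.single i i 1 with hB₂
  have ht₁ : ∀ M : Matrix n n ℂ, (B₁ * M).trace = ∑ a, (s i a : ℂ) * M a a := fun M => by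
    simp [hB₁, Matrix.trace, Matrix.diagonal_mul]
  have ht₂ : ∀ M : Matrix n n ℂ, (B₂ * M).trace = M i i := fun M => by
    rw [hB₂, Matrix.trace_single_mul, one_smul]
  have hh₁ : hsSq B₁ ≤ N * S ^ 2 := by
    have : ∀ a, ∑ b, ‖B₁ a b‖ ^ 2 = s i a ^ 2 := fun a => by
      rw [Finset.sum_eq_single a (fun b _ hb => by simp [hB₁, Matrix.diagonal_apply_ne _ hb.symm])
        (by simp)]
      simp [hB₁]
    simp only [hsSq, this]
    calc ∑ a, s i a ^ 2 ≤ ∑ _a : n, S ^ 2 :=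
          Finset.sum_le_sum fun a _ => pow_le_pow_left₀ (hs i a) (hS i a) 2
      _ = N * S ^ 2 := by simp [hNdef]
  have hh₂ : hsSq B₂ = 1 := by
    have : ∀ a, ∑ b, ‖B₂ a b‖ ^ 2 = if a = i then 1 else 0 := fun a => by
      rw [Finset.sum_eq_single i (fun b _ hb => by simp [hB₂, hb.symm])
        (by simp)]
      by_cases h : i = a <;> simp [hB₂, h, eq_comm]
    simp [hsSq, this]
  obtain ⟨K₁, L₁, C₁, h₁⟩ := hE.exists_hasBoundedGradient hS hA hz hS0.le B₁
  obtain ⟨K₂, L₂, C₂, h₂⟩ := hE.exists_hasBoundedGradient hS hA hz hS0.le B₂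
  have hcov := norm_integral_mul_sub_le (h₁.memLp measurable_id 2) (h₂.memLp measurable_id 2)
    (a := S * √(N * S) / z.im ^ 2) (b := √S / z.im ^ 2) (by positivity) (by positivity)
    (by
      refine h₁.integral_norm_sub_integral_sq_le.trans ?_
      have : (S * √(N * S) / z.im ^ 2) ^ 2 = S * (N * S ^ 2) / z.im ^ 4 := by
        rw [div_pow, mul_pow, Real.sq_sqrt (by positivity)]; ring
      rw [this]
      gcongr)
    (by
      refine h₂.integral_norm_sub_integral_sq_le.trans ?_
      rw [div_pow, Real.sq_sqrt hS0.le, hh₂]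
      exact le_of_eq (by ring))
  simp only [id] at hcov
  rw [hE.integral_trace_mul_resolv hA hz, hE.integral_trace_mul_resolv hA hz, ht₁, ht₂] at hcov
  simp only [ht₁, ht₂] at hcov
  rw [hE.schwinger_dyson hS hS0.le hA hAd hz i, add_sub_cancel_left]
  have e1 : ∑ j, (s i j : ℂ) * (meanResolv E A z j j * meanResolv E A z i i) =
      (∑ j, (s i j : ℂ) * meanResolv E A z j j) * meanResolv E A z i i := by
    rw [Finset.sum_mul]
    exact Finset.sum_congr rfl fun j _ => by ring
  rw [e1]
  refine hcov.trans (le_of_eq ?_)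
  rw [Real.sqrt_mul hN.le, div_mul_div_comm, show S * (√N * √S) * √S = S * √N * (√S * √S) by ring,
    Real.mul_self_sqrt hS0.le]
  ring

end IsHermitianFrame

end MeanResolvent

/-! ### Gaussian coordinates for GUE matrices with a variance profile -/

section GUEFrame

variable {N : ℕ}

/-- The index pairs on and below the diagonal. -/
abbrev LowerPair (N : ℕ) : Type := {p : Fin N × Fin N // p.2 ≤ p.1}

/-- The pair on or below the diagonal with the same entries as `(a, b)`. -/
def lowerPair (a b : Fin N) : LowerPair N := ⟨(max a b, min a b), min_le_max⟩

theorem lowerPair_comm (a b : Fin N) : lowerPair a b = lowerPair b a := by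
  simp [lowerPair, max_comm, min_comm]

theorem lowerPair_of_le {a b : Fin N} (h : b ≤ a) : lowerPair a b = ⟨(a, b), h⟩ := by
  simp [lowerPair, h]

theorem lowerPair_eq_iff {a b d e : Fin N} :
    lowerPair a b = lowerPair d e ↔ (a = d ∧ b = e) ∨ (a = e ∧ b = d) := by
  constructor
  · intro h
    rcases le_total b a with h1 | h1 <;> rcases le_total e d with h2 | h2
    · rw [lowerPair_of_le h1, lowerPair_of_le h2] at h
      simpa using Or.inl h
    · rw [lowerPair_of_le h1, lowerPair_comm d e, lowerPair_of_le h2] at h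
      simp at h; tauto
    · rw [lowerPair_comm a b, lowerPair_of_le h1, lowerPair_of_le h2] at h
      simp at h; tauto
    · rw [lowerPair_comm a b, lowerPair_of_le h1, lowerPair_comm d e, lowerPair_of_le h2] at h
      simp at h; tauto
  · rintro (⟨rfl, rfl⟩ | ⟨rfl, rfl⟩)
    · rfl
    · exact lowerPair_comm _ _

/-- The coefficient of the first Gaussian coordinate in the `(a, b)` entry of a GUE array. -/
noncomputable def gueReCoef (a b : Fin N) : ℂ := if a = b then 1 else ((√2)⁻¹ : ℝ)

/-- The coefficient of the second Gaussian coordinate in the `(a, b)` entry of a GUE array. -/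
noncomputable def gueImCoef (a b : Fin N) : ℂ :=
  if b < a then ((√2)⁻¹ : ℝ) * Complex.I else if a < b then -(((√2)⁻¹ : ℝ) * Complex.I) else 0

theorem inv_sqrt_two_mul_self : (((√2)⁻¹ : ℝ) : ℂ) * ((√2)⁻¹ : ℝ) = 1 / 2 := by
  rw [← Complex.ofReal_mul, ← mul_inv, Real.mul_self_sqrt zero_le_two]
  simp

theorem gueReCoef_mul_add_gueImCoef_mul_comm (a b : Fin N) :
    gueReCoef a b * gueReCoef b a + gueImCoef a b * gueImCoef b a = 1 := by
  have h2 := inv_sqrt_two_mul_self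
  unfold gueReCoef gueImCoef
  rcases lt_trichotomy a b with h | h | h
  · simp only [h, h.ne, h.ne', h.not_gt, if_true, if_false]
    linear_combination (1 - Complex.I ^ 2) * h2 - 1 / 2 * Complex.I_sq
  · simp [h]
  · simp only [h, h.ne, h.ne', h.not_gt, if_true, if_false]
    linear_combination (1 - Complex.I ^ 2) * h2 - 1 / 2 * Complex.I_sq

theorem gueReCoef_mul_self_add {a b : Fin N} (hab : a ≠ b) :
    gueReCoef a b * gueReCoef a b + gueImCoef a b * gueImCoef a b = 0 := by
  have h2 := inv_sqrt_two_mul_self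
  unfold gueReCoef gueImCoef
  rcases lt_or_gt_of_ne hab with h | h
  · simp only [h, h.ne, h.not_gt, if_true, if_false]
    linear_combination (1 + Complex.I ^ 2) * h2 + 1 / 2 * Complex.I_sq
  · simp only [h, h.ne', if_true, if_false]
    linear_combination (1 + Complex.I ^ 2) * h2 + 1 / 2 * Complex.I_sq

theorem star_gueReCoef (a b : Fin N) : star (gueReCoef a b) = gueReCoef b a := by
  unfold gueReCoef
  rcases eq_or_ne a b with h | h
  · simp [h]
  · simp only [h, h.symm, if_false]
    exact Complex.conj_ofReal _

theorem star_gueImCoef (a b : Fin N) : star (gueImCoef a b) = gueImCoef b a := by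
  unfold gueImCoef
  rcases lt_trichotomy a b with h | h | h
  · simp [h, h.not_gt]
  · simp [h]
  · simp [h, h.not_gt]

/-- The matrix multiplying each Gaussian coordinate in a GUE matrix with variance profile. Each pair
on or below the diagonal carries two coordinates; on the diagonal the second one has coefficient
zero. -/
noncomputable def gueFrame (γ : Matrix (Fin N) (Fin N) ℝ) :
    LowerPair N ⊕ LowerPair N → Matrix (Fin N) (Fin N) ℂ
  | Sum.inl p => Matrix.of fun a b =>
      ((γ a b / √N : ℝ) : ℂ) * if lowerPair a b = p then gueReCoef a b else 0
  | Sum.inr p => Matrix.of fun a b =>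
      ((γ a b / √N : ℝ) : ℂ) * if lowerPair a b = p then gueImCoef a b else 0

theorem gaussMat_gueFrame_apply (γ : Matrix (Fin N) (Fin N) ℝ)
    (g : LowerPair N ⊕ LowerPair N → ℝ) (a b : Fin N) : gaussMat (gueFrame γ) g a b =
      ((γ a b / √N : ℝ) : ℂ) * (gueReCoef a b * g (Sum.inl (lowerPair a b)) +
        gueImCoef a b * g (Sum.inr (lowerPair a b))) := by
  rw [gaussMat, Fintype.sum_sum_type, Matrix.add_apply, Matrix.sum_apply, Matrix.sum_apply]
  simp only [gueFrame, Matrix.smul_apply, Matrix.of_apply, smul_eq_mul, mul_ite, mul_zero,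
    Finset.sum_ite_eq, Finset.mem_univ, if_true]
  ring

theorem isHermitianFrame_gueFrame {γ : Matrix (Fin N) (Fin N) ℝ} (hγ : γ.IsSymm) :
    IsHermitianFrame (varProfile γ) (gueFrame γ) := by
  have hsymm : ∀ a b, γ b a = γ a b := fun a b => hγ.apply a b
  constructor
  · rintro (p | p)
    all_goals
      ext a b
      simp only [gueFrame, Matrix.conjTranspose_apply, Matrix.of_apply, star_mul', hsymm a b,
        lowerPair_comm b a]
      congr 1
      · exact Complex.conj_ofReal _
      · split_ifs
        · first | exact star_gueReCoef b a | exact star_gueImCoef b a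
        · exact star_zero _
  · intro a b d e
    have h1 : ∑ c, gueFrame γ c a b * gueFrame γ c d e =
        ((γ a b / √N : ℝ) : ℂ) * ((γ d e / √N : ℝ) : ℂ) *
          if lowerPair a b = lowerPair d e then
            gueReCoef a b * gueReCoef d e + gueImCoef a b * gueImCoef d e else 0 := by
      rw [Fintype.sum_sum_type]
      simp only [gueFrame, Matrix.of_apply, mul_ite, ite_mul, mul_zero, zero_mul,
        Finset.sum_ite_eq, Finset.mem_univ, if_true]
      split_ifs
      · ring
      · simp
    rw [h1]
    have hN : ((γ a b / √N : ℝ) : ℂ) * ((γ a b / √N : ℝ) : ℂ) = (varProfile γ a b : ℂ) := by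
      rw [← Complex.ofReal_mul, varProfile, div_mul_div_comm,
        Real.mul_self_sqrt (Nat.cast_nonneg N), sq]
    by_cases hsw : a = e ∧ b = d
    · obtain ⟨rfl, rfl⟩ := hsw
      rw [if_pos (lowerPair_comm _ _), gueReCoef_mul_add_gueImCoef_mul_comm, hsymm a b, hN]
      simp
    · rw [if_neg hsw]
      by_cases heq : a = d ∧ b = e
      · obtain ⟨rfl, rfl⟩ := heq
        have hab : a ≠ b := fun h => hsw ⟨h, h.symm⟩
        rw [if_pos rfl, gueReCoef_mul_self_add hab, mul_zero]
      · rw [if_neg, mul_zero]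
        rw [lowerPair_eq_iff]
        tauto

end GUEFrame

section SignSymmetry

variable {κ : Type*} [Fintype κ]

theorem measurePreserving_sign_mul {σ : κ → ℝ} (hσ : ∀ c, σ c ^ 2 = 1) :
    MeasurePreserving (fun g c => σ c * g c) (stdGaussPi κ) (stdGaussPi κ) := by
  refine measurePreserving_pi _ _ fun c => ⟨by fun_prop, ?_⟩
  rw [gaussianReal_map_const_mul, mul_zero, mul_one]
  congr 1
  ext
  simp [hσ c]

variable {N : ℕ} {γ : Matrix (Fin N) (Fin N) ℝ} {Y : Matrix (Fin N) (Fin N) ℂ} {z : ℂ}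

/-- The mean resolvent is diagonal: flipping the sign of one row and the corresponding column does
not change the law of the Gaussian matrix. -/
theorem meanResolv_gueFrame_apply_ne (hγ : γ.IsSymm) (hY : Y.IsHermitian) (hYd : Y.IsDiag)
    (hz : 0 < z.im) {i j : Fin N} (hij : i ≠ j) : meanResolv (gueFrame γ) Y z i j = 0 := by
  set ε : Fin N → ℝ := fun a => if a = i then -1 else 1 with hε
  have hε2 : ∀ a, ε a * ε a = 1 := fun a => by
    simp only [hε]; split_ifs <;> norm_num
  set τ : LowerPair N → ℝ := fun p => ε p.1.1 * ε p.1.2 with hτ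
  have hτε : ∀ a b, τ (lowerPair a b) = ε a * ε b := fun a b => by
    rcases le_total b a with h | h
    · rw [lowerPair_of_le h]
    · rw [lowerPair_comm, lowerPair_of_le h, hτ, mul_comm]
  set σ : LowerPair N ⊕ LowerPair N → ℝ := Sum.elim τ τ with hσ
  have hσ2 : ∀ c, σ c ^ 2 = 1 := by
    rintro (p | p) <;>
    · simp only [hσ, Sum.elim_inl, Sum.elim_inr, hτ, sq]
      rw [mul_mul_mul_comm, hε2, hε2, one_mul]
  have hmp := measurePreserving_sign_mul hσ2
  set D : Matrix (Fin N) (Fin N) ℂ := Matrix.diagonal fun a => (ε a : ℂ) with hD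
  have hDD : D * D = 1 := by
    rw [hD, Matrix.diagonal_mul_diagonal, ← Matrix.diagonal_one]
    congr 1
    ext a
    exact_mod_cast hε2 a
  have hX : ∀ g : LowerPair N ⊕ LowerPair N → ℝ,
      gaussMat (gueFrame γ) (fun c => σ c * g c) = D * gaussMat (gueFrame γ) g * D := fun g => by
    ext a b
    rw [hD, Matrix.mul_diagonal, Matrix.diagonal_mul, gaussMat_gueFrame_apply,
      gaussMat_gueFrame_apply]
    simp only [hσ, Sum.elim_inl, Sum.elim_inr, hτε]
    push_cast
    ring
  have hYD : D * Y * D = Y := by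
    rw [← hYd.diagonal_diag, hD, Matrix.diagonal_mul_diagonal, Matrix.diagonal_mul_diagonal]
    congr 1
    ext a
    have : (ε a : ℂ) * ε a = 1 := by exact_mod_cast hε2 a
    linear_combination Y.diag a * this
  have hH := (isHermitianFrame_gueFrame hγ).isHermitian_gaussMat_add hY
  have hR : ∀ g : LowerPair N ⊕ LowerPair N → ℝ,
      resolv z (gaussMat (gueFrame γ) (fun c => σ c * g c) + Y) =
        D * resolv z (gaussMat (gueFrame γ) g + Y) * D := fun g => by
    refine Matrix.inv_eq_right_inv ?_
    have h1 : z • (1 : Matrix (Fin N) (Fin N) ℂ) -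
        (gaussMat (gueFrame γ) (fun c => σ c * g c) + Y) =
          D * (z • (1 : Matrix (Fin N) (Fin N) ℂ) - (gaussMat (gueFrame γ) g + Y)) * D := by
      rw [hX, mul_sub, sub_mul, mul_add, add_mul, hYD, mul_smul_comm, mul_one, smul_mul_assoc, hDD]
    rw [h1]
    calc D * (z • (1 : Matrix (Fin N) (Fin N) ℂ) - (gaussMat (gueFrame γ) g + Y)) * D *
          (D * resolv z (gaussMat (gueFrame γ) g + Y) * D)
        = D * ((z • (1 : Matrix (Fin N) (Fin N) ℂ) - (gaussMat (gueFrame γ) g + Y)) * (D * D) *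
          resolv z (gaussMat (gueFrame γ) g + Y)) * D := by simp only [mul_assoc]
      _ = 1 := by rw [hDD, mul_one, mul_resolv hz (hH g), mul_one, hDD]
  have hRij : ∀ g : LowerPair N ⊕ LowerPair N → ℝ,
      resolv z (gaussMat (gueFrame γ) (fun c => σ c * g c) + Y) i j =
        -resolv z (gaussMat (gueFrame γ) g + Y) i j := fun g => by
    rw [hR, hD, Matrix.mul_diagonal, Matrix.diagonal_mul]
    simp [hε, hij.symm]
  have h1 : meanResolv (gueFrame γ) Y z i j = -meanResolv (gueFrame γ) Y z i j := by
    rw [meanResolv_apply]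
    conv_lhs => rw [← hmp.map_eq]
    rw [integral_map hmp.measurable.aemeasurable]
    · simp only [hRij]
      exact integral_neg _
    · rw [hmp.map_eq]
      exact ((isHermitianFrame_gueFrame hγ).memLp_resolv hY hz i j 1).aestronglyMeasurable
  exact self_eq_neg.1 h1

end SignSymmetry

section Law

variable {Ω : Type*} [MeasurableSpace Ω] {P : Measure Ω} {N : ℕ}

/-- The entries on and below the diagonal of a GUE array, as functions of Gaussian coordinates. -/
noncomputable def gueLower (g : LowerPair N ⊕ LowerPair N → ℝ) (p : LowerPair N) : ℂ :=
  gueReCoef p.1.1 p.1.2 * g (Sum.inl p) + gueImCoef p.1.1 p.1.2 * g (Sum.inr p)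

theorem stdComplexGaussian_eq_map :
    ((gaussianReal 0 1).prod (gaussianReal 0 1)).map (fun q : ℝ × ℝ =>
      (((√2)⁻¹ : ℝ) : ℂ) * q.1 + ((√2)⁻¹ : ℝ) * Complex.I * q.2) = stdComplexGaussian := by
  have h1 : gaussianReal 0 (1 / 2) = (gaussianReal 0 1).map fun t => (√2)⁻¹ * t := by
    rw [gaussianReal_map_const_mul, mul_zero, mul_one]
    congr 1
    ext
    simp
  have hm : Measurable fun p : ℝ × ℝ => (⟨p.1, p.2⟩ : ℂ) :=
    Complex.measurableEquivRealProd.symm.measurable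
  rw [stdComplexGaussian, h1, Measure.map_prod_map _ _ (by fun_prop) (by fun_prop),
    Measure.map_map hm (by fun_prop)]
  congr 1
  ext q
  generalize (√2)⁻¹ = r
  apply Complex.ext <;> simp

theorem map_gueLower_stdGaussPi :
    (stdGaussPi (LowerPair N ⊕ LowerPair N)).map gueLower = Measure.pi fun p : LowerPair N =>
      ((gaussianReal 0 1).prod (gaussianReal 0 1)).map fun q : ℝ × ℝ =>
        gueReCoef p.1.1 p.1.2 * q.1 + gueImCoef p.1.1 p.1.2 * q.2 := by
  have h1 := measurePreserving_sumPiEquivProdPi (ι := LowerPair N) (ι' := LowerPair N)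
    (X := fun _ => ℝ) fun _ => gaussianReal 0 1
  have h2 := measurePreserving_arrowProdEquivProdArrow ℝ ℝ (LowerPair N) (fun _ => gaussianReal 0 1)
    fun _ => gaussianReal 0 1
  have h2' := h2.symm (MeasurableEquiv.arrowProdEquivProdArrow ℝ ℝ (LowerPair N))
  have h3 := h2'.comp h1
  have hm : Measurable fun (v : LowerPair N → ℝ × ℝ) (p : LowerPair N) =>
      gueReCoef p.1.1 p.1.2 * ((v p).1 : ℂ) + gueImCoef p.1.1 p.1.2 * ((v p).2 : ℂ) := by
    fun_prop
  rw [← Measure.pi_map_pi fun p => by fun_prop, ← h3.map_eq, Measure.map_map hm h3.measurable]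
  rfl

theorem IsGUEArray.map_lower [IsProbabilityMeasure P] {x : Fin N → Fin N → Ω → ℂ}
    (hx : IsGUEArray P x) : P.map (fun ω (p : LowerPair N) => x p.1.1 p.1.2 ω) =
      (stdGaussPi (LowerPair N ⊕ LowerPair N)).map gueLower := by
  have hlaw : ∀ p : LowerPair N, HasLaw (x p.1.1 p.1.2)
      (((gaussianReal 0 1).prod (gaussianReal 0 1)).map fun q : ℝ × ℝ =>
        gueReCoef p.1.1 p.1.2 * q.1 + gueImCoef p.1.1 p.1.2 * q.2) P := by
    rintro ⟨⟨i, j⟩, hji⟩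
    rcases eq_or_ne i j with rfl | hij
    · have h := hx.law_diag i
      convert h using 1
      have h2 : (fun q : ℝ × ℝ => gueReCoef i i * (q.1 : ℂ) + gueImCoef i i * (q.2 : ℂ)) =
          (fun t : ℝ => (t : ℂ)) ∘ Prod.fst := by
        ext q; simp [gueReCoef, gueImCoef]
      rw [h2, ← Measure.map_map Complex.measurable_ofReal measurable_fst, Measure.map_fst_prod]
      simp
    · have h := hx.law_offDiag i j hij
      rw [← stdComplexGaussian_eq_map] at h
      convert h using 4
      · simp [gueReCoef, hij]
      · simp [gueImCoef, lt_of_le_of_ne hji hij.symm]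
  rw [(iIndepFun_iff_map_fun_eq_pi_map fun p => (hlaw p).aemeasurable).1 hx.indep,
    map_gueLower_stdGaussPi]
  congr 1
  ext p : 1
  exact (hlaw p).map_eq

/-- The Hermitian matrix with variance profile built from its entries on and below the diagonal.
Only the real parts of diagonal entries are used, so that the result is Hermitian for every
input. -/
noncomputable def ofLower (γ : Matrix (Fin N) (Fin N) ℝ) (y : LowerPair N → ℂ) :
    Matrix (Fin N) (Fin N) ℂ :=
  Matrix.of fun a b => ((γ a b / √N : ℝ) : ℂ) *
    if a = b then ((y (lowerPair a b)).re : ℂ) else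
      if b < a then y (lowerPair a b) else star (y (lowerPair a b))

theorem isHermitian_ofLower {γ : Matrix (Fin N) (Fin N) ℝ} (hγ : γ.IsSymm)
    (y : LowerPair N → ℂ) : (ofLower γ y).IsHermitian := by
  ext a b
  simp only [ofLower, Matrix.conjTranspose_apply, Matrix.of_apply, star_mul', hγ.apply a b,
    lowerPair_comm b a]
  congr 1
  · exact Complex.conj_ofReal _
  · rcases lt_trichotomy a b with h | h | h
    · simp [h.ne, h.ne', h, h.not_gt]
    · simp [h]
    · simp [h.ne, h.ne', h, h.not_gt]

theorem continuous_ofLower (γ : Matrix (Fin N) (Fin N) ℝ) : Continuous (ofLower γ) := by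
  refine continuous_matrix fun a b => ?_
  simp only [ofLower, Matrix.of_apply]
  split_ifs
  · exact continuous_const.mul (Complex.continuous_ofReal.comp
      (Complex.continuous_re.comp (continuous_apply _)))
  · exact continuous_const.mul (continuous_apply _)
  · exact continuous_const.mul (continuous_apply (lowerPair a b)).star

theorem ofLower_gueLower {γ : Matrix (Fin N) (Fin N) ℝ} (g : LowerPair N ⊕ LowerPair N → ℝ) :
    ofLower γ (gueLower g) = gaussMat (gueFrame γ) g := by
  ext a b
  rw [gaussMat_gueFrame_apply, ofLower, Matrix.of_apply]
  congr 1
  rcases lt_trichotomy a b with h | h | h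
  · rw [if_neg h.ne, if_neg h.not_gt, gueLower, lowerPair_comm a b, lowerPair_of_le h.le, star_add,
      star_mul', star_mul', star_gueReCoef, star_gueImCoef]
    congr 2 <;> exact Complex.conj_ofReal _
  · subst h
    rw [if_pos rfl, gueLower, lowerPair_of_le le_rfl]
    simp [gueReCoef, gueImCoef]
  · rw [if_neg h.ne', if_pos h, gueLower, lowerPair_of_le h.le]

theorem IsGUEArray.gueVarProfile_eq {x : Fin N → Fin N → Ω → ℂ} (hx : IsGUEArray P x)
    (γ : Matrix (Fin N) (Fin N) ℝ) (ω : Ω) :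
    gueVarProfile γ x ω = ofLower γ fun p => x p.1.1 p.1.2 ω := by
  ext a b
  have h0 : ∀ v : ℂ, (γ a b : ℂ) * (v / (√N : ℂ)) = ((γ a b / √N : ℝ) : ℂ) * v := fun v => by
    push_cast; ring
  rw [gueVarProfile, ofLower, Matrix.of_apply, Matrix.of_apply, h0]
  congr 1
  rcases lt_trichotomy a b with h | h | h
  · rw [if_neg h.ne, if_neg h.not_gt, lowerPair_comm a b, lowerPair_of_le h.le]
    exact hx.herm b a ω
  · subst h
    rw [if_pos rfl, lowerPair_of_le le_rfl]
    exact (Complex.conj_eq_iff_re.1 (hx.herm a a ω).symm).symm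
  · rw [if_neg h.ne', if_pos h, lowerPair_of_le h.le]

end Law

/-! ### Bounds in terms of the largest entry of the profile -/

section Profile

variable {N : ℕ} {γ : Matrix (Fin N) (Fin N) ℝ}

theorem le_gammaMax (γ : Matrix (Fin N) (Fin N) ℝ) (i j : Fin N) : γ i j ≤ gammaMax γ :=
  le_ciSup (f := fun p : Fin N × Fin N => γ p.1 p.2) (Set.finite_range _).bddAbove (i, j)

theorem natCast_pos_of_gammaMax_pos (hγ : 0 < gammaMax γ) : 0 < (N : ℝ) := by
  rcases Nat.eq_zero_or_pos N with rfl | h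
  · simp [gammaMax] at hγ
  · exact_mod_cast h

theorem varProfile_le (hγ : ∀ i j, 0 ≤ γ i j) (i j : Fin N) :
    varProfile γ i j ≤ gammaMax γ ^ 2 / N :=
  div_le_div_of_nonneg_right (pow_le_pow_left₀ (hγ i j) (le_gammaMax γ i j) 2) (Nat.cast_nonneg N)

theorem sum_varProfile_le (hγ : ∀ i j, 0 ≤ γ i j) (i : Fin N) :
    ∑ j, varProfile γ i j ≤ gammaMax γ ^ 2 := by
  have hN : (0 : ℝ) < N := Nat.cast_pos.2 i.pos
  calc ∑ j, varProfile γ i j ≤ ∑ _j : Fin N, gammaMax γ ^ 2 / N :=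
        Finset.sum_le_sum fun j _ => varProfile_le hγ i j
    _ = gammaMax γ ^ 2 := by
        rw [Finset.sum_const, Finset.card_univ, Fintype.card_fin, nsmul_eq_mul,
          mul_div_cancel₀ _ hN.ne']

theorem pow_six_le_of_rpow_le {g δ η : ℝ} {M : ℝ} (hg : 0 ≤ g) (hM : 0 < M) (hδ : δ < 1)
    (h : g * M ^ (-(1 / 4) : ℝ) * (1 - δ) ^ (-(1 / 6) : ℝ) ≤ η) :
    g ^ 6 ≤ (1 - δ) * M ^ (3 / 2 : ℝ) * η ^ 6 := by
  have hδ' : 0 < 1 - δ := by linarith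
  have h1 := pow_le_pow_left₀ (by positivity) h 6
  have e1 : (M ^ (-(1 / 4) : ℝ)) ^ 6 = (M ^ (3 / 2 : ℝ))⁻¹ := by
    rw [← Real.rpow_natCast, ← Real.rpow_mul hM.le, ← Real.rpow_neg hM.le]
    norm_num
  have e2 : ((1 - δ) ^ (-(1 / 6) : ℝ)) ^ 6 = (1 - δ)⁻¹ := by
    rw [← Real.rpow_natCast, ← Real.rpow_mul hδ'.le, ← Real.rpow_neg_one]
    norm_num
  rw [mul_pow, mul_pow, e1, e2] at h1
  have hM' : 0 < M ^ (3 / 2 : ℝ) := by positivity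
  rw [← div_eq_mul_inv, ← div_eq_mul_inv, div_div, div_le_iff₀ (by positivity)] at h1
  linarith

/-- The bias of the resolvent. Both matrices are diagonal, so it suffices to compare diagonal
entries, which is the stability of the Dyson equation. -/
theorem norm_meanResolv_sub_detEquiv_le {Y : Matrix (Fin N) (Fin N) ℂ} {z : ℂ} {δ : ℝ}
    (hγs : γ.IsSymm) (hγ : ∀ i j, 0 ≤ γ i j) (hγmax : 0 < gammaMax γ) (hY : Y.IsHermitian)
    (hYd : Y.IsDiag) (hz : 0 < z.im) (hδ0 : 0 < δ) (hδ1 : δ < 1)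
    (hη : gammaMax γ * (N : ℝ) ^ (-(1 / 4) : ℝ) * (1 - δ) ^ (-(1 / 6) : ℝ) ≤ z.im) :
    ‖meanResolv (gueFrame γ) Y z - detEquiv γ Y (z • (1 : Matrix (Fin N) (Fin N) ℂ))‖ ≤
      (1 + gammaMax γ ^ 2 / (δ * z.im ^ 2)) *
        (gammaMax γ ^ 4 / ((N : ℝ) ^ (3 / 2 : ℝ) * z.im ^ 5)) := by
  set g := gammaMax γ with hg
  have hN := natCast_pos_of_gammaMax_pos hγmax
  have hE := isHermitianFrame_gueFrame hγs
  have hN32 : (N : ℝ) ^ (3 / 2 : ℝ) = N * √N := by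
    rw [Real.sqrt_eq_rpow, ← Real.rpow_one_add' hN.le (by norm_num)]
    norm_num
  have hε : ∀ i, ‖(z - Y i i) * meanResolv (gueFrame γ) Y z i i - 1 - ∑ j,
      (varProfile γ i j : ℂ) * (meanResolv (gueFrame γ) Y z j j *
        meanResolv (gueFrame γ) Y z i i)‖ ≤ (g ^ 2 / N) ^ 2 * √N / z.im ^ 4 := fun i => by
    have h := hE.norm_schwinger_dyson_error_le (varProfile_nonneg γ) (varProfile_le hγ)
      (by positivity) hY hYd hz i
    rwa [Fintype.card_fin] at h
  have hdiv : (g ^ 2 / N) ^ 2 * √N / z.im ^ 4 / z.im =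
      g ^ 4 / ((N : ℝ) ^ (3 / 2 : ℝ) * z.im ^ 5) := by
    have hs : √(N : ℝ) ≠ 0 := (Real.sqrt_pos.2 hN).ne'
    have hs2 : √(N : ℝ) ^ 2 = N := Real.sq_sqrt hN.le
    rw [hN32]
    field_simp
    rw [hs2]
  have hsmall : g ^ 2 * ((g ^ 2 / N) ^ 2 * √N / z.im ^ 4 / z.im) ≤ (1 - δ) * z.im := by
    have h := pow_six_le_of_rpow_le hγmax.le hN hδ1 hη
    rw [hdiv, ← mul_div_assoc, div_le_iff₀ (by positivity)]
    linarith
  have him : ∀ i, (z - Y i i).im = z.im := fun i => by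
    simpa using im_sub_diag_of_isHermitian hY (z • (1 : Matrix (Fin N) (Fin N) ℂ)) i
  have hdiag := norm_sub_dysonSol_le (w := fun i => z - Y i i) (varProfile_nonneg γ)
    (sum_varProfile_le hγ) hz hδ0 (fun i => (him i).ge)
    (hE.meanResolv_im_nonpos hY hz) hε hsmall
  have heq : meanResolv (gueFrame γ) Y z - detEquiv γ Y (z • (1 : Matrix (Fin N) (Fin N) ℂ)) =
      Matrix.diagonal fun i => meanResolv (gueFrame γ) Y z i i -
        dysonSol (varProfile γ) (fun i => z - Y i i) i := by
    ext i j
    rw [Matrix.sub_apply, detEquiv]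
    rcases eq_or_ne i j with rfl | hij
    · simp
    · rw [meanResolv_gueFrame_apply_ne hγs hY hYd hz hij, Matrix.diagonal_apply_ne _ hij,
        Matrix.diagonal_apply_ne _ hij, sub_zero]
  rw [heq, Matrix.l2_opNorm_diagonal, ← hdiv]
  exact (pi_norm_le_iff_of_nonneg (by positivity)).2 hdiag

end Profile

/-! ### Concentration of the compressed resolvent -/

section Compression

variable {m n : Type*} [Fintype n] {U : Matrix n m ℂ}

theorem conjTranspose_mul_mul_apply (U : Matrix n m ℂ) (M : Matrix n n ℂ) (a b : m) :
    (U.conjTranspose * M * U) a b =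
      (Matrix.vecMulVec (fun i => U i b) (fun j => star (U j a)) * M).trace := by
  simp only [Matrix.trace, Matrix.diag_apply, Matrix.mul_apply, Matrix.vecMulVec_apply,
    Matrix.conjTranspose_apply, Finset.sum_mul]
  exact Finset.sum_congr rfl fun i _ => Finset.sum_congr rfl fun j _ => by ring

theorem hsSq_vecMulVec [Fintype m] (u : m → ℂ) (v : n → ℂ) :
    hsSq (Matrix.vecMulVec u v) = (∑ i, ‖u i‖ ^ 2) * ∑ j, ‖v j‖ ^ 2 := by
  simp only [hsSq, Matrix.vecMulVec_apply, norm_mul, mul_pow, Finset.sum_mul_sum]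

variable [DecidableEq m]

theorem sum_norm_col_sq_eq_one (hU : U.conjTranspose * U = 1) (a : m) :
    ∑ i, ‖U i a‖ ^ 2 = 1 := by
  have h := congrFun (congrFun hU a) a
  rw [Matrix.mul_apply, Matrix.one_apply_eq] at h
  rw [← Complex.ofReal_inj, Complex.ofReal_one, ← h, Complex.ofReal_sum]
  refine Finset.sum_congr rfl fun i _ => ?_
  rw [Matrix.conjTranspose_apply, Complex.ofReal_pow]
  exact (Complex.conj_mul' _).symm

theorem hsSq_vecMulVec_col_eq_one (hU : U.conjTranspose * U = 1) (a b : m) :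
    hsSq (Matrix.vecMulVec (fun i => U i b) fun j => star (U j a)) = 1 := by
  simp only [hsSq_vecMulVec, norm_star, sum_norm_col_sq_eq_one hU, mul_one]

variable [Fintype m]

theorem norm_lt_of_norm_apply_lt [Nonempty m] {D : Matrix m m ℂ} {t : ℝ}
    (h : ∀ a b, ‖D a b‖ < t) : ‖D‖ < Fintype.card m * t := by
  have ht : 0 < t := (norm_nonneg _).trans_lt (h (Classical.arbitrary m) (Classical.arbitrary m))
  refine (l2_opNorm_le_sqrt_hsSq D).trans_lt ?_
  rw [Real.sqrt_lt' (by have := Fintype.card_pos (α := m); positivity)]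
  calc hsSq D < ∑ _a : m, ∑ _b : m, t ^ 2 :=
        Finset.sum_lt_sum_of_nonempty Finset.univ_nonempty fun a _ =>
          Finset.sum_lt_sum_of_nonempty Finset.univ_nonempty fun b _ =>
            pow_lt_pow_left₀ (h a b) (norm_nonneg _) two_ne_zero
    _ = (Fintype.card m * t) ^ 2 := by
        simp only [Finset.sum_const, Finset.card_univ, nsmul_eq_mul]
        ring

theorem norm_le_one_of_conjTranspose_mul_self (hU : U.conjTranspose * U = 1) : ‖U‖ ≤ 1 := by
  have h := Matrix.l2_opNorm_conjTranspose_mul_self U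
  rw [hU, ← Matrix.diagonal_one, Matrix.l2_opNorm_diagonal] at h
  have h1 : ‖fun _ : m => (1 : ℂ)‖ ≤ 1 :=
    (pi_norm_le_iff_of_nonneg zero_le_one).2 fun _ => norm_one.le
  nlinarith [norm_nonneg U]

theorem norm_conjTranspose_mul_mul_le [DecidableEq n] (hU : U.conjTranspose * U = 1)
    (M : Matrix n n ℂ) : ‖U.conjTranspose * M * U‖ ≤ ‖M‖ := by
  have h1 := norm_le_one_of_conjTranspose_mul_self hU
  calc ‖U.conjTranspose * M * U‖ ≤ ‖U.conjTranspose * M‖ * ‖U‖ := Matrix.l2_opNorm_mul _ _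
    _ ≤ (‖U.conjTranspose‖ * ‖M‖) * ‖U‖ :=
        mul_le_mul_of_nonneg_right (Matrix.l2_opNorm_mul _ _) (norm_nonneg _)
    _ = (‖U‖ * ‖M‖) * ‖U‖ := by rw [Matrix.l2_opNorm_conjTranspose]
    _ ≤ (1 * ‖M‖) * 1 := by gcongr
    _ = ‖M‖ := by ring

end Compression

section Concentration

variable {Ω : Type*} [MeasurableSpace Ω] {P : Measure Ω} [IsProbabilityMeasure P] {N : ℕ}
  {x : Fin N → Fin N → Ω → ℂ} {γ : Matrix (Fin N) (Fin N) ℝ} {Y : Matrix (Fin N) (Fin N) ℂ}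
  {z : ℂ}

/-- Linear functionals of the resolvent of `X + Y` concentrate around their mean. The array is only
assumed to have the GUE law, so the probability is first transferred to Gaussian coordinates. -/
theorem IsGUEArray.measureReal_le_norm_trace_sub_le (hx : IsGUEArray P x) (hγs : γ.IsSymm)
    (hγ : ∀ i j, 0 ≤ γ i j) (hγmax : 0 < gammaMax γ) (hY : Y.IsHermitian) (hz : 0 < z.im)
    (B : Matrix (Fin N) (Fin N) ℂ) (hB : 0 < hsSq B) {t : ℝ} (ht : 0 ≤ t) :
    P.real {ω | t ≤ ‖(B * resolv z (gueVarProfile γ x ω + Y)).trace -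
      (B * meanResolv (gueFrame γ) Y z).trace‖} ≤
      2 * Real.exp (-(t ^ 2 / (2 * (gammaMax γ ^ 2 / N * hsSq B / z.im ^ 4)))) := by
  have hN := natCast_pos_of_gammaMax_pos hγmax
  have hE := isHermitianFrame_gueFrame hγs
  set m := (B * meanResolv (gueFrame γ) Y z).trace with hm
  set A : Set (LowerPair N → ℂ) :=
    {y | t ≤ ‖(B * resolv z (ofLower γ y + Y)).trace - m‖} with hA
  have hAm : MeasurableSet A := by
    have hc : Continuous fun y => resolv z (ofLower γ y + Y) :=
      continuous_resolv ((continuous_ofLower γ).add continuous_const)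
        (fun y => (isHermitian_ofLower hγs y).add hY) hz
    exact (isClosed_le continuous_const (((Continuous.matrix_trace
      (continuous_const.matrix_mul hc)).sub continuous_const).norm)).measurableSet
  have hxm : AEMeasurable (fun ω (p : LowerPair N) => x p.1.1 p.1.2 ω) P := by
    refine aemeasurable_pi_lambda _ fun p => ?_
    by_cases h : p.1.1 = p.1.2
    · rw [← h]; exact (hx.law_diag _).aemeasurable
    · exact (hx.law_offDiag _ _ h).aemeasurable
  have hgm : Measurable (gueLower (N := N)) := by
    unfold gueLower
    fun_prop
  have h1 : P.real {ω | t ≤ ‖(B * resolv z (gueVarProfile γ x ω + Y)).trace - m‖} =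
      (stdGaussPi (LowerPair N ⊕ LowerPair N)).real
        {g | t ≤ ‖(B * resolv z (gaussMat (gueFrame γ) g + Y)).trace - m‖} := by
    have h2 := congrArg (fun μ => Measure.real μ A) hx.map_lower
    simp only [measureReal_def, Measure.map_apply_of_aemeasurable hxm hAm,
      Measure.map_apply hgm hAm] at h2
    simp only [measureReal_def, hx.gueVarProfile_eq, ← ofLower_gueLower]
    exact h2
  obtain ⟨K, L, C, hF⟩ := hE.exists_hasBoundedGradient (varProfile_le hγ) hY hz (by positivity) B
  have h3 := hF.measureReal_le_norm_sub_integral_le (by positivity) ht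
  rw [hE.integral_trace_mul_resolv hY hz] at h3
  rw [h1]
  exact h3

theorem two_mul_exp_neg_eq {M g d η : ℝ} (hM : 1 ≤ M) (hg : 0 < g) (hd : 0 < d) (hη : 0 < η) :
    2 * Real.exp (-((√2 * g * (√(d * Real.log M) / η ^ 2) * M ^ (-(1 / 2) : ℝ)) ^ 2 /
      (2 * (g ^ 2 / M * 1 / η ^ 4)))) = 2 * M ^ (-d) := by
  have hM0 : 0 < M := zero_lt_one.trans_le hM
  have e1 : (M ^ (-(1 / 2) : ℝ)) ^ 2 = M⁻¹ := by
    rw [← Real.rpow_natCast, ← Real.rpow_mul hM0.le, ← Real.rpow_neg_one]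
    norm_num
  rw [mul_pow, mul_pow, mul_pow, div_pow, e1, Real.sq_sqrt zero_le_two,
    Real.sq_sqrt (mul_nonneg hd.le (Real.log_nonneg hM)), Real.rpow_def_of_pos hM0]
  congr 3
  field_simp

/-- A deviation of the compressed resolvent forces a deviation of one of its `k²` entries, and each
entry is a linear functional `Tr (B R)` with `B` of Hilbert–Schmidt norm one. -/
theorem IsGUEArray.measureReal_le_norm_betaMat_sub_le {k : ℕ} (hx : IsGUEArray P x) (hk : 0 < k)
    (hγs : γ.IsSymm) (hγ : ∀ i j, 0 ≤ γ i j) (hγmax : 0 < gammaMax γ) (hY : Y.IsHermitian)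
    (hz : 0 < z.im) {U : Matrix (Fin N) (Fin k) ℂ} (hU : U.conjTranspose * U = 1)
    {Θ : Matrix (Fin k) (Fin k) ℂ} (hΘ : 0 < ‖Θ‖)
    {G : Matrix (Fin N) (Fin N) ℂ → Matrix (Fin N) (Fin N) ℂ} {d e : ℝ} (hd : 0 < d)
    (he : ‖meanResolv (gueFrame γ) Y z - G (z • (1 : Matrix (Fin N) (Fin N) ℂ))‖ ≤ e) :
    P.real {ω | ‖Θ‖ * (√2 * k * gammaMax γ * (√(d * Real.log N) / z.im ^ 2) *
        (N : ℝ) ^ (-(1 / 2) : ℝ) + e) ≤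
      ‖betaMat (gueVarProfile γ x ω + Y) U Θ z - betaSquare G U Θ z‖} ≤
      2 * (k : ℝ) ^ 2 * (N : ℝ) ^ (-d) := by
  have hN1 : 1 ≤ (N : ℝ) := by exact_mod_cast natCast_pos_of_gammaMax_pos hγmax
  have : Nonempty (Fin k) := ⟨⟨0, hk⟩⟩
  set t : ℝ := √2 * gammaMax γ * (√(d * Real.log N) / z.im ^ 2) * (N : ℝ) ^ (-(1 / 2) : ℝ) with ht
  have ht0 : 0 ≤ t := by positivity
  set M := meanResolv (gueFrame γ) Y z with hM
  set B : Fin k × Fin k → Matrix (Fin N) (Fin N) ℂ := fun p =>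
    Matrix.vecMulVec (fun i => U i p.2) fun j => star (U j p.1) with hB
  have hB1 : ∀ p, hsSq (B p) = 1 := fun p => hsSq_vecMulVec_col_eq_one hU p.1 p.2
  set A : Fin k × Fin k → Set Ω := fun p => {ω | t ≤
    ‖(B p * resolv z (gueVarProfile γ x ω + Y)).trace - (B p * M).trace‖} with hA
  have hAp : ∀ p, P.real (A p) ≤ 2 * (N : ℝ) ^ (-d) := fun p => by
    have h := hx.measureReal_le_norm_trace_sub_le hγs hγ hγmax hY hz (B p)
      (by rw [hB1]; exact one_pos) ht0
    rwa [hB1, ht, two_mul_exp_neg_eq hN1 hγmax hd hz] at h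
  have hsub : {ω | ‖Θ‖ * (√2 * k * gammaMax γ * (√(d * Real.log N) / z.im ^ 2) *
        (N : ℝ) ^ (-(1 / 2) : ℝ) + e) ≤
      ‖betaMat (gueVarProfile γ x ω + Y) U Θ z - betaSquare G U Θ z‖} ⊆ ⋃ p, A p := by
    intro ω hω
    by_contra hcon
    simp only [hA, Set.mem_iUnion, Set.mem_ofPred_eq, not_exists, not_le] at hcon
    set R := resolv z (gueVarProfile γ x ω + Y) with hR
    set D := U.conjTranspose * (R - M) * U with hD
    have hDt : ‖D‖ < k * t := by
      have h := norm_lt_of_norm_apply_lt (D := D) (t := t) fun a b => by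
        rw [hD, conjTranspose_mul_mul_apply, mul_sub, Matrix.trace_sub]
        exact hcon (a, b)
      rwa [Fintype.card_fin] at h
    have heq : betaMat (gueVarProfile γ x ω + Y) U Θ z - betaSquare G U Θ z =
        -((D + U.conjTranspose * (M - G (z • (1 : Matrix (Fin N) (Fin N) ℂ))) * U) * Θ) := by
      rw [betaMat, betaSquare, hD, ← resolv, ← hR]
      simp only [Matrix.mul_sub, Matrix.sub_mul, Matrix.add_mul]
      abel
    have hlt : ‖betaMat (gueVarProfile γ x ω + Y) U Θ z - betaSquare G U Θ z‖ <
        ‖Θ‖ * (k * t + e) := by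
      rw [heq, norm_neg]
      calc _ ≤ ‖D + U.conjTranspose * (M - G (z • (1 : Matrix (Fin N) (Fin N) ℂ))) * U‖ * ‖Θ‖ :=
            norm_mul_le _ _
        _ ≤ (‖D‖ + e) * ‖Θ‖ := by
            gcongr
            exact (norm_add_le _ _).trans
              (add_le_add_right ((norm_conjTranspose_mul_mul_le hU _).trans he) _)
        _ < (k * t + e) * ‖Θ‖ := by gcongr
        _ = _ := mul_comm _ _
    have hkt : √2 * k * gammaMax γ * (√(d * Real.log N) / z.im ^ 2) * (N : ℝ) ^ (-(1 / 2) : ℝ) =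
        k * t := by rw [ht]; ring
    rw [Set.mem_ofPred_eq, hkt] at hω
    exact absurd hω (not_le.2 hlt)
  calc _ ≤ P.real (⋃ p, A p) := measureReal_mono hsub
    _ ≤ ∑ p, P.real (A p) := measureReal_iUnion_fintype_le _
    _ ≤ ∑ _p : Fin k × Fin k, 2 * (N : ℝ) ^ (-d) := Finset.sum_le_sum fun p _ => hAp p
    _ = 2 * (k : ℝ) ^ 2 * (N : ℝ) ^ (-d) := by
        simp only [Finset.sum_const, Finset.card_univ, Fintype.card_prod, Fintype.card_fin,
          nsmul_eq_mul, Nat.cast_mul]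
        ring

end Concentration

theorem corollary1p3 {Ω : Type*} [MeasurableSpace Ω] (P : Measure Ω) [IsProbabilityMeasure P]
    {N k : ℕ} (hk : 0 < k)
    (γ : Matrix (Fin N) (Fin N) ℝ) (hγsymm : γ.IsSymm) (hγnonneg : ∀ i j, 0 ≤ γ i j)
    (hγmax : 0 < gammaMax γ)
    (x : Fin N → Fin N → Ω → ℂ) (hx : IsGUEArray P x)
    (Y : Matrix (Fin N) (Fin N) ℂ) (hYherm : Y.IsHermitian) (hYdiag : Y.IsDiag)
    (θ : Fin k → ℝ) (hθ : ∀ i, θ i ≠ 0)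
    (U : Matrix (Fin N) (Fin k) ℂ) (hU : U.conjTranspose * U = 1) :
    ∃ G : Matrix (Fin N) (Fin N) ℂ → Matrix (Fin N) (Fin N) ℂ,
      IsDetEquiv γ Y G ∧
      (∀ G' : Matrix (Fin N) (Fin N) ℂ → Matrix (Fin N) (Fin N) ℂ,
        IsDetEquiv γ Y G' → Set.EqOn G' G (diagPlus N)) ∧
      ∀ δ : ℝ, 0 < δ → δ < 1 → ∀ d : ℝ, 0 < d → ∀ z : ℂ, 0 < z.im →
        gammaMax γ * (N : ℝ) ^ (-(1 / 4) : ℝ) * (1 - δ) ^ (-(1 / 6) : ℝ) ≤ z.im →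
        P.real {ω | ‖Matrix.diagonal (fun i => (θ i : ℂ))‖ *
              epsPrime N k (gammaMax γ) δ d z.im ≤
            ‖betaMat (gueVarProfile γ x ω + Y) U (Matrix.diagonal (fun i => (θ i : ℂ))) z -
              betaSquare G U (Matrix.diagonal (fun i => (θ i : ℂ))) z‖} ≤
          4 * (k : ℝ) ^ 2 * (N : ℝ) ^ (-d) := by
  refine ⟨detEquiv γ Y, isDetEquiv_detEquiv γ hYherm hYdiag, fun G' hG' =>
    (isDetEquiv_detEquiv γ hYherm hYdiag).eqOn hYherm hYdiag hG', ?_⟩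
  intro δ hδ0 hδ1 d hd z hz hη
  have hΘ : 0 < ‖Matrix.diagonal (fun i => (θ i : ℂ))‖ := by
    refine norm_pos_iff.2 fun h => hθ ⟨0, hk⟩ ?_
    have h0 := congrFun (congrFun h ⟨0, hk⟩) ⟨0, hk⟩
    rw [Matrix.diagonal_apply_eq, Matrix.zero_apply] at h0
    exact_mod_cast h0
  refine (hx.measureReal_le_norm_betaMat_sub_le hk hγsymm hγnonneg hγmax hYherm hz hU hΘ hd
    (norm_meanResolv_sub_detEquiv_le hγsymm hγnonneg hγmax hYherm hYdiag hz hδ0 hδ1 hη)).trans ?_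
  -- The union bound gives the constant `2` in place of `4`.
  gcongr
  norm_num
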